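/- **Conventions.** A *piece* is a convex polygon in $\mathbb R^2$ with nonempty interior. An instance is a finite list of pieces, each given by a finite list of points of which it is the convex hull (for example its corners); its size is the total number of listed points. Pieces may only be translated, and a *packing* assigns a translation to each piece such that the translated pieces have pairwise disjoint interiors (in bin packing: such that this holds for any two pieces in the same bin). An algorithm is a program of a real RAM (natural numbers with addition, truncated subtraction and comparison, used for addressing; exact real numbers with rational constants, the four arithmetic operations and comparison; unit cost per step; no rounding and no roots), and *polynomial time* means that the number of steps is bounded by a polynomial in the size of the instance. A *$c$-approximation algorithm* outputs on every instance a feasible solution of cost at most $c\cdot\mathrm{OPT}$, where $\mathrm{OPT}$ is the infimum of the costs of all feasible solutions of the instance. **Theorem 6.** There are polynomial-time algorithms for the following offline translational packing problems. (a) *Strip packing* (pack the pieces into the strip $[0,\infty)\times[0,1]$, minimizing the largest $x$-coordinate that is used; instances are those that admit a packing into the strip): a $32.7$-approximation algorithm. (b) *Bin packing* (assign each piece to a bin, each bin being a unit square $[0,1]^2$, and pack the pieces into their bins, minimizing the number of used bins), restricted to pieces of diameter at most $1/10$: a $10.1$-approximation algorithm. (c) *Perimeter packing* (pack the pieces anywhere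 in the plane, minimizing the perimeter of the convex hull of their union): an $8.9$-approximation algorithm. (d) *Square packing*: an algorithm that packs into the unit square $[0,1]^2$ every instance whose pieces have diameter at most $1/10$ each and total area at most $1/10$. In particular, every finite family of convex polygons, each of diameter at most $1/10$ and of total area at most $1/10$, can be packed into the unit square by translations. -/

import Mathlib

open MeasureTheory
open scoped ENNReal

noncomputable section

namespace ConvexPacking

/-! ### The geometry of pieces -/

/-- The Euclidean plane; `p 0` and `p 1` are the coordinates `x(p)` and `y(p)`. -/
abbrev Plane : Type := EuclideanSpace ℝ (Fin 2)

/-- A (filled, nondegenerate) convex polygon: the convex hull of finitely many points, with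
nonempty interior. -/
def IsConvexPolygon (S : Set Plane) : Prop :=
  (∃ V : Set Plane, V.Finite ∧ S = convexHull ℝ V) ∧ (interior S).Nonempty

/-- The translate of `S` by the vector `t`. -/
def translate (t : Plane) (S : Set Plane) : Set Plane := (fun p => p + t) '' S

/-- Two pieces overlap if their interiors meet; touching along the boundary is allowed. -/
def NonOverlapping (S T : Set Plane) : Prop := Disjoint (interior S) (interior T)

/-- The unit square `[0,1] × [0,1]`. -/
def unitSquare : Set Plane := {p | p 0 ∈ Set.Icc (0 : ℝ) 1 ∧ p 1 ∈ Set.Icc (0 : ℝ) 1}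

/-- The horizontal strip `[0,∞) × [0,1]`. -/
def strip : Set Plane := {p | 0 ≤ p 0 ∧ p 1 ∈ Set.Icc (0 : ℝ) 1}

/-- The perimeter of a planar convex set: the length (one-dimensional Hausdorff measure) of its
boundary. -/
def perimeter (S : Set Plane) : ℝ≥0∞ := Measure.hausdorffMeasure 1 (frontier S)

/-! ### Instances and solutions -/

/-- An instance: a finite list of convex polygons, each of them given by a finite list of points
of which it is the convex hull (for instance its corners in their order along the boundary;
neither an order nor extremality of the listed points is needed). -/
structure PackingInstance where
  pieces : List (List Plane)
  nondeg : ∀ V ∈ pieces, (interior (convexHull ℝ {p | p ∈ V})).Nonempty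

namespace PackingInstance

/-- The number of pieces. -/
def num (I : PackingInstance) : ℕ := I.pieces.length

/-- The `i`-th piece, as a subset of the plane. -/
def piece (I : PackingInstance) (i : Fin I.num) : Set Plane :=
  convexHull ℝ {p | p ∈ I.pieces.get i}

/-- All listed points, piece after piece. -/
def points (I : PackingInstance) : List Plane := I.pieces.flatten

/-- The input size: the total number of listed corners. -/
def size (I : PackingInstance) : ℕ := I.points.length

/-- The number of points listed before those of the `i`-th piece; the points of the `i`-th piece
are at the positions `start i ≤ k < start (i + 1)` of `points`. -/
def start (I : PackingInstance) (i : ℕ) : ℕ := (I.pieces.take i).flatten.length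

end PackingInstance

/-- A translation vector for each piece and the number of a bin for each piece (the latter is
used in bin packing only). -/
structure Solution (I : PackingInstance) where
  shift : Fin I.num → Plane
  bin : Fin I.num → ℕ

namespace Solution

variable {I : PackingInstance}

/-- The `i`-th piece, where the solution puts it. -/
def placed (σ : Solution I) (i : Fin I.num) : Set Plane := translate (σ.shift i) (I.piece i)

/-- The pieces are placed in the plane without overlap. -/
def IsPlanePacking (σ : Solution I) : Prop :=
  Pairwise fun i j => NonOverlapping (σ.placed i) (σ.placed j)

/-- The pieces are packed into the strip. -/
def IsStripPacking (σ : Solution I) : Prop :=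
  (∀ i, σ.placed i ⊆ strip) ∧ σ.IsPlanePacking

/-- The pieces are packed into the unit square. -/
def IsSquarePacking (σ : Solution I) : Prop :=
  (∀ i, σ.placed i ⊆ unitSquare) ∧ σ.IsPlanePacking

/-- The pieces are packed into bins, each of which is a copy of the unit square. -/
def IsBinPacking (σ : Solution I) : Prop :=
  (∀ i, σ.placed i ⊆ unitSquare) ∧
    Pairwise fun i j => σ.bin i = σ.bin j → NonOverlapping (σ.placed i) (σ.placed j)

/-- The length of the used part of the strip: the largest `x`-coordinate that is reached. -/
def stripLength (σ : Solution I) : ℝ≥0∞ := ⨆ i, ⨆ p ∈ σ.placed i, ENNReal.ofReal (p 0)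

/-- The number of bins that are used. -/
def binCount (σ : Solution I) : ℝ≥0∞ := ((Finset.univ.image σ.bin).card : ℝ≥0∞)

/-- The perimeter of the convex hull of all placed pieces. -/
def hullPerimeter (σ : Solution I) : ℝ≥0∞ := perimeter (convexHull ℝ (⋃ i, σ.placed i))

end Solution

/-- The optimal cost of an instance: the infimum of the costs of its feasible solutions
(`∞` if there are none). -/
def opt {I : PackingInstance} (feasible : Solution I → Prop) (cost : Solution I → ℝ≥0∞) : ℝ≥0∞ :=
  ⨅ (σ : Solution I) (_ : feasible σ), cost σ

/-- `σ` is feasible and its cost is at most `c` times the optimal cost. -/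
def IsApprox {I : PackingInstance} (c : ℝ) (feasible : Solution I → Prop)
    (cost : Solution I → ℝ≥0∞) (σ : Solution I) : Prop :=
  feasible σ ∧ cost σ ≤ ENNReal.ofReal c * opt feasible cost

/-! ### The real RAM

A real RAM has two memories, one for natural numbers and one for exact real numbers, each of them
divided into infinite arrays `0, 1, 2, …`. A program is a fixed finite text; the array that an
instruction accesses is fixed in the text, the index in the array is computed. On natural numbers
there are only addition, truncated subtraction and comparison, on real numbers the four
arithmetic operations, rational constants and comparison. There are no roots, no rounding, and no
conversion of real numbers to natural numbers. -/

/-- A state of the memory. -/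
structure State where
  nat : ℕ → ℕ → ℕ
  real : ℕ → ℕ → ℝ

/-- Expressions with values in `ℕ`. -/
inductive NatExpr where
  | const (k : ℕ)
  | read (a : ℕ) (i : NatExpr)
  | add (e₁ e₂ : NatExpr)
  | sub (e₁ e₂ : NatExpr)

/-- Expressions with values in `ℝ`. -/
inductive RealExpr where
  | const (q : ℚ)
  | read (a : ℕ) (i : NatExpr)
  | add (e₁ e₂ : RealExpr)
  | sub (e₁ e₂ : RealExpr)
  | mul (e₁ e₂ : RealExpr)
  | div (e₁ e₂ : RealExpr)

/-- Tests on which a program can branch. -/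
inductive Test where
  | natLt (e₁ e₂ : NatExpr)
  | realLt (e₁ e₂ : RealExpr)
  | not (b : Test)
  | and (b₁ b₂ : Test)

/-- Programs. -/
inductive Program where
  | skip
  | setNat (a : ℕ) (i : NatExpr) (e : NatExpr)
  | setReal (a : ℕ) (i : NatExpr) (e : RealExpr)
  | seq (P Q : Program)
  | cond (b : Test) (P Q : Program)
  | loop (b : Test) (P : Program)

def NatExpr.eval (s : State) : NatExpr → ℕ
  | .const k => k
  | .read a i => s.nat a (i.eval s)
  | .add e₁ e₂ => e₁.eval s + e₂.eval s
  | .sub e₁ e₂ => e₁.eval s - e₂.eval s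

/-- The value of a real expression; a division by zero returns `0`. -/
def RealExpr.eval (s : State) : RealExpr → ℝ
  | .const q => (q : ℝ)
  | .read a i => s.real a (i.eval s)
  | .add e₁ e₂ => e₁.eval s + e₂.eval s
  | .sub e₁ e₂ => e₁.eval s - e₂.eval s
  | .mul e₁ e₂ => e₁.eval s * e₂.eval s
  | .div e₁ e₂ => e₁.eval s / e₂.eval s

def Test.Holds (s : State) : Test → Prop
  | .natLt e₁ e₂ => e₁.eval s < e₂.eval s
  | .realLt e₁ e₂ => e₁.eval s < e₂.eval s
  | .not b => ¬ b.Holds s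
  | .and b₁ b₂ => b₁.Holds s ∧ b₂.Holds s

/-- Store `v` in cell `k` of array `a` of the natural-number memory. -/
def State.writeNat (s : State) (a k v : ℕ) : State :=
  { s with nat := Function.update s.nat a (Function.update (s.nat a) k v) }

/-- Store `v` in cell `k` of array `a` of the real memory. -/
def State.writeReal (s : State) (a k : ℕ) (v : ℝ) : State :=
  { s with real := Function.update s.real a (Function.update (s.real a) k v) }

/-- `Exec P s t s'`: started in the state `s`, the program `P` halts in the state `s'` after `t`
steps. An assignment and the evaluation of a test cost one step each (the expressions in a
program have bounded size, so this counts the operations up to a constant factor that depends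
only on the program). -/
inductive Exec : Program → State → ℕ → State → Prop
  | skip (s : State) : Exec .skip s 1 s
  | setNat (s : State) (a : ℕ) (i e : NatExpr) :
      Exec (.setNat a i e) s 1 (s.writeNat a (i.eval s) (e.eval s))
  | setReal (s : State) (a : ℕ) (i : NatExpr) (e : RealExpr) :
      Exec (.setReal a i e) s 1 (s.writeReal a (i.eval s) (e.eval s))
  | seq {P Q : Program} {s s' s'' : State} {t t' : ℕ} :
      Exec P s t s' → Exec Q s' t' s'' → Exec (.seq P Q) s (t + t') s''
  | cond_true {b : Test} {P Q : Program} {s s' : State} {t : ℕ} :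
      b.Holds s → Exec P s t s' → Exec (.cond b P Q) s (t + 1) s'
  | cond_false {b : Test} {P Q : Program} {s s' : State} {t : ℕ} :
      ¬ b.Holds s → Exec Q s t s' → Exec (.cond b P Q) s (t + 1) s'
  | loop_true {b : Test} {P : Program} {s s' s'' : State} {t t' : ℕ} :
      b.Holds s → Exec P s t s' → Exec (.loop b P) s' t' s'' →
        Exec (.loop b P) s (t + t' + 1) s''
  | loop_false {b : Test} {P : Program} {s : State} :
      ¬ b.Holds s → Exec (.loop b P) s 1 s

/-- The machine is deterministic: the final state and the number of steps are determined by the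
program and the initial state. -/
theorem Exec.deterministic {P : Program} {s s₁ : State} {t₁ : ℕ} (h₁ : Exec P s t₁ s₁) :
    ∀ {t₂ : ℕ} {s₂ : State}, Exec P s t₂ s₂ → t₁ = t₂ ∧ s₁ = s₂ := by
  induction h₁ with
  | skip s => intro t₂ s₂ h₂; cases h₂; exact ⟨rfl, rfl⟩
  | setNat s a i e => intro t₂ s₂ h₂; cases h₂; exact ⟨rfl, rfl⟩
  | setReal s a i e => intro t₂ s₂ h₂; cases h₂; exact ⟨rfl, rfl⟩
  | seq _ _ ih ih' =>
    intro t₂ s₂ h₂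
    cases h₂ with
    | seq k k' =>
      obtain ⟨rfl, rfl⟩ := ih k
      obtain ⟨rfl, rfl⟩ := ih' k'
      exact ⟨rfl, rfl⟩
  | cond_true hb _ ih =>
    intro t₂ s₂ h₂
    cases h₂ with
    | cond_true _ k => obtain ⟨rfl, rfl⟩ := ih k; exact ⟨rfl, rfl⟩
    | cond_false hb' _ => exact absurd hb hb'
  | cond_false hb _ ih =>
    intro t₂ s₂ h₂
    cases h₂ with
    | cond_true hb' _ => exact absurd hb' hb
    | cond_false _ k => obtain ⟨rfl, rfl⟩ := ih k; exact ⟨rfl, rfl⟩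
  | loop_true hb _ _ ih ih' =>
    intro t₂ s₂ h₂
    cases h₂ with
    | loop_true _ k k' =>
      obtain ⟨rfl, rfl⟩ := ih k
      obtain ⟨rfl, rfl⟩ := ih' k'
      exact ⟨rfl, rfl⟩
    | loop_false hb' => exact absurd hb hb'
  | loop_false hb =>
    intro t₂ s₂ h₂
    cases h₂ with
    | loop_true hb' _ _ => exact absurd hb' hb
    | loop_false _ => exact ⟨rfl, rfl⟩

/-- The initial memory for an instance. Natural-number memory: the number of pieces in cell `0` of
array `0`, and for `i ≤ num` the offset `start i` in cell `i` of array `1`. Real memory: the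
coordinates of the `k`-th listed point in the cells `k` of the arrays `0` and `1`. All other cells
hold `0`. -/
def PackingInstance.input (I : PackingInstance) : State where
  nat
    | 0, 0 => I.num
    | 1, i => if i ≤ I.num then I.start i else 0
    | _, _ => 0
  real
    | 0, k => (I.points.getD k 0) 0
    | 1, k => (I.points.getD k 0) 1
    | _, _ => 0

/-- The solution that is read off the final memory: piece `i` is translated by the vector whose
coordinates are in the cells `i` of the arrays `2` and `3` of the real memory, and its bin is in
cell `i` of array `2` of the natural-number memory. -/
def State.output (s : State) (I : PackingInstance) : Solution I where
  shift i := !₂[s.real 2 i, s.real 3 i]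
  bin i := s.nat 2 i

/-- There is one program that, on every admissible instance, halts after a number of steps that
is polynomial in the input size, with a solution as required. -/
def PolyTimeSolvable (admissible : PackingInstance → Prop)
    (good : (I : PackingInstance) → Solution I → Prop) : Prop :=
  ∃ (P : Program) (q : Polynomial ℕ), ∀ I : PackingInstance, admissible I →
    ∃ (t : ℕ) (s : State), Exec P I.input t s ∧ t ≤ q.eval I.size ∧ good I (s.output I)

end ConvexPacking

end

noncomputable section

namespace ConvexPacking

/-! ### Areas -/

/-! All four algorithms are one layout routine run with different parameters. The spine of a piece
joins a lowest to a highest point; let `h` be the height of the piece and `w` the width of its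
shadow along the direction of the spine. The triangles over the spine with their apices at the two
extremes of the shadow lie in the piece, so `w * h` is at most twice its area
(`le_volume_of_spine`). Conversely, the piece lies in a parallelogram of base `w` and height `h`
with two sides parallel to the spine. Parallelograms side by side on a common bottom line do not
overlap if slopes increase from left to right (`RowSeparated`, `LayoutResult.solution`). Hence a row
sorted by slope is limited only by the sum of its widths: if all bases start in `[0, T]` and no
piece has horizontal extent above `W`, the row fits into length `T + 3 * W` (`PieceData.shape`).

A class of row height `c` takes the pieces higher than `c / 2`, and row heights at least halve from
class to class. A row is closed once its bases exceed `T`, so a closed row has `T * c` at most twice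
the sum of its products `w * h`. The last row of a class may be almost empty, but the heights of
these rows form a geometric series with sum at most `2 * K`, where `K` bounds all heights. Rows are
stacked in bins of height `C`. Row heights above `C / 4` are rounded up to `C / 2` or `C`, so a bin
is abandoned only when it is filled up to `3 / 4 * C`. Altogether `T * (3 / 4 * C * B + H) ≤ 2 * Σ w
* h + 2 * T * K` (`LayoutResult.area`), where `B` is the number of abandoned bins and `H` the
filling of the last one; `LayoutInv` carries this as a potential that `LayoutInv.newRow` and
`LayoutInv.place` preserve.

For small pieces in squares, `T = 7 / 10` makes a row one unit long. For the strip, bins become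
consecutive segments of length `5 * W`. For the perimeter, `T` is a rational-step approximation of
`√(2 * Σ w * h)` and `C` is so large that one bin suffices. The competitor is bounded from below by
area and by the largest pieces; in the perimeter case these bounds come from
`two_mul_dist_le_perimeter` and `volume_le_of_dist_le`, and the cost of the computed packing is
estimated by `perimeter_le_of_subset_box`.

The programs are verified with `Runs`, a total correctness judgement with a step bound. Placing one
piece takes a constant number of linear searches, so the whole computation is quadratic. -/

/-- The axis-parallel rectangle `[a,b] × [c,d]`. -/
def box (a b c d : ℝ) : Set Plane := {p | p 0 ∈ Set.Icc a b ∧ p 1 ∈ Set.Icc c d}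

theorem volume_box (a b c d : ℝ) :
    volume (box a b c d) = ENNReal.ofReal (b - a) * ENNReal.ofReal (d - c) := by
  have h : box a b c d = (@WithLp.ofLp 2 (Fin 2 → ℝ)) ⁻¹' (Set.Icc ![a, c] ![b, d]) := by
    ext p
    simp only [box, Set.mem_ofPred_eq, Set.mem_Icc, Set.mem_preimage, Pi.le_def, Fin.forall_fin_two,
      Matrix.cons_val_zero, Matrix.cons_val_one]
    tauto
  rw [h, (PiLp.volume_preserving_ofLp (Fin 2)).measure_preimage
    measurableSet_Icc.nullMeasurableSet, Real.volume_Icc_pi, Fin.prod_univ_two]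
  simp

/-- The linear map that sends the standard basis to `u`, `v`. -/
def frameMap (u v : Plane) : Plane →ₗ[ℝ] Plane where
  toFun p := p 0 • u + p 1 • v
  map_add' p q := by simp only [PiLp.add_apply, add_smul]; abel
  map_smul' r p := by simp [mul_smul]

theorem det_frameMap (u v : Plane) :
    LinearMap.det (frameMap u v) = u 0 * v 1 - u 1 * v 0 := by
  rw [← LinearMap.det_toMatrix (EuclideanSpace.basisFun (Fin 2) ℝ).toBasis, Matrix.det_fin_two]
  simp [LinearMap.toMatrix_apply, frameMap]
  ring

/-- The triangle and its point reflection, which has the same area, cover the parallelogram spanned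
by two of its sides, and the area of the latter is the determinant of `frameMap`. -/
theorem le_volume_triangle {S : Set Plane} (hS : Convex ℝ S) {p q r : Plane} (hp : p ∈ S)
    (hq : q ∈ S) (hr : r ∈ S) :
    ENNReal.ofReal (|(q 0 - p 0) * (r 1 - p 1) - (q 1 - p 1) * (r 0 - p 0)| / 2) ≤ volume S := by
  set u := q - p with hu
  set v := r - p with hv
  have hsub : frameMap u v '' box 0 1 0 1 ⊆
      ((fun x => p + x) ⁻¹' S) ∪ (fun x => (q + r - p) - x) ⁻¹' S := by
    rintro _ ⟨x, hx, rfl⟩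
    obtain ⟨⟨h1, h2⟩, h3, h4⟩ := hx
    rcases le_total (x 0 + x 1) 1 with h | h
    · left
      have := hS.sum_mem (t := Finset.univ) (w := ![1 - x 0 - x 1, x 0, x 1]) (z := ![p, q, r])
        (by simp [Fin.forall_fin_succ]; exact ⟨by linarith, h1, h3⟩)
        (by simp [Fin.sum_univ_three]; ring) (by simp [Fin.forall_fin_succ, hp, hq, hr])
      simp only [Fin.sum_univ_three] at this
      change p + (x 0 • u + x 1 • v) ∈ S
      convert this using 1
      simp [hu, hv]
      module
    · right
      have := hS.sum_mem (t := Finset.univ) (w := ![x 0 + x 1 - 1, 1 - x 0, 1 - x 1])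
        (z := ![p, q, r])
        (by simp [Fin.forall_fin_succ]; exact ⟨by linarith, h2, h4⟩)
        (by simp [Fin.sum_univ_three]) (by simp [Fin.forall_fin_succ, hp, hq, hr])
      simp only [Fin.sum_univ_three] at this
      change (q + r - p) - (x 0 • u + x 1 • v) ∈ S
      convert this using 1
      simp [hu, hv]
      module
  have h1 := (measure_mono (μ := volume) hsub).trans (measure_union_le _ _)
  rw [Measure.addHaar_image_linearMap, det_frameMap, volume_box, measure_preimage_add,
    (Measure.measurePreserving_sub_left volume (q + r - p)).measure_preimage
      (hS.nullMeasurableSet volume)] at h1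
  simp only [sub_zero, ENNReal.ofReal_one, mul_one, ← two_mul, hu, hv, PiLp.sub_apply] at h1
  rw [ENNReal.ofReal_div_of_pos two_pos]
  refine ENNReal.div_le_of_le_mul ?_
  rw [mul_comm (volume S)]
  simpa only [ENNReal.ofReal_ofNat] using h1

/-- Convex sets without overlap inside `R` have a total area of at most that of `R`. -/
theorem sum_volume_le {ι : Type*} (t : Finset ι) {S : ι → Set Plane} {R : Set Plane}
    (hS : ∀ i ∈ t, Convex ℝ (S i)) (hR : ∀ i ∈ t, S i ⊆ R)
    (hd : ∀ i ∈ t, ∀ j ∈ t, i ≠ j → NonOverlapping (S i) (S j)) :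
    ∑ i ∈ t, volume (S i) ≤ volume R := by
  -- The boundary of a convex set is a null set, so the disjoint interiors carry the whole area.
  have h : ∀ i ∈ t, volume (S i) = volume (interior (S i)) := fun i hi =>
    measure_congr (interior_ae_eq_of_null_frontier ((hS i hi).addHaar_frontier _)).symm
  rw [Finset.sum_congr rfl h, ← measure_biUnion_finset (fun i hi j hj hij => hd i hi j hj hij)
    (fun i _ => isOpen_interior.measurableSet)]
  exact measure_mono (Set.iUnion₂_subset fun i hi => interior_subset.trans (hR i hi))

/-- Sets on the two sides of a line whose direction is not horizontal do not overlap. -/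
theorem nonOverlapping_of_lines {S T : Set Plane} {a s a' s' : ℝ}
    (hS : ∀ p ∈ S, p 0 ≤ a + s * p 1) (hT : ∀ p ∈ T, a' + s' * p 1 ≤ p 0)
    (h : ∀ p ∈ S, p ∈ T → a + s * p 1 ≤ a' + s' * p 1) : NonOverlapping S T := by
  refine Set.disjoint_left.2 fun p hp hq => ?_
  -- A common interior point can be moved a little to the right inside both sets; its ordinate, and
  -- with it the position of both lines, stays the same.
  have hn : (fun ε : ℝ => p + ε • (EuclideanSpace.single 0 1 : Plane)) ⁻¹' (S ∩ T) ∈ nhds 0 := by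
    refine ContinuousAt.preimage_mem_nhds (by fun_prop) ?_
    simpa using Filter.inter_mem (mem_interior_iff_mem_nhds.1 hp) (mem_interior_iff_mem_nhds.1 hq)
  obtain ⟨ε, h1, hε⟩ := Filter.nonempty_of_mem
    (Filter.inter_mem (mem_nhdsWithin_of_mem_nhds (t := Set.Ioi 0) hn) self_mem_nhdsWithin)
  have e1 := hS _ h1.1
  have e2 := hT _ (interior_subset hq)
  have e3 := h _ (interior_subset hp) (interior_subset hq)
  simp at e1 hε
  linarith

/-- Sets above and below a horizontal line do not overlap. -/
theorem nonOverlapping_of_le {S T : Set Plane} {c : ℝ}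
    (hS : ∀ p ∈ S, p 1 ≤ c) (hT : ∀ p ∈ T, c ≤ p 1) : NonOverlapping S T := by
  refine Set.disjoint_left.2 fun p hp hq => ?_
  have hn : (fun ε : ℝ => p + ε • (EuclideanSpace.single 1 1 : Plane)) ⁻¹' S ∈ nhds 0 := by
    refine ContinuousAt.preimage_mem_nhds (by fun_prop) ?_
    simpa using (mem_interior_iff_mem_nhds.1 hp)
  obtain ⟨ε, h1, hε⟩ := Filter.nonempty_of_mem
    (Filter.inter_mem (mem_nhdsWithin_of_mem_nhds (t := Set.Ioi 0) hn) self_mem_nhdsWithin)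
  have e1 := hS _ h1
  have e2 := hT _ (interior_subset hq)
  simp at e1 hε
  linarith

/-- A linear inequality that holds on a set holds on its convex hull. -/
theorem convexHull_linear_le {V : Set Plane} {u v c : ℝ} (h : ∀ p ∈ V, u * p 0 + v * p 1 ≤ c) :
    ∀ p ∈ convexHull ℝ V, u * p 0 + v * p 1 ≤ c := by
  refine fun p hp => convexHull_min (t := {p : Plane | u * p 0 + v * p 1 ≤ c}) h ?_ hp
  intro x hx y hy α β hα hβ hαβ
  simp only [Set.mem_ofPred_eq, PiLp.add_apply, PiLp.smul_apply, smul_eq_mul] at *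
  have e := add_le_add (mul_le_mul_of_nonneg_left hx hα) (mul_le_mul_of_nonneg_left hy hβ)
  have : β = 1 - α := by linarith
  subst this
  linarith

theorem NonOverlapping.symm {S T : Set Plane} (h : NonOverlapping S T) : NonOverlapping T S :=
  Disjoint.symm h

/-- A convex set contains at least half of the parallelogram that is spanned by its height and by
its extent in the sheared horizontal direction. -/
theorem le_volume_of_spine {S : Set Plane} (hS : Convex ℝ S) {b t l r : Plane} (hb : b ∈ S)
    (ht : t ∈ S) (hl : l ∈ S) (hr : r ∈ S) {s : ℝ} (hbt : b 1 < t 1)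
    (hs : s = (t 0 - b 0) / (t 1 - b 1)) (hlb : l 0 - s * l 1 ≤ b 0 - s * b 1)
    (hrb : b 0 - s * b 1 ≤ r 0 - s * r 1) :
    ENNReal.ofReal ((r 0 - s * r 1 - (l 0 - s * l 1)) * (t 1 - b 1) / 2) ≤ volume S := by
  have hst : t 0 - b 0 = s * (t 1 - b 1) := by
    rw [hs]; field_simp [(sub_pos.2 hbt).ne']
  have tri : ∀ q : Plane, q ∈ S → ENNReal.ofReal
      (|q 0 - s * q 1 - (b 0 - s * b 1)| * (t 1 - b 1) / 2) ≤
      volume (convexHull ℝ {b, t, q}) := by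
    intro q hq
    have h := le_volume_triangle (convex_convexHull ℝ {b, t, q}) (p := b) (q := t) (r := q)
      (subset_convexHull _ _ (by simp)) (subset_convexHull _ _ (by simp))
      (subset_convexHull _ _ (by simp))
    convert h using 3
    rw [hst, ← abs_of_pos (sub_pos.2 hbt), ← abs_mul, abs_of_pos (sub_pos.2 hbt), ← abs_neg]
    congr 1
    ring
  -- The line of the spine separates the triangle with apex `l` from the one with apex `r`, so their
  -- areas add up.
  have key := sum_volume_le (Finset.univ : Finset (Fin 2))
    (S := ![convexHull ℝ {b, t, l}, convexHull ℝ {b, t, r}]) (R := S) ?_ ?_ ?_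
  · rw [Fin.sum_univ_two] at key
    refine le_trans ?_ key
    refine le_trans (le_of_eq ?_) (add_le_add (tri l hl) (tri r hr))
    rw [← ENNReal.ofReal_add (by have := sub_pos.2 hbt; positivity)
      (by have := sub_pos.2 hbt; positivity), abs_of_nonpos (by linarith),
      abs_of_nonneg (by linarith)]
    congr 1
    ring
  · simp [Fin.forall_fin_two, convex_convexHull]
  · simp only [Finset.mem_univ, forall_true_left, Fin.forall_fin_two, Matrix.cons_val_zero,
      Matrix.cons_val_one]
    constructor <;> refine convexHull_min ?_ hS <;> simp [Set.insert_subset_iff, *]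
  · have hcl : ∀ p ∈ convexHull ℝ {b, t, l}, p 0 ≤ (b 0 - s * b 1) + s * p 1 := by
      intro p hp
      have := convexHull_linear_le (V := {b, t, l}) (u := 1) (v := -s) (c := b 0 - s * b 1)
        (by rintro _ (rfl | rfl | rfl) <;> linarith) p hp
      linarith
    have hcr : ∀ p ∈ convexHull ℝ {b, t, r}, (b 0 - s * b 1) + s * p 1 ≤ p 0 := by
      intro p hp
      have := convexHull_linear_le (V := {b, t, r}) (u := -1) (v := s) (c := -(b 0 - s * b 1))
        (by rintro _ (rfl | rfl | rfl) <;> linarith) p hp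
      linarith
    have := nonOverlapping_of_lines hcl hcr (fun _ _ _ => le_rfl)
    simp only [Finset.mem_univ, forall_true_left, Fin.forall_fin_two, Matrix.cons_val_zero,
      Matrix.cons_val_one]
    simp [this, this.symm]

/-! ### Perimeters -/

/-- On a ray that starts inside a compact set there is a point of the frontier. -/
theorem exists_frontier_ray {S : Set Plane} (hS : IsCompact S) {p v : Plane} (hp : p ∈ S)
    (hv : v ≠ 0) : ∃ r : ℝ, 0 ≤ r ∧ p + r • v ∈ frontier S := by
  set R := {r : ℝ | 0 ≤ r ∧ p + r • v ∈ S}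
  have hclosed : IsClosed R := by
    have h1 : IsClosed {r : ℝ | p + r • v ∈ S} :=
      hS.isClosed.preimage (f := fun r : ℝ => p + r • v) (by fun_prop)
    exact isClosed_Ici.inter h1
  have hbdd : BddAbove R := by
    obtain ⟨M, hM⟩ := hS.isBounded.exists_norm_le
    refine ⟨(M + ‖p‖) / ‖v‖, fun r hr => ?_⟩
    rw [le_div_iff₀ (norm_pos_iff.2 hv)]
    have h1 := hM _ hr.2
    have h2 : ‖r • v‖ ≤ ‖p + r • v‖ + ‖p‖ := by
      simpa [add_comm, add_sub_cancel_left] using norm_sub_le (p + r • v) p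
    rw [norm_smul, Real.norm_of_nonneg hr.1] at h2
    linarith
  have hne : R.Nonempty := ⟨0, le_rfl, by simpa using hp⟩
  have hmem := hclosed.csSup_mem hne hbdd
  -- The last point of the ray in `S` is not interior, as the ray could otherwise be followed
  -- further.
  refine ⟨sSup R, hmem.1, subset_closure hmem.2, fun hi => ?_⟩
  have hn : (fun ε : ℝ => p + (sSup R + ε) • v) ⁻¹' S ∈ nhds 0 := by
    refine ContinuousAt.preimage_mem_nhds (by fun_prop) ?_
    simpa using mem_interior_iff_mem_nhds.1 hi
  obtain ⟨ε, h1, hε⟩ := Filter.nonempty_of_mem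
    (Filter.inter_mem (mem_nhdsWithin_of_mem_nhds (t := Set.Ioi 0) hn) self_mem_nhdsWithin)
  have hε' : 0 < ε := hε
  have := le_csSup hbdd (show sSup R + ε ∈ R from ⟨by linarith [hmem.1], h1⟩)
  linarith

/-- The perimeter is at least twice the distance of any two inner points. -/
theorem two_mul_dist_le_perimeter_of_interior {S : Set Plane} (hS : IsCompact S)
    (hc : Convex ℝ S) {p q : Plane} (hp : p ∈ interior S) (hq : q ∈ interior S) :
    2 * edist p q ≤ perimeter S := by
  rcases eq_or_ne p q with rfl | hpq
  · simp
  set d := ‖q - p‖ with hd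
  have hd0 : 0 < d := norm_pos_iff.2 (sub_ne_zero.2 hpq.symm)
  set u : Plane := q - p with hu
  set v : Plane := !₂[-(u 1), u 0] with hv
  have huu : inner ℝ u u = d ^ 2 := real_inner_self_eq_norm_sq u
  have huv : inner ℝ u v = 0 := by
    simp [hv, PiLp.inner_apply, Fin.sum_univ_two]; ring
  have hvu : inner ℝ v u = 0 := by rw [real_inner_comm]; exact huv
  have hvv : inner ℝ v v = d ^ 2 := by
    rw [← huu, hv]; simp only [PiLp.inner_apply, Fin.sum_univ_two]; simp; ring
  have hv0 : v ≠ 0 := by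
    rintro h
    rw [h, inner_zero_left] at hvv
    exact (pow_pos hd0 2).ne hvv
  -- the projection to the line through `p` and `q`
  set f : Plane → ℝ := fun x => inner ℝ u (x - p) / d with hf
  have hlip : LipschitzWith 1 f := by
    refine LipschitzWith.of_dist_le_mul fun x y => ?_
    rw [NNReal.coe_one, one_mul, Real.dist_eq, hf]
    simp only
    rw [← sub_div, ← inner_sub_right, sub_sub_sub_cancel_right, abs_div, abs_of_pos hd0,
      div_le_iff₀ hd0, dist_eq_norm, mul_comm]
    exact abs_real_inner_le_norm u (x - y)
  -- From every point of the open segment a perpendicular ray, on the side chosen by the sign of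
  -- `σ`, reaches the boundary. So the part of the boundary on that side projects over the whole
  -- segment, and projecting does not increase length.
  have side : ∀ (σ : ℝ), σ ≠ 0 → ENNReal.ofReal d ≤
      Measure.hausdorffMeasure 1 (frontier S ∩ {x | 0 < σ * inner ℝ v (x - p)}) := by
    intro σ hσ
    have h1 : Set.Ioo 0 d ⊆ f '' (frontier S ∩ {x | 0 < σ * inner ℝ v (x - p)}) := by
      rintro c ⟨hc0, hcd⟩
      have hm : p + (c / d) • u ∈ interior S := by
        have := hc.interior.add_smul_sub_mem hp hq (t := c / d)
          ⟨by positivity, by rw [div_le_one hd0]; exact hcd.le⟩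
        exact this
      obtain ⟨r, hr0, hr⟩ := exists_frontier_ray hS (interior_subset hm)
        (smul_ne_zero hσ hv0)
      have hr' : r ≠ 0 := by
        rintro rfl
        rw [zero_smul, add_zero] at hr
        exact hr.2 hm
      refine ⟨_, ⟨hr, ?_⟩, ?_⟩
      · have : p + (c / d) • u + r • σ • v - p = (c / d) • u + (r * σ) • v := by module
        simp only [Set.mem_ofPred_eq, this, inner_add_right, inner_smul_right, hvu, hvv]
        have : 0 < r := lt_of_le_of_ne hr0 hr'.symm
        have h3 : 0 < σ * σ := mul_self_pos.2 hσ
        have : 0 < r * (σ * σ) * d ^ 2 := by positivity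
        linarith
      · have : p + (c / d) • u + r • σ • v - p = (c / d) • u + (r * σ) • v := by module
        simp only [hf, this, inner_add_right, inner_smul_right, huv, huu]
        field_simp
        ring
    calc ENNReal.ofReal d = volume (Set.Ioo 0 d) := by simp
      _ ≤ volume (f '' (frontier S ∩ {x | 0 < σ * inner ℝ v (x - p)})) := measure_mono h1
      _ = Measure.hausdorffMeasure 1 (f '' _) := by rw [hausdorffMeasure_real]
      _ ≤ _ := by simpa using hlip.hausdorffMeasure_image_le (d := 1) zero_le_one _
  have hmeas : MeasurableSet {x : Plane | 0 < (1 : ℝ) * inner ℝ v (x - p)} :=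
    (isOpen_lt continuous_const (by fun_prop)).measurableSet
  have h2 := add_le_add (side 1 one_ne_zero) (side (-1) (by norm_num))
  rw [← measure_union' _ (isClosed_frontier.measurableSet.inter hmeas)] at h2
  · refine le_trans (le_of_eq ?_) (h2.trans (measure_mono (Set.union_subset
      Set.inter_subset_left Set.inter_subset_left)))
    rw [two_mul, edist_dist, dist_comm, dist_eq_norm]
  · refine Set.disjoint_left.2 fun x hx hy => ?_
    have e1 := hx.2
    have e2 := hy.2
    simp only [Set.mem_ofPred_eq] at e1 e2
    linarith

/-- Interior points are dense in a closed convex set with nonempty interior, so the bound extends by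
continuity, one variable at a time. -/
theorem two_mul_dist_le_perimeter {S : Set Plane} (hS : IsCompact S) (hc : Convex ℝ S)
    (hi : (interior S).Nonempty) {p q : Plane} (hp : p ∈ S) (hq : q ∈ S) :
    2 * edist p q ≤ perimeter S := by
  have hcl : closure (interior S) = S := by
    rw [hc.closure_interior_eq_closure_of_nonempty_interior hi, hS.isClosed.closure_eq]
  have hclosed : ∀ x : Plane, IsClosed {y : Plane | 2 * edist y x ≤ perimeter S} := fun x =>
    isClosed_le ((ENNReal.continuous_const_mul ENNReal.ofNat_ne_top).comp
      (continuous_id.edist continuous_const)) continuous_const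
  have h1 : ∀ x ∈ interior S, S ⊆ {y : Plane | 2 * edist y x ≤ perimeter S} := fun x hx => by
    have h := closure_minimal
      (fun y hy => two_mul_dist_le_perimeter_of_interior hS hc hy hx :
        interior S ⊆ {y : Plane | 2 * edist y x ≤ perimeter S}) (hclosed x)
    rwa [hcl] at h
  have h2 : S ⊆ {y : Plane | 2 * edist y p ≤ perimeter S} := by
    have h := closure_minimal (fun y hy => by
      have := h1 y hy hp
      rw [Set.mem_ofPred_eq, edist_comm] at this
      exact this : interior S ⊆ {y : Plane | 2 * edist y p ≤ perimeter S}) (hclosed p)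
    rwa [hcl] at h
  have h3 := h2 hq
  rw [Set.mem_ofPred_eq, edist_comm] at h3
  exact h3

/-- The nearest-point map onto a compact convex set. -/
theorem exists_nearest_point_map {S : Set Plane} (hS : IsCompact S) (hc : Convex ℝ S)
    (hne : S.Nonempty) :
    ∃ π : Plane → Plane, LipschitzWith 1 π ∧
      ∀ z, ∀ e ∈ S, (∀ w ∈ S, inner ℝ (z - e) (w - e) ≤ 0) → π z = e := by
  have h : ∀ z : Plane, ∃ v ∈ S, ∀ w ∈ S, inner ℝ (z - v) (w - v) ≤ 0 := by
    intro z
    obtain ⟨v, hv, h⟩ := exists_norm_eq_iInf_of_complete_convex hne hS.isComplete hc z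
    exact ⟨v, hv, (norm_eq_iInf_iff_real_inner_le_zero hc hv).1 h⟩
  choose π hπ hπ' using h
  refine ⟨π, LipschitzWith.of_dist_le_mul fun x y => ?_, fun z e he hz => ?_⟩
  · rw [NNReal.coe_one, one_mul, dist_eq_norm, dist_eq_norm]
    have h1 := hπ' x _ (hπ y)
    have h2 := hπ' y _ (hπ x)
    -- The sum of the variational inequalities at `x` and at `y`; Cauchy–Schwarz then yields the
    -- Lipschitz constant `1`.
    have h3 : ‖π x - π y‖ ^ 2 ≤ inner ℝ (x - y) (π x - π y) := by
      rw [← real_inner_self_eq_norm_sq]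
      have : inner ℝ (x - y) (π x - π y) - inner ℝ (π x - π y) (π x - π y) =
          - (inner ℝ (x - π x) (π y - π x) + inner ℝ (y - π y) (π x - π y)) := by
        simp only [inner_sub_left, inner_sub_right]; ring
      linarith
    have h4 := real_inner_le_norm (x - y) (π x - π y)
    by_contra! h5
    nlinarith [norm_nonneg (x - y)]
  · have h1 := hπ' z e he
    have h2 := hz _ (hπ z)
    have h3 : ‖π z - e‖ ^ 2 = inner ℝ (z - e) (π z - e) + inner ℝ (z - π z) (e - π z) := by
      rw [← real_inner_self_eq_norm_sq]
      simp only [inner_sub_left, inner_sub_right]; ring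
    have h4 : ‖π z - e‖ ^ 2 ≤ 0 := by linarith
    have h5 : ‖π z - e‖ = 0 := by nlinarith [norm_nonneg (π z - e)]
    exact sub_eq_zero.1 (norm_eq_zero.1 h5)

/-! ### The length of the boundary of a rectangle -/

theorem hausdorffMeasure_vertical_le (x c d : ℝ) :
    Measure.hausdorffMeasure 1 {z : Plane | z 0 = x ∧ z 1 ∈ Set.Icc c d} ≤
      ENNReal.ofReal (d - c) := by
  have hl : LipschitzWith 1 (fun t : ℝ => (!₂[x, t] : Plane)) := by
    refine LipschitzWith.of_dist_le_mul fun s t => ?_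
    simp [EuclideanSpace.dist_eq, Fin.sum_univ_two, Real.sqrt_sq_eq_abs, Real.dist_eq]
  have h := hl.hausdorffMeasure_image_le (d := 1) zero_le_one (Set.Icc c d)
  rw [hausdorffMeasure_real, Real.volume_Icc] at h
  simp only [ENNReal.coe_one, ENNReal.one_rpow, one_mul] at h
  refine le_trans (measure_mono ?_) h
  rintro z ⟨h0, h1⟩
  refine ⟨z 1, h1, ?_⟩
  ext i
  fin_cases i <;> simp [h0]

theorem hausdorffMeasure_horizontal_le (y c d : ℝ) :
    Measure.hausdorffMeasure 1 {z : Plane | z 1 = y ∧ z 0 ∈ Set.Icc c d} ≤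
      ENNReal.ofReal (d - c) := by
  have hl : LipschitzWith 1 (fun t : ℝ => (!₂[t, y] : Plane)) := by
    refine LipschitzWith.of_dist_le_mul fun s t => ?_
    simp [EuclideanSpace.dist_eq, Fin.sum_univ_two, Real.sqrt_sq_eq_abs, Real.dist_eq]
  have h := hl.hausdorffMeasure_image_le (d := 1) zero_le_one (Set.Icc c d)
  rw [hausdorffMeasure_real, Real.volume_Icc] at h
  simp only [ENNReal.coe_one, ENNReal.one_rpow, one_mul] at h
  refine le_trans (measure_mono ?_) h
  rintro z ⟨h0, h1⟩
  refine ⟨z 0, h1, ?_⟩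
  ext i
  fin_cases i <;> simp [h0]

theorem isClosed_box (a b c d : ℝ) : IsClosed (box a b c d) := by
  have h0 : IsClosed {p : Plane | p 0 ∈ Set.Icc a b} :=
    isClosed_Icc.preimage (f := fun p : Plane => p 0) (by fun_prop)
  have h1 : IsClosed {p : Plane | p 1 ∈ Set.Icc c d} :=
    isClosed_Icc.preimage (f := fun p : Plane => p 1) (by fun_prop)
  exact h0.inter h1

theorem isCompact_box (a b c d : ℝ) : IsCompact (box a b c d) := by
  refine Metric.isCompact_of_isClosed_isBounded (isClosed_box a b c d) ?_
  refine Metric.isBounded_iff_subset_closedBall 0 |>.2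
    ⟨|a| + |b| + |c| + |d|, fun p hp => ?_⟩
  obtain ⟨⟨h1, h2⟩, h3, h4⟩ := hp
  rw [mem_closedBall_zero_iff, EuclideanSpace.norm_eq]
  refine Real.sqrt_le_iff.2 ⟨by positivity, ?_⟩
  simp only [Fin.sum_univ_two, Real.norm_eq_abs, sq_abs]
  have e0 : |p 0| ≤ |a| + |b| := abs_le.2
    ⟨by linarith [neg_abs_le a, abs_nonneg b], by linarith [le_abs_self b, abs_nonneg a]⟩
  have e1 : |p 1| ≤ |c| + |d| := abs_le.2
    ⟨by linarith [neg_abs_le c, abs_nonneg d], by linarith [le_abs_self d, abs_nonneg c]⟩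
  rw [← sq_abs (p 0), ← sq_abs (p 1)]
  nlinarith [abs_nonneg (p 0), abs_nonneg (p 1)]

theorem hausdorffMeasure_frontier_box_le {a b : ℝ} (ha : 0 ≤ a) (hb : 0 ≤ b) :
    perimeter (box 0 a 0 b) ≤ ENNReal.ofReal (2 * (a + b)) := by
  have hsub : frontier (box 0 a 0 b) ⊆
      ({z : Plane | z 0 = 0 ∧ z 1 ∈ Set.Icc 0 b} ∪ {z : Plane | z 0 = a ∧ z 1 ∈ Set.Icc 0 b}) ∪
      ({z : Plane | z 1 = 0 ∧ z 0 ∈ Set.Icc 0 a} ∪ {z : Plane | z 1 = b ∧ z 0 ∈ Set.Icc 0 a}) := by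
    intro z hz
    have hm : z ∈ box 0 a 0 b := (isClosed_box 0 a 0 b).closure_eq ▸ hz.1
    by_contra hcon
    simp only [Set.mem_union, Set.mem_ofPred_eq, not_or] at hcon
    obtain ⟨⟨h1, h2⟩, h3, h4⟩ := hcon
    obtain ⟨m1, m2⟩ := hm
    have o0 : IsOpen {p : Plane | p 0 ∈ Set.Ioo 0 a} :=
      isOpen_Ioo.preimage (f := fun p : Plane => p 0) (by fun_prop)
    have o1 : IsOpen {p : Plane | p 1 ∈ Set.Ioo 0 b} :=
      isOpen_Ioo.preimage (f := fun p : Plane => p 1) (by fun_prop)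
    refine hz.2 (interior_maximal (s := box 0 a 0 b)
      (t := {p : Plane | p 0 ∈ Set.Ioo 0 a} ∩ {p : Plane | p 1 ∈ Set.Ioo 0 b})
      (fun p hp => ⟨Set.Ioo_subset_Icc_self hp.1, Set.Ioo_subset_Icc_self hp.2⟩)
      (o0.inter o1) ⟨⟨?_, ?_⟩, ?_, ?_⟩)
    · exact lt_of_le_of_ne m1.1 fun h => h1 ⟨h.symm, m2⟩
    · exact lt_of_le_of_ne m1.2 fun h => h2 ⟨h, m2⟩
    · exact lt_of_le_of_ne m2.1 fun h => h3 ⟨h.symm, m1⟩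
    · exact lt_of_le_of_ne m2.2 fun h => h4 ⟨h, m1⟩
  refine (measure_mono hsub).trans ((measure_union_le _ _).trans ((add_le_add
    ((measure_union_le _ _).trans (add_le_add (hausdorffMeasure_vertical_le _ _ _)
      (hausdorffMeasure_vertical_le _ _ _)))
    ((measure_union_le _ _).trans (add_le_add (hausdorffMeasure_horizontal_le _ _ _)
      (hausdorffMeasure_horizontal_le _ _ _)))).trans (le_of_eq ?_)))
  simp only [sub_zero]
  rw [← ENNReal.ofReal_add hb hb, ← ENNReal.ofReal_add ha ha,
    ← ENNReal.ofReal_add (by positivity) (by positivity)]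
  congr 1
  ring

/-- The perimeter of a convex set is at most that of an enclosing rectangle. -/
theorem perimeter_le_of_subset_box {S : Set Plane} (hS : IsCompact S) (hc : Convex ℝ S)
    (hi : (interior S).Nonempty) {a b : ℝ} (ha : 0 ≤ a) (hb : 0 ≤ b) (hSb : S ⊆ box 0 a 0 b) :
    perimeter S ≤ ENNReal.ofReal (2 * (a + b)) := by
  obtain ⟨π, hπ, hπe⟩ := exists_nearest_point_map hS hc (hi.mono interior_subset)
  -- A boundary point `e` has an outer normal `n`. The ray from `e` in direction `n` meets the
  -- boundary of the rectangle in a point whose nearest point in `S` is `e`.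
  have hsub : frontier S ⊆ π '' frontier (box 0 a 0 b) := by
    intro e he
    have heS : e ∈ S := hS.isClosed.closure_eq ▸ he.1
    obtain ⟨f, hf⟩ := geometric_hahn_banach_open_point hc.interior isOpen_interior he.2
    set n := (InnerProductSpace.toDual ℝ Plane).symm f with hn
    have hfn : ∀ x, f x = inner ℝ n x := fun x => by
      rw [hn, InnerProductSpace.toDual_symm_apply]
    have hcl : closure (interior S) = S := by
      rw [hc.closure_interior_eq_closure_of_nonempty_interior hi, hS.isClosed.closure_eq]
    have hle : ∀ x ∈ S, f x ≤ f e := by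
      intro x hx
      rw [← hcl] at hx
      exact closure_minimal (fun y hy => (hf y hy).le)
        (isClosed_le f.continuous continuous_const) hx
    have hn0 : n ≠ 0 := by
      intro h
      obtain ⟨x, hx⟩ := hi
      have := hf x hx
      rw [hfn, hfn, h, inner_zero_left, inner_zero_left] at this
      exact lt_irrefl _ this
    obtain ⟨r, hr, hz⟩ := exists_frontier_ray (isCompact_box 0 a 0 b) (hSb heS) hn0
    refine ⟨_, hz, hπe _ e heS fun w hw => ?_⟩
    rw [add_sub_cancel_left, inner_smul_left, inner_sub_right, ← hfn, ← hfn]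
    have := hle w hw
    exact mul_nonpos_of_nonneg_of_nonpos (by simpa using hr) (by linarith)
  refine (measure_mono hsub).trans (le_trans ?_ (hausdorffMeasure_frontier_box_le ha hb))
  have h := hπ.hausdorffMeasure_image_le (d := 1) zero_le_one (frontier (box 0 a 0 b))
  simp only [ENNReal.coe_one, ENNReal.one_rpow, one_mul] at h
  exact h

/-! ### Bounding rectangles, and the area of a set of given diameter -/

theorem convexHull_subset_box {V : Set Plane} {a b c d : ℝ} (h : V ⊆ box a b c d) :
    convexHull ℝ V ⊆ box a b c d := by
  intro p hp
  have h1 := convexHull_linear_le (V := V) (u := -1) (v := 0) (c := -a)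
    (fun p hp => by have := (h hp).1.1; linarith) p hp
  have h2 := convexHull_linear_le (V := V) (u := 1) (v := 0) (c := b)
    (fun p hp => by have := (h hp).1.2; linarith) p hp
  have h3 := convexHull_linear_le (V := V) (u := 0) (v := -1) (c := -c)
    (fun p hp => by have := (h hp).2.1; linarith) p hp
  have h4 := convexHull_linear_le (V := V) (u := 0) (v := 1) (c := d)
    (fun p hp => by have := (h hp).2.2; linarith) p hp
  exact ⟨⟨by linarith, by linarith⟩, by linarith, by linarith⟩

theorem dist_sq_plane (p q : Plane) : dist p q ^ 2 = (p 0 - q 0) ^ 2 + (p 1 - q 1) ^ 2 := by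
  rw [EuclideanSpace.dist_eq, Real.sq_sqrt (by positivity), Fin.sum_univ_two]
  simp [Real.dist_eq, sq_abs]

/-- A planar convex set of diameter at most `d` leaves room in the corners of its bounding
square. -/
theorem volume_le_of_dist_le {S : Set Plane} (hS : IsCompact S) (hc : Convex ℝ S) {d : ℝ}
    (hne : S.Nonempty) (hd : ∀ p ∈ S, ∀ q ∈ S, dist p q ≤ d) :
    volume S ≤ ENNReal.ofReal (23 / 25 * d ^ 2) := by
  have hd0 : 0 ≤ d := by
    obtain ⟨p, hp⟩ := hne
    simpa using hd p hp p hp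
  -- The sum of the coordinates varies by at most `√2 * d`, and `71 / 50` is a rational upper bound
  -- for `√2`.
  have ext : ∀ p ∈ S, ∀ q ∈ S, p 0 - q 0 ≤ d ∧ p 1 - q 1 ≤ d ∧
      p 0 + p 1 - (q 0 + q 1) ≤ 71 / 50 * d := by
    intro p hp q hq
    have h1 := dist_sq_plane p q
    have h2 := pow_le_pow_left₀ dist_nonneg (hd p hp q hq) 2
    refine ⟨abs_le_of_sq_le_sq' (b := d) ?_ hd0 |>.2, abs_le_of_sq_le_sq' (b := d) ?_ hd0 |>.2,
      abs_le_of_sq_le_sq' (b := 71 / 50 * d) ?_ (by positivity) |>.2⟩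
    · nlinarith [sq_nonneg (p 1 - q 1)]
    · nlinarith [sq_nonneg (p 0 - q 0)]
    · nlinarith [sq_nonneg (p 0 - q 0 - (p 1 - q 1)), sq_nonneg d]
  obtain ⟨px, hpx, hx⟩ := hS.exists_isMinOn hne (f := fun p => p 0) (by fun_prop)
  obtain ⟨py, hpy, hy⟩ := hS.exists_isMinOn hne (f := fun p => p 1) (by fun_prop)
  obtain ⟨pm, hpm, hm⟩ := hS.exists_isMinOn hne (f := fun p => p 0 + p 1) (by fun_prop)
  obtain ⟨pM, hpM, hM⟩ := hS.exists_isMaxOn hne (f := fun p => p 0 + p 1) (by fun_prop)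
  simp only [isMinOn_iff, isMaxOn_iff] at hx hy hm hM
  set x := px 0
  set y := py 1
  set u := pm 0 + pm 1 - x - y with hu
  set v := min d (2 * d - (pM 0 + pM 1 - x - y)) with hv
  have hu0 : 0 ≤ u := by have := hx pm hpm; have := hy pm hpm; linarith
  have hud : u ≤ d := by have := hm px hpx; have := (ext px hpx py hpy).2.1; linarith
  have hv0 : 0 ≤ v := by
    refine le_min hd0 ?_
    have := (ext pM hpM px hpx).1; have := (ext pM hpM py hpy).2.1; linarith
  have hvd : v ≤ d := min_le_left _ _
  have hvM : v ≤ 2 * d - (pM 0 + pM 1 - x - y) := min_le_right _ _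
  -- The sum of the coordinates varies by `2 * d` on the square but by at most `71 / 50 * d` on `S`;
  -- the two corners share the difference.
  have huv : 29 / 50 * d ≤ u + v := by
    have := (ext pM hpM pm hpm).2.2
    rcases min_choice d (2 * d - (pM 0 + pM 1 - x - y)) with h | h <;> rw [← hv] at h <;> linarith
  set T₁ := convexHull ℝ {(!₂[x, y] : Plane), !₂[x + u, y], !₂[x, y + u]} with hT₁
  set T₂ := convexHull ℝ {(!₂[x + d, y + d] : Plane), !₂[x + d - v, y + d], !₂[x + d, y + d - v]}
    with hT₂
  have t1 : ENNReal.ofReal (u ^ 2 / 2) ≤ volume T₁ := by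
    have h := le_volume_triangle (convex_convexHull ℝ _ : Convex ℝ T₁)
      (p := !₂[x, y]) (q := !₂[x + u, y]) (r := !₂[x, y + u])
      (subset_convexHull _ _ (by simp)) (subset_convexHull _ _ (by simp))
      (subset_convexHull _ _ (by simp))
    refine le_trans (ENNReal.ofReal_le_ofReal (le_of_eq ?_)) h
    simp [sq]
  have t2 : ENNReal.ofReal (v ^ 2 / 2) ≤ volume T₂ := by
    have h := le_volume_triangle (convex_convexHull ℝ _ : Convex ℝ T₂)
      (p := !₂[x + d, y + d]) (q := !₂[x + d - v, y + d]) (r := !₂[x + d, y + d - v])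
      (subset_convexHull _ _ (by simp)) (subset_convexHull _ _ (by simp))
      (subset_convexHull _ _ (by simp))
    refine le_trans (ENNReal.ofReal_le_ofReal (le_of_eq ?_)) h
    simp [sq]
  have c1 : ∀ p ∈ T₁, p 0 ≤ (x + y + u) + (-1) * p 1 := by
    intro p hp
    have := convexHull_linear_le (u := 1) (v := 1) (c := x + y + u)
      (by rintro _ (rfl | rfl | rfl) <;> simp <;> linarith) p hp
    linarith
  have c2 : ∀ p ∈ T₂, (x + y + 2 * d - v) + (-1) * p 1 ≤ p 0 := by
    intro p hp
    have := convexHull_linear_le (u := -1) (v := -1) (c := -(x + y + 2 * d - v))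
      (by rintro _ (rfl | rfl | rfl) <;> simp <;> linarith) p hp
    linarith
  have s1 : ∀ p ∈ S, (x + y + u) + (-1) * p 1 ≤ p 0 := fun p hp => by
    have := hm p hp; linarith
  have s2 : ∀ p ∈ S, p 0 ≤ (x + y + 2 * d - v) + (-1) * p 1 := fun p hp => by
    have := hM p hp; linarith
  have n1 : NonOverlapping T₁ S := nonOverlapping_of_lines c1 s1 fun _ _ _ => le_rfl
  have n2 : NonOverlapping S T₂ := nonOverlapping_of_lines s2 c2 fun _ _ _ => le_rfl
  have n3 : NonOverlapping T₁ T₂ := nonOverlapping_of_lines c1 c2 fun _ _ _ => by linarith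
  have key := sum_volume_le (Finset.univ : Finset (Fin 3)) (S := ![S, T₁, T₂])
    (R := box x (x + d) y (y + d)) ?_ ?_ ?_
  · rw [Fin.sum_univ_three, volume_box, ← ENNReal.ofReal_mul (by linarith)] at key
    simp only [Matrix.cons_val_zero, Matrix.cons_val_one, Matrix.cons_val_two,
      add_sub_cancel_left] at key
    have k2 : volume S + ENNReal.ofReal (u ^ 2 / 2 + v ^ 2 / 2) ≤ ENNReal.ofReal (d * d) := by
      rw [ENNReal.ofReal_add (by positivity) (by positivity), ← add_assoc]
      exact le_trans (add_le_add (add_le_add le_rfl t1) t2) key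
    have k3 := ENNReal.le_sub_of_add_le_right ENNReal.ofReal_ne_top k2
    rw [← ENNReal.ofReal_sub _ (by positivity)] at k3
    refine k3.trans (ENNReal.ofReal_le_ofReal ?_)
    -- The triangles have area at least `(u + v) ^ 2 / 4`, hence at least `0.0841 * d ^ 2`, and `2 /
    -- 25 * d ^ 2` is needed.
    nlinarith [sq_nonneg (u - v), mul_nonneg (sub_nonneg.2 huv) (by linarith : 0 ≤ u + v), sq_nonneg d]
  · intro i _
    fin_cases i
    · exact hc
    · exact convex_convexHull ℝ _
    · exact convex_convexHull ℝ _
  · intro i _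
    fin_cases i
    · intro p hp
      exact ⟨⟨hx p hp, by have := (ext p hp px hpx).1; linarith⟩, hy p hp,
        by have := (ext p hp py hpy).2.1; linarith⟩
    · refine convexHull_subset_box ?_
      rintro _ (rfl | rfl | rfl) <;> refine ⟨⟨?_, ?_⟩, ?_, ?_⟩ <;> simp <;> linarith
    · refine convexHull_subset_box ?_
      rintro _ (rfl | rfl | rfl) <;> refine ⟨⟨?_, ?_⟩, ?_, ?_⟩ <;> simp <;> linarith
  · intro i _ j _ hij
    fin_cases i <;> fin_cases j <;> first | exact absurd rfl hij | skip
    · exact n1.symm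
    · exact n2
    · exact n1
    · exact n3
    · exact n2.symm
    · exact n3.symm

/-! ### Total correctness of programs with a bound on the number of steps -/

/-! ### Reading after writing -/

section Memory
variable (s : State) (a k b : ℕ)

@[simp] theorem State.writeNat_nat_self (v : ℕ) :
    (s.writeNat a k v).nat a = Function.update (s.nat a) k v := by
  simp [State.writeNat]

@[simp] theorem State.writeNat_nat_of_ne (v : ℕ) (h : b ≠ a) :
    (s.writeNat a k v).nat b = s.nat b := by
  simp [State.writeNat, h]

@[simp] theorem State.writeNat_real (v : ℕ) : (s.writeNat a k v).real = s.real := rfl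

@[simp] theorem State.writeReal_real_self (v : ℝ) :
    (s.writeReal a k v).real a = Function.update (s.real a) k v := by
  simp [State.writeReal]

@[simp] theorem State.writeReal_real_of_ne (v : ℝ) (h : b ≠ a) :
    (s.writeReal a k v).real b = s.real b := by
  simp [State.writeReal, h]

@[simp] theorem State.writeReal_nat (v : ℝ) : (s.writeReal a k v).nat = s.nat := rfl

end Memory

/-- Started in `s`, the program `P` halts after at most `B` steps in a state that satisfies `Q`. -/
def Runs (P : Program) (s : State) (B : ℕ) (Q : State → Prop) : Prop :=
  ∃ (t : ℕ) (s' : State), Exec P s t s' ∧ t ≤ B ∧ Q s'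

/-! ### Proof rules for single instructions and their composition -/

section Rules
variable {P P' : Program} {s : State} {B B' : ℕ} {Q R : State → Prop}

theorem Runs.mono (h : Runs P s B Q) (hB : B ≤ B') (hQ : ∀ s', Q s' → R s') : Runs P s B' R := by
  obtain ⟨t, s', h1, h2, h3⟩ := h
  exact ⟨t, s', h1, h2.trans hB, hQ _ h3⟩

theorem runs_skip (h : Q s) : Runs .skip s 1 Q := ⟨1, s, .skip s, le_rfl, h⟩

theorem runs_setNat {a : ℕ} {i e : NatExpr} (h : Q (s.writeNat a (i.eval s) (e.eval s))) :
    Runs (.setNat a i e) s 1 Q := ⟨1, _, .setNat s a i e, le_rfl, h⟩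

theorem runs_setReal {a : ℕ} {i : NatExpr} {e : RealExpr}
    (h : Q (s.writeReal a (i.eval s) (e.eval s))) :
    Runs (.setReal a i e) s 1 Q := ⟨1, _, .setReal s a i e, le_rfl, h⟩

theorem Runs.seq (h : Runs P s B Q) (h' : ∀ s', Q s' → Runs P' s' B' R) :
    Runs (.seq P P') s (B + B') R := by
  obtain ⟨t, s', h1, h2, h3⟩ := h
  obtain ⟨t', s'', h1', h2', h3'⟩ := h' s' h3
  exact ⟨t + t', s'', .seq h1 h1', add_le_add h2 h2', h3'⟩

theorem runs_setNat_seq {a : ℕ} {i e : NatExpr}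
    (h : Runs P (s.writeNat a (i.eval s) (e.eval s)) B Q) :
    Runs (.seq (.setNat a i e) P) s (1 + B) Q :=
  Runs.seq (Q := fun s' => s' = s.writeNat a (i.eval s) (e.eval s)) (runs_setNat rfl)
    (by rintro _ rfl; exact h)

theorem runs_setReal_seq {a : ℕ} {i : NatExpr} {e : RealExpr}
    (h : Runs P (s.writeReal a (i.eval s) (e.eval s)) B Q) :
    Runs (.seq (.setReal a i e) P) s (1 + B) Q :=
  Runs.seq (Q := fun s' => s' = s.writeReal a (i.eval s) (e.eval s)) (runs_setReal rfl)
    (by rintro _ rfl; exact h)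

theorem runs_cond {b : Test} (h : b.Holds s → Runs P s B Q) (h' : ¬ b.Holds s → Runs P' s B Q) :
    Runs (.cond b P P') s (B + 1) Q := by
  by_cases hb : b.Holds s
  · obtain ⟨t, s', h1, h2, h3⟩ := h hb
    exact ⟨t + 1, s', .cond_true hb h1, by omega, h3⟩
  · obtain ⟨t, s', h1, h2, h3⟩ := h' hb
    exact ⟨t + 1, s', .cond_false hb h1, by omega, h3⟩

end Rules

/-- The arrays of natural numbers into which a program writes. -/
def Program.natWrites : Program → List ℕ
  | .skip => []
  | .setNat a _ _ => [a]
  | .setReal _ _ _ => []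
  | .seq P Q => P.natWrites ++ Q.natWrites
  | .cond _ P Q => P.natWrites ++ Q.natWrites
  | .loop _ P => P.natWrites

/-- The arrays of real numbers into which a program writes. -/
def Program.realWrites : Program → List ℕ
  | .skip => []
  | .setNat _ _ _ => []
  | .setReal a _ _ => [a]
  | .seq P Q => P.realWrites ++ Q.realWrites
  | .cond _ P Q => P.realWrites ++ Q.realWrites
  | .loop _ P => P.realWrites

/-- `s` and `s'` agree on the arrays into which `P` does not write. -/
structure Frame (P : Program) (s s' : State) : Prop where
  nat : ∀ a, a ∉ P.natWrites → s'.nat a = s.nat a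
  real : ∀ a, a ∉ P.realWrites → s'.real a = s.real a

/-- This frame property is what keeps postconditions short: arrays that a program does not assign to
need no mention in them. -/
theorem Exec.frame {P : Program} {s s' : State} {t : ℕ} (h : Exec P s t s') : Frame P s s' := by
  induction h with
  | skip s => exact ⟨fun _ _ => rfl, fun _ _ => rfl⟩
  | setNat s a i e =>
    refine ⟨fun b hb => ?_, fun _ _ => rfl⟩
    simp only [Program.natWrites, List.mem_singleton] at hb
    simp [hb]
  | setReal s a i e =>
    refine ⟨fun _ _ => rfl, fun b hb => ?_⟩
    simp only [Program.realWrites, List.mem_singleton] at hb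
    simp [hb]
  | seq _ _ ih ih' =>
    constructor
    · intro a ha
      simp only [Program.natWrites, List.mem_append, not_or] at ha
      rw [ih'.nat a ha.2, ih.nat a ha.1]
    · intro a ha
      simp only [Program.realWrites, List.mem_append, not_or] at ha
      rw [ih'.real a ha.2, ih.real a ha.1]
  | cond_true _ _ ih =>
    constructor
    · intro a ha
      simp only [Program.natWrites, List.mem_append, not_or] at ha
      exact ih.nat a ha.1
    · intro a ha
      simp only [Program.realWrites, List.mem_append, not_or] at ha
      exact ih.real a ha.1
  | cond_false _ _ ih =>
    constructor
    · intro a ha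
      simp only [Program.natWrites, List.mem_append, not_or] at ha
      exact ih.nat a ha.2
    · intro a ha
      simp only [Program.realWrites, List.mem_append, not_or] at ha
      exact ih.real a ha.2
  | loop_true _ _ _ ih ih' =>
    exact ⟨fun a ha => by rw [ih'.nat a ha, ih.nat a ha],
      fun a ha => by rw [ih'.real a ha, ih.real a ha]⟩
  | loop_false _ => exact ⟨fun _ _ => rfl, fun _ _ => rfl⟩

theorem Runs.frame {P : Program} {s : State} {B : ℕ} {Q : State → Prop} (h : Runs P s B Q) :
    Runs P s B fun s' => Q s' ∧ Frame P s s' := by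
  obtain ⟨t, s', h1, h2, h3⟩ := h
  exact ⟨t, s', h1, h2, h3, h1.frame⟩

/-! ### Counting loops and the search for a minimum -/

/-- Cell `0` of an array of natural numbers, used as a register. -/
abbrev NatExpr.reg (a : ℕ) : NatExpr := .read a (.const 0)

/-- Cell `0` of an array of real numbers, used as a register. -/
abbrev RealExpr.reg (a : ℕ) : RealExpr := .read a (.const 0)

/-- Run `P` with the register `c` running through `lo ≤ k < hi`. -/
def forLoop (c : ℕ) (lo hi : NatExpr) (P : Program) : Program :=
  .seq (.setNat c (.const 0) lo)
    (.loop (.natLt (.reg c) hi) (.seq P (.setNat c (.const 0) (.add (.reg c) (.const 1)))))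

/-- `Inv k` describes the state in which the counter has just become `k`, and the body has to leave
the counter alone. A round costs `B` for the body and one step each for the test and the increment;
the initialization and the final, failing test account for the additional `2`. -/
theorem runs_forLoop {c : ℕ} {lo hi : NatExpr} {P : Program} {s : State} {B N : ℕ}
    (Inv : ℕ → State → Prop) (hlo : lo.eval s ≤ N)
    (hhi : ∀ k s', Inv k s' → s'.nat c 0 = k → hi.eval s' = N)
    (hinit : Inv (lo.eval s) (s.writeNat c 0 (lo.eval s)))
    (hstep : ∀ k s', k < N → lo.eval s ≤ k → Inv k s' → s'.nat c 0 = k →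
      Runs P s' B fun s'' => s''.nat c 0 = k ∧ Inv (k + 1) (s''.writeNat c 0 (k + 1))) :
    Runs (forLoop c lo hi P) s ((N - lo.eval s) * (B + 2) + 2) (Inv N) := by
  have key : ∀ d k s', d = N - k → lo.eval s ≤ k → k ≤ N → Inv k s' → s'.nat c 0 = k →
      Runs (.loop (.natLt (.reg c) hi) (.seq P (.setNat c (.const 0)
        (.add (.reg c) (.const 1))))) s' (d * (B + 2) + 1) (Inv N) := by
    intro d
    induction d with
    | zero =>
      intro k s' hd h0 hk hI hc
      obtain rfl : k = N := by omega
      refine ⟨1, s', .loop_false ?_, by omega, hI⟩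
      simp [Test.Holds, NatExpr.eval, hc, hhi k s' hI hc]
    | succ d ih =>
      intro k s' hd h0 hk hI hc
      have hkN : k < N := by omega
      have hb : Runs (.seq P (.setNat c (.const 0) (.add (.reg c) (.const 1)))) s' (B + 1)
          fun s'' => Inv (k + 1) s'' ∧ s''.nat c 0 = k + 1 := by
        refine Runs.seq (hstep k s' hkN h0 hI hc) fun s'' h => runs_setNat ?_
        simp only [NatExpr.eval, h.1]
        exact ⟨h.2, by simp⟩
      obtain ⟨t, s'', h1, h2, h3, h4⟩ := hb
      obtain ⟨t', s₃, h1', h2', h3'⟩ := ih (k + 1) s'' (by omega) (by omega) (by omega) h3 h4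
      refine ⟨t + t' + 1, s₃, .loop_true ?_ h1 h1', ?_, h3'⟩
      · simp [Test.Holds, NatExpr.eval, hc, hhi k s' hI hc, hkN]
      · rw [Nat.add_mul]; omega
  refine (runs_setNat_seq (key _ _ _ rfl le_rfl hlo hinit (by simp [NatExpr.eval]))).mono ?_
    fun _ h => h
  omega

/-- Let the register `d`, starting from its current value, run to an index that minimizes `f` among
those `lo ≤ k < hi` that satisfy `g`. -/
def argMin (d c : ℕ) (lo hi : NatExpr) (g : NatExpr → Test) (f : NatExpr → RealExpr) : Program :=
  forLoop c lo hi (.cond (.and (g (.reg c)) (.realLt (f (.reg c)) (f (.reg d))))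
    (.setNat d (.const 0) (.reg c)) .skip)

/-- The start value of `d` need not be in the range nor satisfy the guard, and it survives if
nothing better is found. Callers that need a guarded result therefore start at an index that meets
the guard. -/
theorem runs_argMin {d c : ℕ} {lo hi : NatExpr} {g : NatExpr → Test} {f : NatExpr → RealExpr}
    {s : State} (hcd : c ≠ d) (G : ℕ → Prop) (F : ℕ → ℝ)
    (hg : ∀ s' e, s'.real = s.real → (∀ a, a ≠ c → a ≠ d → s'.nat a = s.nat a) →
      ((g (.reg e)).Holds s' ↔ G (s'.nat e 0)))
    (hf : ∀ s' e, s'.real = s.real → (∀ a, a ≠ c → a ≠ d → s'.nat a = s.nat a) →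
      (f (.reg e)).eval s' = F (s'.nat e 0))
    (hhi : ∀ s', (∀ a, a ≠ c → a ≠ d → s'.nat a = s.nat a) → hi.eval s' = hi.eval s)
    (hle : lo.eval s ≤ hi.eval s) :
    Runs (argMin d c lo hi g f) s ((hi.eval s - lo.eval s) * 4 + 2) fun s' =>
      s'.real = s.real ∧ (∀ a, a ≠ c → a ≠ d → s'.nat a = s.nat a) ∧
      (s'.nat d 0 = s.nat d 0 ∨
        (lo.eval s ≤ s'.nat d 0 ∧ s'.nat d 0 < hi.eval s ∧ G (s'.nat d 0))) ∧
      F (s'.nat d 0) ≤ F (s.nat d 0) ∧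
      ∀ k, lo.eval s ≤ k → k < hi.eval s → G k → F (s'.nat d 0) ≤ F k := by
  refine (runs_forLoop (N := hi.eval s) (B := 2) (fun m s' =>
      s'.real = s.real ∧ (∀ a, a ≠ c → a ≠ d → s'.nat a = s.nat a) ∧
      (s'.nat d 0 = s.nat d 0 ∨
        (lo.eval s ≤ s'.nat d 0 ∧ s'.nat d 0 < hi.eval s ∧ G (s'.nat d 0))) ∧
      F (s'.nat d 0) ≤ F (s.nat d 0) ∧
      ∀ k, lo.eval s ≤ k → k < m → G k → F (s'.nat d 0) ≤ F k) hle ?_ ?_ ?_).mono le_rfl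
      fun _ h => h
  · intro k s' h _
    exact hhi s' h.2.1
  · refine ⟨rfl, fun a h _ => by simp [h], by simp [hcd.symm], by simp [hcd.symm],
      fun k h1 h2 => absurd h1 (by omega)⟩
  · rintro k s' hk hlk ⟨h1, h2, h3, h4, h5⟩ hc
    have eg := hg s' c h1 h2
    have ef := hf s' c h1 h2
    have ef' := hf s' d h1 h2
    rw [hc] at eg ef
    refine runs_cond (fun hb => ?_) (fun hb => ?_)
    · simp only [Test.Holds, eg, ef, ef'] at hb
      refine runs_setNat ?_
      simp only [NatExpr.eval, hc]
      refine ⟨by simp [hcd, hc], h1, fun a ha hd => by simp [ha, hd, h2], ?_, ?_, ?_⟩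
      · right; simp [hcd.symm, hlk, hk, hb.1]
      · simp [hcd.symm]; linarith [hb.2]
      · intro j hj hj' hG
        simp [hcd.symm]
        rcases Nat.lt_succ_iff_lt_or_eq.1 hj' with h | rfl
        · exact hb.2.le.trans (h5 j hj h hG)
        · exact le_rfl
    · simp only [Test.Holds, eg, ef, ef'] at hb
      refine runs_skip ⟨hc, h1, fun a ha hd => by simp [ha, hd, h2], by simpa [hcd.symm] using h3,
        by simpa [hcd.symm] using h4, ?_⟩
      intro j hj hj' hG
      simp [hcd.symm]
      rcases Nat.lt_succ_iff_lt_or_eq.1 hj' with h | rfl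
      · exact h5 j hj h hG
      · by_contra! hlt
        exact hb ⟨hG, hlt⟩

/-! ### The row layout

Pieces are sorted into classes of similar height, each class is packed into rows of a common
height by increasing slope of the spines, and the rows are stacked in bins of height `C`. -/

/-- The height of the rows of the class whose tallest piece has height `x`. -/
def classTop (C x : ℝ) : ℝ := if C / 2 < x then C else if C / 4 < x then C / 2 else x

theorem le_classTop {C x : ℝ} (h : x ≤ C) : x ≤ classTop C x := by
  unfold classTop; split_ifs <;> linarith

/-- Rounding up never doubles the height, so the tallest piece belongs to the class that it opens.
-/
theorem half_classTop_lt {C x : ℝ} (hx : 0 < x) : classTop C x / 2 < x := by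
  unfold classTop; split_ifs <;> linarith

/-- Two placed pieces are in different rows, or one is to the left of the other. -/
def RowSeparated (h s w A Y : ℕ → ℝ) (i j : ℕ) : Prop :=
  Y i + h i ≤ Y j ∨ Y j + h j ≤ Y i ∨
    (Y i = Y j ∧ ((A i + w i ≤ A j ∧ s i ≤ s j) ∨ (A j + w j ≤ A i ∧ s j ≤ s i)))

/-- The invariant of the layout. There are `n` pieces with heights `h`, slopes `s` of the spines and
widths `w`; `T` is the base length after which a row is closed, `C` the height of a bin and `K` a
bound for the heights. The class in work has rows of height `c`; the row in work extends from `y`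
to `yt` in bin `b` and is filled up to `a`. The heights of the remaining pieces are kept in `r`,
which is zero for the placed ones; those have base points `A`, bottoms `Y` and bins `β`. -/
structure LayoutInv (n : ℕ) (h s w : ℕ → ℝ) (T C K c a y yt : ℝ) (b : ℕ) (r A Y : ℕ → ℝ)
    (β : ℕ → ℕ) : Prop where
  live : ∀ i < n, r i = h i ∨ r i = 0
  le_class : ∀ i < n, r i ≤ c
  class_nonneg : 0 ≤ c
  class_cases : c = 2 * K ∨ c = C ∨ c = C / 2 ∨ c ≤ C / 4
  base_nonneg : 0 ≤ a
  bottom_nonneg : 0 ≤ y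
  top_le : yt ≤ C
  top_nonneg : 0 ≤ yt
  row : c = 2 * K ∨ (c ≤ K ∧ yt = y + c)
  top_of_lt : C < c → yt = 0
  top_of_full : c = C → yt = 0 ∨ yt = C
  top_of_half : c = C / 2 → yt = 0 ∨ yt = C / 2 ∨ yt = C
  area : T * (3 / 4 * C * b + yt) + a * c ≤
    2 * ∑ i ∈ Finset.range n, w i * (h i - r i) + T * (2 * K - c)
  area_of_pos : 0 < b → T * C + a * c <
    2 * ∑ i ∈ Finset.range n, w i * (h i - r i) + T * (2 * K - c)
  placed : ∀ i < n, r i = 0 → 0 ≤ A i ∧ A i ≤ T ∧ 0 ≤ Y i ∧ Y i + h i ≤ C ∧ β i ≤ b ∧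
    (β i = b → Y i + h i ≤ yt)
  current : ∀ i < n, r i = 0 → β i = b → Y i + h i ≤ y ∨
    (Y i = y ∧ A i + w i ≤ a ∧ ∀ j < n, c / 2 < r j → s i ≤ s j)
  pairs : ∀ i < n, ∀ j < n, i ≠ j → r i = 0 → r j = 0 → β i = β j → RowSeparated h s w A Y i j

namespace LayoutInv

variable {n : ℕ} {h s w : ℕ → ℝ} {T C K c a y yt : ℝ} {b : ℕ} {r A Y : ℕ → ℝ} {β : ℕ → ℕ}

/-- The fictitious class of height `2 * K` has no members, as no piece is higher than `K`. The first
real class is charged to it just as every later class is charged to its predecessor. -/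
theorem init (hC : 0 < C) (hK : 0 ≤ K) (hh : ∀ i < n, 0 < h i ∧ h i ≤ K)
    (hr : ∀ i < n, r i = h i) :
    LayoutInv n h s w T C K (2 * K) 0 0 0 0 r A Y β where
  live i hi := .inl (hr i hi)
  le_class i hi := by rw [hr i hi]; linarith [hh i hi]
  class_nonneg := by linarith
  class_cases := .inl rfl
  base_nonneg := le_rfl
  bottom_nonneg := le_rfl
  top_le := hC.le
  top_nonneg := le_rfl
  row := .inl rfl
  top_of_lt _ := rfl
  top_of_full _ := .inl rfl
  top_of_half _ := .inl rfl
  area := by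
    rw [Finset.sum_eq_zero (fun i hi => by rw [hr i (Finset.mem_range.1 hi), sub_self, mul_zero])]
    simp
  area_of_pos h := absurd h (lt_irrefl 0)
  placed i hi h0 := absurd h0 (by rw [hr i hi]; exact (hh i hi).1.ne')
  current i hi h0 := absurd h0 (by rw [hr i hi]; exact (hh i hi).1.ne')
  pairs i hi _ _ _ h0 := absurd h0 (by rw [hr i hi]; exact (hh i hi).1.ne')

/-- The potential argument. Opening a row of height `c'` costs `T * c'`. Within a class this is paid
by `a * c`, since the row just closed has `T < a`. For a new class `c' ≤ c / 2`, and the allowance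
`T * (2 * K - c)` grows by `T * (c - c')`, which is at least `T * c'`. If the row does not fit, only
`3 / 4 * C` is charged from then on for the bin left behind. -/
theorem newRow (H : LayoutInv n h s w T C K c a y yt b r A Y β) (hT : 0 < T) (hC : 0 < C)
    (hKC : K = C ∨ 4 * K ≤ C) {c' : ℝ}
    (hc' : (c' = c ∧ T < a ∧ c ≠ 2 * K) ∨
      ∃ x, 0 < x ∧ x ≤ K ∧ x ≤ c / 2 ∧ c' = classTop C x ∧ ∀ i < n, r i ≤ x) :
    (yt + c' ≤ C → LayoutInv n h s w T C K c' 0 yt (yt + c') b r A Y β) ∧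
      (C < yt + c' → LayoutInv n h s w T C K c' 0 0 c' (b + 1) r A Y β) := by
  have hc := H.class_nonneg
  have hy := H.bottom_nonneg
  have hyt := H.top_nonneg
  have htop := H.top_le
  have f : 0 ≤ c' ∧ (∀ i < n, r i ≤ c') ∧ (c' = C ∨ c' = C / 2 ∨ c' ≤ C / 4) ∧ c' ≤ K ∧
      T * c' + T * (2 * K - c) ≤ a * c + T * (2 * K - c') ∧
      (c' = C → yt = 0 ∨ yt = C) ∧ (c' = C / 2 → yt = 0 ∨ yt = C / 2 ∨ yt = C) := by
    rcases hc' with ⟨rfl, hTa, hcK⟩ | ⟨x, hx0, hxK, hxc, rfl, hx⟩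
    · refine ⟨hc, H.le_class, H.class_cases.resolve_left hcK, (H.row.resolve_left hcK).1, ?_,
        H.top_of_full, H.top_of_half⟩
      nlinarith
    -- Since `x ≤ c / 2`, a tallest piece above `C / 2` forces `c > C`, hence the fictitious class
    -- with `K = C`; one above `C / 4` forces `c > C / 2`.
    · have h1 : C / 2 < x → c = 2 * C := by
        intro h
        rcases H.class_cases with e | e | e | e <;> rcases hKC with e' | e' <;> linarith
      have h2 : C / 4 < x → c = 2 * C ∨ c = C := by
        intro h
        rcases H.class_cases with e | e | e | e
        · rcases hKC with e' | e'
          · left; linarith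
          · exfalso; linarith
        · exact .inr e
        · exfalso; linarith
        · exfalso; linarith
      have hle : classTop C x ≤ c / 2 := by
        unfold classTop
        split_ifs with i1 i2
        · linarith [h1 i1]
        · rcases h2 i2 with e | e <;> linarith
        · exact hxc
      have hxC : x ≤ C := by rcases hKC with e | e <;> linarith
      have h0 := le_classTop hxC
      refine ⟨by linarith, fun i hi => (hx i hi).trans h0, ?_, ?_, ?_, ?_, ?_⟩
      · unfold classTop
        split_ifs with i1 i2
        · exact .inl rfl
        · exact .inr (.inl rfl)
        · exact .inr (.inr (not_lt.1 i2))
      · rcases H.row with e | e <;> linarith [e]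
      · have := mul_le_mul_of_nonneg_left hle hT.le
        have := mul_nonneg H.base_nonneg hc
        linarith
      · intro e
        exact .inl (H.top_of_lt (by linarith))
      · intro e
        have hc4 : C / 4 < x := by
          have := half_classTop_lt (C := C) hx0
          linarith
        rcases h2 hc4 with e' | e'
        · exact .inl (H.top_of_lt (by linarith))
        · rcases H.top_of_full e' with e'' | e''
          · exact .inl e''
          · exact .inr (.inr e'')
  obtain ⟨g0, g1, g2, g3, g4, g5, g6⟩ := f
  have hTc' : 0 ≤ T * c' := by positivity
  have hcC : c' ≤ C := by rcases g2 with e | e | e <;> linarith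
  have hA := H.area
  have hTb : 0 ≤ T * (3 / 4 * C * b) := by positivity
  constructor
  · intro hfit
    exact {
      live := H.live
      le_class := g1
      class_nonneg := g0
      class_cases := .inr g2
      base_nonneg := le_rfl
      bottom_nonneg := hyt
      top_le := hfit
      top_nonneg := by linarith
      row := .inr ⟨g3, rfl⟩
      top_of_lt := fun h => absurd h (by linarith)
      top_of_full := fun e => by right; rcases g5 e with e' | e' <;> linarith
      top_of_half := fun e => by
        right
        rcases g6 e with e' | e' | e'
        · left; linarith
        · right; linarith
        · exfalso; linarith
      area := by linarith
      area_of_pos := fun hb => by have := H.area_of_pos hb; linarith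
      placed := fun i hi h0 => by
        obtain ⟨p1, p2, p3, p4, p5, p6⟩ := H.placed i hi h0
        exact ⟨p1, p2, p3, p4, p5, fun e => by linarith [p6 e]⟩
      current := fun i hi h0 e => .inl ((H.placed i hi h0).2.2.2.2.2 e)
      pairs := H.pairs }
  · intro hfull
    -- A row of height `C` meets a bin that is empty or full, one of height `C / 2` a bin that is
    -- empty, half full or full, and all other rows have height at most `C / 4`.
    have hfill : 3 / 4 * C ≤ yt := by
      rcases g2 with e | e | e
      · rcases g5 e with e' | e' <;> linarith
      · rcases g6 e with e' | e' | e' <;> linarith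
      · linarith
    have hTf := mul_le_mul_of_nonneg_left hfill hT.le
    have hTf' := mul_lt_mul_of_pos_left hfull hT
    exact {
      live := H.live
      le_class := g1
      class_nonneg := g0
      class_cases := .inr g2
      base_nonneg := le_rfl
      bottom_nonneg := le_rfl
      top_le := hcC
      top_nonneg := g0
      row := .inr ⟨g3, by ring⟩
      top_of_lt := fun h => absurd h (by linarith)
      top_of_full := fun e => .inr e
      top_of_half := fun e => .inr (.inl e)
      area := by push_cast; linarith
      area_of_pos := fun _ => by linarith
      placed := fun i hi h0 => by
        obtain ⟨p1, p2, p3, p4, p5, p6⟩ := H.placed i hi h0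
        exact ⟨p1, p2, p3, p4, by omega, fun e => by omega⟩
      current := fun i hi h0 e => by have := (H.placed i hi h0).2.2.2.2.1; omega
      pairs := H.pairs }

/-- A member of the class is higher than `c / 2`, so the new term `w k * c` is covered by `2 * (w k
* r k)`. Only the start of the base has to be within `T`; its end may exceed `T`, and then the row
is full. Choosing the least slope keeps the row sorted. -/
theorem place (H : LayoutInv n h s w T C K c a y yt b r A Y β) (hw : ∀ i < n, 0 ≤ w i)
    (hcK : c ≠ 2 * K)
    (haT : a ≤ T) {k : ℕ} (hk : k < n) (hkc : c / 2 < r k)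
    (hmin : ∀ j < n, c / 2 < r j → s k ≤ s j) :
    LayoutInv n h s w T C K c (a + w k) y yt b (Function.update r k 0) (Function.update A k a)
      (Function.update Y k y) (Function.update β k b) := by
  have hc := H.class_nonneg
  have hrow := (H.row.resolve_left hcK).2
  have hrk : r k = h k := (H.live k hk).resolve_right (by linarith)
  have hrkc := H.le_class k hk
  have hsum : ∑ i ∈ Finset.range n, w i * (h i - Function.update r k 0 i) =
      ∑ i ∈ Finset.range n, w i * (h i - r i) + w k * r k := by
    rw [← Finset.add_sum_erase _ _ (Finset.mem_range.2 hk),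
      ← Finset.add_sum_erase _ (fun i => w i * (h i - r i)) (Finset.mem_range.2 hk)]
    rw [Finset.sum_congr rfl (fun i hi => by
      rw [Function.update_of_ne (Finset.ne_of_mem_erase hi)] :
      ∀ i ∈ (Finset.range n).erase k, w i * (h i - Function.update r k 0 i) = w i * (h i - r i))]
    simp only [Function.update_self]
    ring
  have hwk := hw k hk
  have hwkc : w k * c ≤ 2 * (w k * r k) := by nlinarith
  have hyt := H.top_le
  have hy := H.bottom_nonneg
  have old : ∀ i, i ≠ k → Function.update r k 0 i = r i := fun i hi => Function.update_of_ne hi _ _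
  have upd_le : ∀ j, c / 2 < Function.update r k 0 j → c / 2 < r j := by
    intro j hj
    rcases eq_or_ne j k with rfl | hjk
    · exact hkc
    · rwa [old j hjk] at hj
  have sep : ∀ i < n, i ≠ k → r i = 0 → β i = b →
      RowSeparated h s w (Function.update A k a) (Function.update Y k y) i k := by
    intro i hi hik h0 e
    unfold RowSeparated
    simp only [Function.update_self, Function.update_of_ne hik]
    rcases H.current i hi h0 e with h1 | ⟨h1, h2, h3⟩
    · exact .inl h1
    · exact .inr (.inr ⟨h1, .inl ⟨h2, h3 k hk hkc⟩⟩)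
  exact {
    live := fun i hi => by
      rcases eq_or_ne i k with rfl | hik
      · right; simp
      · rw [old i hik]; exact H.live i hi
    le_class := fun i hi => by
      rcases eq_or_ne i k with rfl | hik
      · simpa using hc
      · rw [old i hik]; exact H.le_class i hi
    class_nonneg := hc
    class_cases := H.class_cases
    base_nonneg := by linarith [H.base_nonneg]
    bottom_nonneg := hy
    top_le := hyt
    top_nonneg := H.top_nonneg
    row := H.row
    top_of_lt := H.top_of_lt
    top_of_full := H.top_of_full
    top_of_half := H.top_of_half
    area := by rw [hsum]; linarith [H.area]
    area_of_pos := fun hb => by rw [hsum]; linarith [H.area_of_pos hb]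
    placed := fun i hi h0 => by
      rcases eq_or_ne i k with rfl | hik
      · simp only [Function.update_self]
        refine ⟨H.base_nonneg, haT, hy, by linarith, le_rfl, fun _ => by linarith⟩
      · rw [old i hik] at h0
        simp only [Function.update_of_ne hik]
        exact H.placed i hi h0
    current := fun i hi h0 => by
      rcases eq_or_ne i k with rfl | hik
      · simp only [Function.update_self]
        exact fun _ => .inr ⟨trivial, le_rfl, fun j hj hj' => hmin j hj (upd_le j hj')⟩
      · rw [old i hik] at h0
        simp only [Function.update_of_ne hik]
        intro e
        rcases H.current i hi h0 e with h1 | ⟨h1, h2, h3⟩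
        · exact .inl h1
        · exact .inr ⟨h1, by linarith, fun j hj hj' => h3 j hj (upd_le j hj')⟩
    pairs := fun i hi j hj hij h0 h0' e => by
      rcases eq_or_ne i k with rfl | hik
      · have hji := hij.symm
        rw [old j hji] at h0'
        rw [Function.update_self, Function.update_of_ne hji] at e
        rcases sep j hj hji h0' e.symm with h1 | h1 | ⟨h1, h2⟩
        · exact .inr (.inl h1)
        · exact .inl h1
        · exact .inr (.inr ⟨h1.symm, h2.symm⟩)
      · rw [old i hik] at h0
        rcases eq_or_ne j k with rfl | hjk
        · rw [Function.update_self, Function.update_of_ne hik] at e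
          exact sep i hi hik h0 e
        · rw [old j hjk] at h0'
          rw [Function.update_of_ne hik, Function.update_of_ne hjk] at e
          have := H.pairs i hi j hj hij h0 h0' e
          unfold RowSeparated at this ⊢
          simpa only [Function.update_of_ne hik, Function.update_of_ne hjk] using this }

end LayoutInv

/-! ### The layout program

Arrays of natural numbers: `3`, `4` loop counters, `5` the index that was searched, `6` the bin in
work. Arrays of real numbers with an entry for each piece: `4` bottom, `5` slope of the spine, `6`
left end of the base, `7` width, `8` height, `9` height if not yet placed, `10` horizontal extent,
`21`, `22`, `23` base point, bottom and offset in the layout. Real registers: `11`, `12`, `13`, `14`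
class height, filling, bottom and top of the row in work, `15` offset of the bin, `16` to `20` the
parameters `T`, maximal extent, `C`, `K` and distance of the bins. -/

/-- Find a piece with the largest entry in array `x`. -/
def findMax (x : ℕ) : Program :=
  .seq (.setNat 5 (.const 0) (.const 0))
    -- The guard `0 < 1` always holds; the maximum is found as a minimum of negated entries.
    (argMin 5 4 (.const 0) (.reg 0) (fun _ => .natLt (.const 0) (.const 1))
      fun k => .sub (.const 0) (.read x k))

theorem runs_findMax (x : ℕ) (s : State) :
    Runs (findMax x) s (s.nat 0 0 * 4 + 3) fun s' =>
      s'.real = s.real ∧ (∀ a, a ≠ 4 → a ≠ 5 → s'.nat a = s.nat a) ∧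
      (0 < s.nat 0 0 → s'.nat 5 0 < s.nat 0 0) ∧
      ∀ i < s.nat 0 0, s.real x i ≤ s.real x (s'.nat 5 0) := by
  refine (runs_setNat_seq (runs_argMin (by decide) (fun _ => True) (fun k => 0 - s.real x k)
    ?_ ?_ ?_ ?_)).mono (B' := s.nat 0 0 * 4 + 3) ?_ ?_
  · intro s' e _ _
    simp [Test.Holds, NatExpr.eval]
  · intro s' e h _
    simp [RealExpr.eval, NatExpr.eval, h]
  · intro s' h
    simp [NatExpr.eval, h]
  · simp [NatExpr.eval]
  · simp [NatExpr.eval]; omega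
  · rintro s' ⟨h1, h2, h3, -, h5⟩
    simp [NatExpr.eval] at h1 h3 h5
    refine ⟨h1, fun a ha ha' => by simp [h2 a ha ha', ha'], fun hn => ?_, h5⟩
    rcases h3 with h3 | h3
    · omega
    · exact h3

/-- Start a new class if no piece of the current class is left. -/
def chooseClass : Program :=
  .cond (.realLt (.div (.reg 11) (.const 2)) (.read 9 (.reg 5))) .skip
    (.seq (.cond (.realLt (.div (.reg 18) (.const 2)) (.read 9 (.reg 5)))
        (.setReal 11 (.const 0) (.reg 18))
        (.cond (.realLt (.div (.reg 18) (.const 4)) (.read 9 (.reg 5)))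
          (.setReal 11 (.const 0) (.div (.reg 18) (.const 2)))
          (.setReal 11 (.const 0) (.read 9 (.reg 5)))))
      -- A filling above `T` makes `chooseRow` open a row for the new class.
      (.setReal 12 (.const 0) (.add (.reg 16) (.const 1))))

theorem runs_chooseClass (s : State) :
    Runs chooseClass s 5 fun s' =>
      (s'.real 11 0 = s.real 11 0 ∧ s'.real 12 0 = s.real 12 0 ∧
        s.real 11 0 / 2 < s.real 9 (s.nat 5 0)) ∨
      (s'.real 11 0 = classTop (s.real 18 0) (s.real 9 (s.nat 5 0)) ∧
        s'.real 12 0 = s.real 16 0 + 1 ∧ s.real 9 (s.nat 5 0) ≤ s.real 11 0 / 2) := by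
  refine runs_cond (fun hb => ?_) (fun hb => ?_)
  · simp only [Test.Holds, RealExpr.eval, NatExpr.eval, Rat.cast_ofNat] at hb
    exact (runs_skip (.inl ⟨rfl, rfl, hb⟩)).mono (by omega) fun _ h => h
  · simp only [Test.Holds, RealExpr.eval, NatExpr.eval, Rat.cast_ofNat, not_lt] at hb
    refine (Runs.seq (B := 3) (Q := fun s' => s' = s.writeReal 11 0
      (classTop (s.real 18 0) (s.real 9 (s.nat 5 0)))) ?_ ?_).mono (le_refl (3 + 1)) fun _ h => h
    · refine runs_cond (B := 2) (fun h1 => ?_) (fun h1 => ?_)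
      · simp only [Test.Holds, RealExpr.eval, NatExpr.eval, Rat.cast_ofNat] at h1
        exact (runs_setReal (by simp [RealExpr.eval, NatExpr.eval, classTop, h1])).mono
          (by omega) fun _ h => h
      · simp only [Test.Holds, RealExpr.eval, NatExpr.eval, Rat.cast_ofNat] at h1
        refine runs_cond (fun h2 => ?_) (fun h2 => ?_)
        · simp only [Test.Holds, RealExpr.eval, NatExpr.eval, Rat.cast_ofNat] at h2
          exact runs_setReal (by simp [RealExpr.eval, NatExpr.eval, classTop, h1, h2])
        · simp only [Test.Holds, RealExpr.eval, NatExpr.eval, Rat.cast_ofNat] at h2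
          exact runs_setReal (by simp [RealExpr.eval, NatExpr.eval, classTop, h1, h2])
    · rintro _ rfl
      refine runs_setReal (.inr ⟨?_, ?_, hb⟩) <;> simp [RealExpr.eval, NatExpr.eval]

/-- Start a new row, if need be in a new bin, if the current row is full. -/
def chooseRow : Program :=
  .cond (.realLt (.reg 16) (.reg 12))
    (.seq (.setReal 13 (.const 0) (.reg 14))
      (.seq (.cond (.realLt (.reg 18) (.add (.reg 13) (.reg 11)))
          (.seq (.setReal 13 (.const 0) (.const 0))
            (.seq (.setNat 6 (.const 0) (.add (.reg 6) (.const 1)))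
              -- The offset is accumulated along with the bin number, as a natural number cannot be
              -- converted into a real one.
              (.setReal 15 (.const 0) (.add (.reg 15) (.reg 20)))))
          .skip)
        (.seq (.setReal 14 (.const 0) (.add (.reg 13) (.reg 11)))
          (.setReal 12 (.const 0) (.const 0)))))
    .skip

theorem runs_chooseRow (s : State) :
    Runs chooseRow s 8 fun s' =>
      (s'.nat = s.nat ∧ s'.real = s.real ∧ s.real 12 0 ≤ s.real 16 0) ∨
      (s.real 16 0 < s.real 12 0 ∧ s'.real 12 0 = 0 ∧
        ((s.real 14 0 + s.real 11 0 ≤ s.real 18 0 ∧ s'.nat 6 0 = s.nat 6 0 ∧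
            s'.real 15 0 = s.real 15 0 ∧ s'.real 13 0 = s.real 14 0 ∧
            s'.real 14 0 = s.real 14 0 + s.real 11 0) ∨
          (s.real 18 0 < s.real 14 0 + s.real 11 0 ∧ s'.nat 6 0 = s.nat 6 0 + 1 ∧
            s'.real 15 0 = s.real 15 0 + s.real 20 0 ∧ s'.real 13 0 = 0 ∧
            s'.real 14 0 = s.real 11 0))) := by
  refine runs_cond (B := 7) (fun hb => ?_) (fun hb => ?_)
  · simp only [Test.Holds, RealExpr.eval, NatExpr.eval] at hb
    refine runs_setReal_seq (B := 6) (Runs.seq (B := 4) (B' := 2) (runs_cond (B := 3)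
      (Q := fun s' => (s.real 14 0 + s.real 11 0 ≤ s.real 18 0 ∧
        s' = s.writeReal 13 0 (s.real 14 0)) ∨
        (s.real 18 0 < s.real 14 0 + s.real 11 0 ∧
        s' = (((s.writeReal 13 0 (s.real 14 0)).writeReal 13 0 0).writeNat 6 0
          (s.nat 6 0 + 1)).writeReal 15 0 (s.real 15 0 + s.real 20 0)))
      (fun h1 => ?_) fun h1 => ?_) ?_)
    · simp [Test.Holds, RealExpr.eval, NatExpr.eval] at h1
      refine runs_setReal_seq (runs_setNat_seq (runs_setReal (.inr ⟨h1, ?_⟩)))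
      simp [RealExpr.eval, NatExpr.eval]
    · simp [Test.Holds, RealExpr.eval, NatExpr.eval] at h1
      exact (runs_skip (.inl ⟨h1, by simp [RealExpr.eval, NatExpr.eval]⟩)).mono (by omega)
        fun _ h => h
    · rintro s' (⟨h1, rfl⟩ | ⟨h1, rfl⟩)
      · refine runs_setReal_seq (runs_setReal (.inr ⟨hb, ?_, .inl ⟨h1, ?_⟩⟩)) <;>
          simp [RealExpr.eval, NatExpr.eval]
      · refine runs_setReal_seq (runs_setReal (.inr ⟨hb, ?_, .inr ⟨h1, ?_⟩⟩)) <;>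
          simp [RealExpr.eval, NatExpr.eval]
  · simp only [Test.Holds, RealExpr.eval, NatExpr.eval, not_lt] at hb
    exact (runs_skip (.inl ⟨rfl, rfl, hb⟩)).mono (by omega) fun _ h => h

/-- Find a piece of the current class whose spine has the least slope. -/
def findNext : Program :=
  argMin 5 4 (.const 0) (.reg 0)
    (fun k => .realLt (.div (.reg 11) (.const 2)) (.read 9 k)) fun k => .read 5 k

/-- The search starts at a member of the class, so its result is a member even if no smaller slope
is found. -/
theorem runs_findNext {s : State} (hk : s.nat 5 0 < s.nat 0 0)
    (hc : s.real 11 0 / 2 < s.real 9 (s.nat 5 0)) :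
    Runs findNext s (s.nat 0 0 * 4 + 2) fun s' =>
      s'.real = s.real ∧ s'.nat 0 = s.nat 0 ∧ s'.nat 2 = s.nat 2 ∧ s'.nat 3 = s.nat 3 ∧
      s'.nat 6 = s.nat 6 ∧ s'.nat 5 0 < s.nat 0 0 ∧
      s.real 11 0 / 2 < s.real 9 (s'.nat 5 0) ∧
      ∀ i < s.nat 0 0, s.real 11 0 / 2 < s.real 9 i → s.real 5 (s'.nat 5 0) ≤ s.real 5 i := by
  refine (runs_argMin (by decide) (fun k => s.real 11 0 / 2 < s.real 9 k) (fun k => s.real 5 k)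
    ?_ ?_ ?_ ?_).mono (B' := s.nat 0 0 * 4 + 2) ?_ ?_
  · intro s' e h _
    simp [Test.Holds, RealExpr.eval, NatExpr.eval, h]
  · intro s' e h _
    simp [RealExpr.eval, NatExpr.eval, h]
  · intro s' h
    simp [NatExpr.eval, h]
  · simp [NatExpr.eval]
  · simp [NatExpr.eval]
  · rintro s' ⟨h1, h2, h3, -, h5⟩
    simp [NatExpr.eval] at h3 h5
    refine ⟨h1, h2 0 (by decide) (by decide), h2 2 (by decide) (by decide),
      h2 3 (by decide) (by decide), h2 6 (by decide) (by decide), ?_, ?_, h5⟩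
    · rcases h3 with h3 | h3
      · rwa [h3]
      · exact h3.1
    · rcases h3 with h3 | h3
      · rwa [h3]
      · exact h3.2

/-- Put the piece that was found into the current row. -/
def placePiece : Program :=
  .seq (.setReal 21 (.reg 5) (.reg 12))
    (.seq (.setReal 22 (.reg 5) (.reg 13))
      (.seq (.setReal 23 (.reg 5) (.reg 15))
        (.seq (.setNat 2 (.reg 5) (.reg 6))
          (.seq (.setReal 12 (.const 0) (.add (.reg 12) (.read 7 (.reg 5))))
            (.setReal 9 (.reg 5) (.const 0))))))

/-- Place one more piece. -/
def layoutStep : Program :=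
  .seq (findMax 9) (.seq chooseClass (.seq chooseRow (.seq findNext placePiece)))

/-- The parameters and the data of the pieces are those of `s₀`. -/
structure SameData (s₀ s : State) : Prop where
  num : s.nat 0 = s₀.nat 0
  slope : s.real 5 = s₀.real 5
  width : s.real 7 = s₀.real 7
  height : s.real 8 = s₀.real 8
  base : s.real 16 = s₀.real 16
  cap : s.real 18 = s₀.real 18
  bound : s.real 19 = s₀.real 19
  dist : s.real 20 = s₀.real 20

/-- The invariant of the layout program after `k` pieces. -/
structure ProgInv (s₀ : State) (k : ℕ) (s : State) : Prop where
  same : SameData s₀ s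
  layout : LayoutInv (s₀.nat 0 0) (s₀.real 8) (s₀.real 5) (s₀.real 7) (s₀.real 16 0)
    (s₀.real 18 0) (s₀.real 19 0) (s.real 11 0) (s.real 12 0) (s.real 13 0) (s.real 14 0)
    (s.nat 6 0) (s.real 9) (s.real 21) (s.real 22) (s.nat 2)
  offset : s.real 15 0 = s₀.real 20 0 * s.nat 6 0
  offsets : ∀ i < s₀.nat 0 0, s.real 9 i = 0 → s.real 23 i = s₀.real 20 0 * s.nat 2 i
  count : ((Finset.range (s₀.nat 0 0)).filter fun i => s.real 9 i ≠ 0).card + k = s₀.nat 0 0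

/-- The conditions on the data under which the layout is correct. -/
structure LayoutData (s₀ : State) : Prop where
  base_pos : 0 < s₀.real 16 0
  cap_pos : 0 < s₀.real 18 0
  bound_cases : s₀.real 19 0 = s₀.real 18 0 ∨ 4 * s₀.real 19 0 ≤ s₀.real 18 0
  width_nonneg : ∀ i < s₀.nat 0 0, 0 ≤ s₀.real 7 i
  height_pos : ∀ i < s₀.nat 0 0, 0 < s₀.real 8 i
  height_le : ∀ i < s₀.nat 0 0, s₀.real 8 i ≤ s₀.real 19 0

/-- Fewer than all pieces are placed, so array `9` has a positive entry and the tallest remaining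
piece is genuine. Changes of class and of row are both covered by `LayoutInv.newRow`, the final
assignments by `LayoutInv.place`. -/
theorem runs_layoutStep {s₀ s : State} {k : ℕ} (D : LayoutData s₀) (H : ProgInv s₀ k s)
    (hk : k < s₀.nat 0 0) :
    Runs layoutStep s (s₀.nat 0 0 * 8 + 24) fun s' => s'.nat 3 = s.nat 3 ∧ ProgInv s₀ (k + 1) s' := by
  have hn : s.nat 0 0 = s₀.nat 0 0 := by rw [H.same.num]
  obtain ⟨j, hj⟩ : ((Finset.range (s₀.nat 0 0)).filter fun i => s.real 9 i ≠ 0).Nonempty := by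
    rw [← Finset.card_pos]; have := H.count; omega
  rw [Finset.mem_filter, Finset.mem_range] at hj
  have hjpos : 0 < s.real 9 j := by
    rw [(H.layout.live j hj.1).resolve_right hj.2]; exact D.height_pos j hj.1
  have live_le : ∀ i < s₀.nat 0 0, s.real 9 i ≤ s₀.real 19 0 := by
    intro i hi
    rcases H.layout.live i hi with e | e <;> rw [e]
    · exact D.height_le i hi
    · exact (D.height_pos i hi).le.trans (D.height_le i hi)
  have hfind : Runs (findMax 9) s (s₀.nat 0 0 * 4 + 3) _ := hn ▸ runs_findMax 9 s
  refine (Runs.seq (B' := 5 + (8 + (s₀.nat 0 0 * 4 + 8))) hfind fun s₁ h₁ =>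
    Runs.seq (runs_chooseClass s₁).frame fun s₂ h₂ =>
    Runs.seq (runs_chooseRow s₂).frame fun s₃ h₃ => ?_).mono (by omega) fun _ h => h
  obtain ⟨r1, m, hq, hmax⟩ := h₁
  have m0 := m 0 (by decide) (by decide)
  have m2 := m 2 (by decide) (by decide)
  have m3 := m 3 (by decide) (by decide)
  have m6 := m 6 (by decide) (by decide)
  replace hq := hq (by omega)
  obtain ⟨h₂, F2⟩ := h₂
  obtain ⟨h₃, F3⟩ := h₃
  set q := s₁.nat 5 0 with hqdef
  have n2 : ∀ a, s₂.nat a = s₁.nat a := fun a => F2.nat a (by simp [chooseClass, Program.natWrites])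
  have R2 : ∀ a, a ≠ 11 → a ≠ 12 → s₂.real a = s.real a := fun a h1 h2 => by
    rw [F2.real a (by simp [chooseClass, Program.realWrites, h1, h2]), r1]
  have n3 : ∀ a, a ≠ 6 → s₃.nat a = s₁.nat a := fun a h => by
    rw [F3.nat a (by simp [chooseRow, Program.natWrites, h]), n2]
  have R3 : ∀ a, a ≠ 12 → a ≠ 13 → a ≠ 14 → a ≠ 15 → s₃.real a = s₂.real a :=
    fun a h1 h2 h3 h4 => F3.real a (by simp [chooseRow, Program.realWrites, h1, h2, h3, h4])
  have e9 : s₃.real 9 = s.real 9 := by simp [R3, R2]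
  have e11 : s₃.real 11 = s₂.real 11 := by simp [R3]
  have hxpos : 0 < s.real 9 q := hjpos.trans_le (hmax j hj.1)
  have hxK := live_le q hq
  have hT : s₂.real 16 0 = s₀.real 16 0 := by rw [R2 16 (by decide) (by decide), H.same.base]
  have hC : s₂.real 18 0 = s₀.real 18 0 := by rw [R2 18 (by decide) (by decide), H.same.cap]
  have hd : s₂.real 20 0 = s₀.real 20 0 := by rw [R2 20 (by decide) (by decide), H.same.dist]
  have hX : s₂.real 15 0 = s₀.real 20 0 * s.nat 6 0 := by
    rw [R2 15 (by decide) (by decide), H.offset]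
  have hb2 : s₂.nat 6 0 = s.nat 6 0 := by rw [n2, m6]
  have h14 : s₂.real 14 0 = s.real 14 0 := by rw [R2 14 (by decide) (by decide)]
  have h13 : s₂.real 13 0 = s.real 13 0 := by rw [R2 13 (by decide) (by decide)]
  rw [r1, H.same.cap, H.same.base] at h₂
  rw [hT, hC, hd, hX, hb2, h14] at h₃
  -- The state in which the next piece is chosen: a real class with `q` as a member, and a row that
  -- still has room.
  have key : LayoutInv (s₀.nat 0 0) (s₀.real 8) (s₀.real 5) (s₀.real 7) (s₀.real 16 0)
      (s₀.real 18 0) (s₀.real 19 0) (s₃.real 11 0) (s₃.real 12 0) (s₃.real 13 0) (s₃.real 14 0)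
      (s₃.nat 6 0) (s.real 9) (s.real 21) (s.real 22) (s.nat 2) ∧
      s₃.real 15 0 = s₀.real 20 0 * s₃.nat 6 0 ∧ s₃.real 11 0 / 2 < s.real 9 q ∧
      s₃.real 11 0 ≠ 2 * s₀.real 19 0 ∧ s₃.real 12 0 ≤ s₀.real 16 0 := by
    rw [e11]
    have row : s₀.real 16 0 < s₂.real 12 0 →
        ((s₂.real 11 0 = s.real 11 0 ∧ s₀.real 16 0 < s.real 12 0 ∧
          s.real 11 0 ≠ 2 * s₀.real 19 0) ∨
        ∃ x, 0 < x ∧ x ≤ s₀.real 19 0 ∧ x ≤ s.real 11 0 / 2 ∧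
          s₂.real 11 0 = classTop (s₀.real 18 0) x ∧ ∀ i < s₀.nat 0 0, s.real 9 i ≤ x) →
        LayoutInv (s₀.nat 0 0) (s₀.real 8) (s₀.real 5) (s₀.real 7) (s₀.real 16 0)
          (s₀.real 18 0) (s₀.real 19 0) (s₂.real 11 0) (s₃.real 12 0) (s₃.real 13 0)
          (s₃.real 14 0) (s₃.nat 6 0) (s.real 9) (s.real 21) (s.real 22) (s.nat 2) ∧
        s₃.real 15 0 = s₀.real 20 0 * s₃.nat 6 0 ∧ s₃.real 12 0 ≤ s₀.real 16 0 := by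
      intro hlt hc
      obtain ⟨N1, N2⟩ := H.layout.newRow D.base_pos D.cap_pos D.bound_cases hc
      rcases h₃ with ⟨-, -, h⟩ | ⟨-, h0, ⟨f1, f2, f3, f4, f5⟩ | ⟨f1, f2, f3, f4, f5⟩⟩
      · exact absurd hlt (not_lt.2 h)
      · rw [h0, f2, f3, f4, f5]
        exact ⟨N1 f1, rfl, D.base_pos.le⟩
      · rw [h0, f2, f3, f4, f5]
        exact ⟨N2 f1, by push_cast; ring, D.base_pos.le⟩
    rcases h₂ with ⟨g1, g2, g3⟩ | ⟨g1, g2, g3⟩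
    -- A remaining piece above half of the class height excludes the fictitious class.
    · have hne : s.real 11 0 ≠ 2 * s₀.real 19 0 := by intro e; linarith
      by_cases hlt : s₀.real 16 0 < s₂.real 12 0
      · obtain ⟨k1, k2, k3⟩ := row hlt (.inl ⟨g1, by rwa [← g2], hne⟩)
        exact ⟨k1, k2, by rwa [g1], by rwa [g1], k3⟩
      · rcases h₃ with ⟨f1, f2, f3⟩ | ⟨f1, -⟩
        · rw [f1, f2, g1, g2, h13, h14, hb2, hX]
          exact ⟨H.layout, rfl, g3, hne, by rw [← g2]; exact f3⟩
        · exact absurd f1 hlt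
    · have hlt := half_classTop_lt (C := s₀.real 18 0) hxpos
      obtain ⟨k1, k2, k3⟩ := row (by rw [g2]; linarith)
        (.inr ⟨_, hxpos, hxK, g3, g1, hmax⟩)
      exact ⟨k1, k2, by rwa [g1], by rw [g1]; intro e; linarith, k3⟩
  obtain ⟨L, hX3, hcx, hcK, haT⟩ := key
  have hn3 : s₃.nat 0 0 = s₀.nat 0 0 := by rw [n3 0 (by decide), m0, hn]
  have hq3 : s₃.nat 5 0 = q := by rw [n3 5 (by decide)]
  have hnext : Runs findNext s₃ (s₀.nat 0 0 * 4 + 2) _ :=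
    hn3 ▸ runs_findNext (s := s₃) (by rw [hq3, hn3]; exact hq) (by rw [hq3, e9]; exact hcx)
  refine (Runs.seq (B' := 6) hnext fun s₄ h₄ => ?_).mono (le_refl _) fun _ h => h
  obtain ⟨r4, p0, p2, p3, p6, hk4, hc4, hmin⟩ := h₄
  rw [e9] at hc4 hmin
  have e5 : s₃.real 5 = s₀.real 5 := by
    rw [R3 5 (by decide) (by decide) (by decide) (by decide), R2 5 (by decide) (by decide),
      H.same.slope]
  have e7 : s₃.real 7 = s₀.real 7 := by
    rw [R3 7 (by decide) (by decide) (by decide) (by decide), R2 7 (by decide) (by decide),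
      H.same.width]
  have e8 : s₃.real 8 = s₀.real 8 := by
    rw [R3 8 (by decide) (by decide) (by decide) (by decide), R2 8 (by decide) (by decide),
      H.same.height]
  have e16 : s₃.real 16 = s₀.real 16 := by
    rw [R3 16 (by decide) (by decide) (by decide) (by decide), R2 16 (by decide) (by decide),
      H.same.base]
  have e18 : s₃.real 18 = s₀.real 18 := by
    rw [R3 18 (by decide) (by decide) (by decide) (by decide), R2 18 (by decide) (by decide),
      H.same.cap]
  have e19 : s₃.real 19 = s₀.real 19 := by
    rw [R3 19 (by decide) (by decide) (by decide) (by decide), R2 19 (by decide) (by decide),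
      H.same.bound]
  have e20 : s₃.real 20 = s₀.real 20 := by
    rw [R3 20 (by decide) (by decide) (by decide) (by decide), R2 20 (by decide) (by decide),
      H.same.dist]
  have e21 : s₃.real 21 = s.real 21 := by
    rw [R3 21 (by decide) (by decide) (by decide) (by decide), R2 21 (by decide) (by decide)]
  have e22 : s₃.real 22 = s.real 22 := by
    rw [R3 22 (by decide) (by decide) (by decide) (by decide), R2 22 (by decide) (by decide)]
  have e23 : s₃.real 23 = s.real 23 := by
    rw [R3 23 (by decide) (by decide) (by decide) (by decide), R2 23 (by decide) (by decide)]
  have b2 : s₄.nat 2 = s.nat 2 := by rw [p2, n3 2 (by decide), m2]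
  have b3 : s₄.nat 3 = s.nat 3 := by rw [p3, n3 3 (by decide), m3]
  have b0 : s₄.nat 0 = s₀.nat 0 := by rw [p0, n3 0 (by decide), m0, H.same.num]
  set k' := s₄.nat 5 0 with hk'
  have P := L.place D.width_nonneg hcK haT hk4 hc4 (by rw [e5] at hmin; exact hmin)
  refine runs_setReal_seq (runs_setReal_seq (runs_setReal_seq (runs_setNat_seq
    (runs_setReal_seq (runs_setReal ?_)))))
  simp only [RealExpr.eval, NatExpr.eval]
  have hk4' : s.real 9 k' ≠ 0 := by have := L.class_nonneg; intro e; linarith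
  refine ⟨by simp [b3], ⟨by simp [b0], by simp [r4, e5], by simp [r4, e7], by simp [r4, e8],
    by simp [r4, e16], by simp [r4, e18], by simp [r4, e19], by simp [r4, e20]⟩, ?_, ?_, ?_, ?_⟩
  · convert P using 1 <;> simp [r4, e7, e9, e21, e22, b2, p6, ← hk']
  · simp [r4, p6, hX3]
  · intro i hi
    simp [r4, e9, e23, b2, ← hk']
    rcases eq_or_ne i k' with rfl | hik
    · simp [p6, hX3]
    · simpa [hik] using H.offsets i hi
  · have hcard := H.count
    have : ((Finset.range (s₀.nat 0 0)).filter fun i => s.real 9 i ≠ 0) =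
        insert k' ((Finset.range (s₀.nat 0 0)).filter
          fun i => Function.update (s.real 9) k' 0 i ≠ 0) := by
      ext i
      simp only [Finset.mem_filter, Finset.mem_range, Finset.mem_insert]
      rcases eq_or_ne i k' with rfl | hik
      · simp [hk4, hk4']
      · simp [hik]
    rw [this, Finset.card_insert_of_notMem (by simp)] at hcard
    simp [r4, e9, ← hk'] at hcard ⊢
    omega

theorem ProgInv.writeCounter {s₀ s : State} {k v : ℕ} (h : ProgInv s₀ k s) :
    ProgInv s₀ k (s.writeNat 3 0 v) :=
  ⟨⟨by simp [h.same.num], h.same.slope, h.same.width, h.same.height, h.same.base, h.same.cap,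
    h.same.bound, h.same.dist⟩, by simpa using h.layout, by simpa using h.offset,
    by simpa using h.offsets, h.count⟩

/-- Start with an empty layout. -/
def layoutInit : Program :=
  .seq (.setReal 11 (.const 0) (.add (.reg 19) (.reg 19)))
    (.seq (.setReal 12 (.const 0) (.const 0))
      (.seq (.setReal 13 (.const 0) (.const 0))
        (.seq (.setReal 14 (.const 0) (.const 0))
          (.seq (.setReal 15 (.const 0) (.const 0)) (.setNat 6 (.const 0) (.const 0))))))

theorem runs_layoutInit {s : State} (hr : ∀ i < s.nat 0 0, s.real 9 i = s.real 8 i) :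
    Runs layoutInit s 6 fun s' => s'.nat 0 = s.nat 0 ∧
      (0 < s.nat 0 0 → LayoutData s → ProgInv s 0 s') := by
  refine runs_setReal_seq (runs_setReal_seq (runs_setReal_seq (runs_setReal_seq
    (runs_setReal_seq (runs_setNat ⟨by simp, fun hn D => ?_⟩)))))
  refine ⟨⟨by simp, by simp, by simp, by simp, by simp, by simp, by simp, by simp⟩, ?_, ?_, ?_, ?_⟩
  · have := LayoutInv.init (n := s.nat 0 0) (h := s.real 8) (s := s.real 5) (w := s.real 7)
      (T := s.real 16 0) (C := s.real 18 0) (K := s.real 19 0) (r := s.real 9) (A := s.real 21)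
      (Y := s.real 22) (β := s.nat 2) D.cap_pos
      ((D.height_pos 0 hn).le.trans (D.height_le 0 hn))
      (fun i hi => ⟨D.height_pos i hi, D.height_le i hi⟩) hr
    convert this using 1 <;> simp [RealExpr.eval, NatExpr.eval]
    ring
  · simp [RealExpr.eval, NatExpr.eval]
  · intro i hi h0
    simp at h0
    have := D.height_pos i hi
    rw [hr i hi] at h0
    exact absurd h0 this.ne'
  · rw [Finset.filter_true_of_mem]
    · simp
    · intro i hi
      have hi := Finset.mem_range.1 hi
      simp only [State.writeNat_real]
      simp [hr i hi, (D.height_pos i hi).ne']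

/-- Compute the translations from the layout. -/
def layoutFinish : Program :=
  .seq (.setReal 2 (.reg 3) (.sub (.sub (.add (.add (.read 23 (.reg 3)) (.read 21 (.reg 3)))
      (.reg 17)) (.read 6 (.reg 3))) (.mul (.read 5 (.reg 3)) (.read 4 (.reg 3)))))
    (.setReal 3 (.reg 3) (.sub (.read 22 (.reg 3)) (.read 4 (.reg 3))))

theorem runs_layoutFinish (s : State) :
    Runs (forLoop 3 (.const 0) (.reg 0) layoutFinish) s (s.nat 0 0 * 4 + 2) fun s' =>
      ∀ i < s.nat 0 0,
        s'.real 2 i = s.real 23 i + s.real 21 i + s.real 17 0 - s.real 6 i -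
          s.real 5 i * s.real 4 i ∧
        s'.real 3 i = s.real 22 i - s.real 4 i := by
  refine (runs_forLoop (N := s.nat 0 0) (B := 2) (fun m s' => s'.nat 0 = s.nat 0 ∧
      (∀ a, a ≠ 2 → a ≠ 3 → s'.real a = s.real a) ∧
      ∀ i < m, s'.real 2 i = s.real 23 i + s.real 21 i + s.real 17 0 - s.real 6 i -
          s.real 5 i * s.real 4 i ∧
        s'.real 3 i = s.real 22 i - s.real 4 i) (Nat.zero_le _) ?_ ?_ ?_).mono
        (by simp [NatExpr.eval]) fun _ h => h.2.2
  · intro k s' h _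
    simp [NatExpr.eval, h.1]
  · exact ⟨by simp, fun _ _ _ => rfl, fun i hi => absurd hi (by simp [NatExpr.eval])⟩
  · rintro k s' hk - ⟨h1, h2, h3⟩ hc
    refine runs_setReal_seq (runs_setReal ⟨by simpa using hc, by simpa using h1, ?_, ?_⟩)
    · intro a ha ha'
      simp [ha, ha', h2]
    · intro i hi
      rcases eq_or_ne i k with rfl | hik
      · simp [RealExpr.eval, NatExpr.eval, hc, h2]
      · simpa [RealExpr.eval, NatExpr.eval, hc, hik] using h3 i (by omega)

/-- The layout of all pieces. -/
def layoutProgram : Program :=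
  .seq layoutInit (.seq (forLoop 3 (.const 0) (.reg 0) layoutStep)
    (forLoop 3 (.const 0) (.reg 0) layoutFinish))

/-- What the layout program achieves: `B + 1` bins suffice, and if `B = 0` then the height `H`. -/
structure LayoutResult (s₀ s : State) (H : ℝ) (B : ℕ) (A Y : ℕ → ℝ) : Prop where
  placed : ∀ i < s₀.nat 0 0, 0 ≤ A i ∧ A i ≤ s₀.real 16 0 ∧ 0 ≤ Y i ∧
    Y i + s₀.real 8 i ≤ s₀.real 18 0 ∧ s.nat 2 i ≤ B ∧ (B = 0 → Y i + s₀.real 8 i ≤ H)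
  pairs : ∀ i < s₀.nat 0 0, ∀ j < s₀.nat 0 0, i ≠ j → s.nat 2 i = s.nat 2 j →
    RowSeparated (s₀.real 8) (s₀.real 5) (s₀.real 7) A Y i j
  area : s₀.real 16 0 * (3 / 4 * s₀.real 18 0 * B + H) ≤
    2 * ∑ i ∈ Finset.range (s₀.nat 0 0), s₀.real 7 i * s₀.real 8 i +
      2 * (s₀.real 16 0 * s₀.real 19 0)
  nonneg : 0 ≤ H
  area_of_pos : 0 < B → s₀.real 16 0 * s₀.real 18 0 <
    2 * ∑ i ∈ Finset.range (s₀.nat 0 0), s₀.real 7 i * s₀.real 8 i +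
      2 * (s₀.real 16 0 * s₀.real 19 0)
  shift_fst : ∀ i < s₀.nat 0 0, s.real 2 i = s₀.real 20 0 * s.nat 2 i + A i + s₀.real 17 0 -
    s₀.real 6 i - s₀.real 5 i * s₀.real 4 i
  shift_snd : ∀ i < s₀.nat 0 0, s.real 3 i = Y i - s₀.real 4 i

/-- Without pieces the parameters may be meaningless, and only termination is claimed. Otherwise the
count shows that every piece is placed, and the bounds follow from the potential by dropping the
nonnegative terms `a * c` and `T * c`. -/
theorem runs_layoutProgram {s : State} (hr : ∀ i < s.nat 0 0, s.real 9 i = s.real 8 i)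
    (D : 0 < s.nat 0 0 → LayoutData s) :
    Runs layoutProgram s (s.nat 0 0 * (s.nat 0 0 * 8 + 30) + 10) fun s' =>
      0 < s.nat 0 0 → ∃ H B A Y, LayoutResult s s' H B A Y := by
  have loop : ∀ s₁ : State, s₁.nat 0 = s.nat 0 → (0 < s.nat 0 0 → ProgInv s 0 s₁) →
      Runs (forLoop 3 (.const 0) (.reg 0) layoutStep) s₁
        (s.nat 0 0 * (s.nat 0 0 * 8 + 26) + 2) fun s' => s'.nat 0 = s.nat 0 ∧
        (0 < s.nat 0 0 → ProgInv s (s.nat 0 0) s') := by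
    intro s₁ hn₁ h₁
    refine (runs_forLoop (N := s.nat 0 0) (B := s.nat 0 0 * 8 + 24) (fun m s' =>
      s'.nat 0 = s.nat 0 ∧ (0 < s.nat 0 0 → ProgInv s m s')) (Nat.zero_le _) ?_ ?_ ?_).mono
      (by simp [NatExpr.eval]) fun _ h => h
    · intro k s' h _
      simp [NatExpr.eval, h.1]
    · exact ⟨by simp [hn₁], fun h => (h₁ h).writeCounter⟩
    · rintro k s' hk - ⟨h1, h2⟩ hc
      refine (runs_layoutStep (D (by omega)) (h2 (by omega)) hk).mono le_rfl ?_
      rintro s'' ⟨g1, g2⟩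
      exact ⟨by rw [g1, hc], by simp [g2.same.num], fun _ => g2.writeCounter⟩
  refine (Runs.seq (B' := s.nat 0 0 * (s.nat 0 0 * 8 + 26) + 2 + (s.nat 0 0 * 4 + 2))
    (runs_layoutInit hr).frame fun s₁ h₁ => Runs.seq (B' := s.nat 0 0 * 4 + 2)
      (loop s₁ h₁.1.1 fun hn => h₁.1.2 hn (D hn)).frame fun s₂ h₂ => ?_).mono
    (by rw [Nat.mul_add, Nat.mul_add]; omega) fun _ h => h
  have hn2 : s₂.nat 0 0 = s.nat 0 0 := by rw [h₂.1.1]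
  refine (runs_layoutFinish s₂).frame.mono (by rw [hn2]) ?_
  rintro s₃ ⟨h₃, F3⟩ hn
  obtain ⟨⟨-, h₂⟩, F2⟩ := h₂
  have F1 := h₁.2
  have I := h₂ hn
  have L := I.layout
  rw [hn2] at h₃
  have hnat : s₃.nat 2 = s₂.nat 2 :=
    F3.nat 2 (by simp [forLoop, layoutFinish, Program.natWrites])
  have hreal : ∀ a ∈ [4, 6, 17], s₂.real a = s.real a := by
    intro a ha
    simp only [List.mem_cons, List.not_mem_nil, or_false] at ha
    rw [F2.real a (by rcases ha with rfl | rfl | rfl <;>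
      simp [forLoop, layoutStep, findMax, chooseClass, chooseRow, findNext, placePiece, argMin,
        Program.realWrites]),
      F1.real a (by rcases ha with rfl | rfl | rfl <;> simp [layoutInit, Program.realWrites])]
  have all : ∀ i < s.nat 0 0, s₂.real 9 i = 0 := by
    intro i hi
    have := I.count
    have hc : ((Finset.range (s.nat 0 0)).filter fun i => s₂.real 9 i ≠ 0).card = 0 := by omega
    by_contra h
    have hm : i ∈ (Finset.range (s.nat 0 0)).filter fun i => s₂.real 9 i ≠ 0 := by
      simp [hi, h]
    rw [Finset.card_eq_zero.1 hc] at hm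
    simp at hm
  have hT := (D hn).base_pos
  have hsum : ∑ i ∈ Finset.range (s.nat 0 0), s.real 7 i * (s.real 8 i - s₂.real 9 i) =
      ∑ i ∈ Finset.range (s.nat 0 0), s.real 7 i * s.real 8 i :=
    Finset.sum_congr rfl fun i hi => by rw [all i (Finset.mem_range.1 hi), sub_zero]
  have hac := mul_nonneg L.base_nonneg L.class_nonneg
  have hTc := mul_nonneg hT.le L.class_nonneg
  have area := L.area
  have area' := L.area_of_pos
  rw [hsum] at area area'
  refine ⟨s₂.real 14 0, s₂.nat 6 0, s₂.real 21, s₂.real 22, ?_, ?_, by linarith, L.top_nonneg,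
    fun hb => by linarith [area' hb], ?_, ?_⟩
  · intro i hi
    obtain ⟨p1, p2, p3, p4, p5, p6⟩ := L.placed i hi (all i hi)
    rw [hnat]
    exact ⟨p1, p2, p3, p4, p5, fun h0 => p6 (by omega)⟩
  · intro i hi j hj hij e
    rw [hnat] at e
    exact L.pairs i hi j hj hij (all i hi) (all j hj) e
  · intro i hi
    rw [(h₃ i hi).1, I.offsets i hi (all i hi), hnat, hreal 17 (by simp), hreal 6 (by simp),
      hreal 4 (by simp), I.same.slope]
  · intro i hi
    rw [(h₃ i hi).2, hreal 4 (by simp)]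

/-! ### Computing the data of the pieces -/

/-- Among the points of the piece in register `3`, find one that minimizes `f`. -/
def pointSearch (d : ℕ) (f : NatExpr → RealExpr) : Program :=
  .seq (.setNat d (.const 0) (.read 1 (.reg 3)))
    (argMin d 4 (.read 1 (.reg 3)) (.read 1 (.add (.reg 3) (.const 1)))
      (fun _ => .natLt (.const 0) (.const 1)) f)

theorem runs_pointSearch {d : ℕ} {f : NatExpr → RealExpr} {s : State} {i u v : ℕ}
    (hi : s.nat 3 0 = i) (hu : s.nat 1 i = u) (hv : s.nat 1 (i + 1) = v) (huv : u < v)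
    (h1 : 1 ≠ d) (h3 : 3 ≠ d) (h4 : 4 ≠ d) (F : ℕ → ℝ)
    (hf : ∀ s' e, s'.real = s.real → s'.nat 3 0 = i → (f (.reg e)).eval s' = F (s'.nat e 0)) :
    Runs (pointSearch d f) s ((v - u) * 4 + 3) fun s' =>
      s'.real = s.real ∧ (∀ a, a ≠ 4 → a ≠ d → s'.nat a = s.nat a) ∧
      u ≤ s'.nat d 0 ∧ s'.nat d 0 < v ∧ ∀ k, u ≤ k → k < v → F (s'.nat d 0) ≤ F k := by
  subst hi hu hv
  refine (runs_setNat_seq (runs_argMin h4 (fun _ => True) F ?_ ?_ ?_ ?_)).mono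
    (B' := (s.nat 1 (s.nat 3 0 + 1) - s.nat 1 (s.nat 3 0)) * 4 + 3) ?_ ?_
  · intro s' e _ _
    simp [Test.Holds, NatExpr.eval]
  · intro s' e h h'
    refine hf s' e h ?_
    rw [h' 3 (by decide) h3]
    simp [h3]
  · intro s' h
    simp [NatExpr.eval, h 1 (by decide) h1, h 3 (by decide) h3]
  · simp [NatExpr.eval, h1, h3]; omega
  · simp [NatExpr.eval, h1, h3]; omega
  · rintro s' ⟨g1, g2, g3, -, g5⟩
    simp [NatExpr.eval, h1, h3] at g3 g5
    refine ⟨g1, fun a ha ha' => by rw [g2 a ha ha']; simp [ha'], ?_, ?_, g5⟩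
    · rcases g3 with h | h <;> omega
    · rcases g3 with h | h <;> omega

/-- The data of a piece with the points `(x k, y k)` for `u ≤ k < v`: the height `yb` of its lowest
point, the slope `sl` of its spine (which joins a lowest and a highest point), the left end `lo` and
the width `w` of its shadow on the `x`-axis in direction of the spine, its height `h` and its
horizontal extent `e`. -/
def PieceData (x y : ℕ → ℝ) (u v : ℕ) (yb sl lo w h e : ℝ) : Prop :=
  ∃ b t l r m M : ℕ, (u ≤ b ∧ b < v) ∧ (u ≤ t ∧ t < v) ∧ (u ≤ l ∧ l < v) ∧ (u ≤ r ∧ r < v) ∧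
    (u ≤ m ∧ m < v) ∧ (u ≤ M ∧ M < v) ∧
    yb = y b ∧ h = y t - y b ∧ sl = (x t - x b) / h ∧ lo = x l - sl * y l ∧
    w = x r - sl * y r - lo ∧ e = x M - x m ∧
    ∀ k, u ≤ k → k < v → y b ≤ y k ∧ y k ≤ y t ∧ x l - sl * y l ≤ x k - sl * y k ∧
      x k - sl * y k ≤ x r - sl * y r ∧ x m ≤ x k ∧ x k ≤ x M

/-- Compute the data of the piece in register `3`. -/
def pieceProgram : Program :=
  .seq (pointSearch 7 fun k => .read 1 k)
  (.seq (pointSearch 8 fun k => .sub (.const 0) (.read 1 k))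
  (.seq (pointSearch 9 fun k => .read 0 k)
  (.seq (pointSearch 10 fun k => .sub (.const 0) (.read 0 k))
  (.seq (.setReal 4 (.reg 3) (.read 1 (.reg 7)))
  (.seq (.setReal 8 (.reg 3) (.sub (.read 1 (.reg 8)) (.read 1 (.reg 7))))
  (.seq (.setReal 9 (.reg 3) (.read 8 (.reg 3)))
  (.seq (.setReal 10 (.reg 3) (.sub (.read 0 (.reg 10)) (.read 0 (.reg 9))))
  -- Pieces with inner points have positive height, so the convention on division by zero plays no
  -- role. The slope is stored before the last two searches, whose objective reads it.
  (.seq (.setReal 5 (.reg 3) (.div (.sub (.read 0 (.reg 8)) (.read 0 (.reg 7)))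
    (.read 8 (.reg 3))))
  (.seq (pointSearch 11 fun k => .sub (.read 0 k) (.mul (.read 5 (.reg 3)) (.read 1 k)))
  (.seq (pointSearch 12 fun k => .sub (.const 0)
    (.sub (.read 0 k) (.mul (.read 5 (.reg 3)) (.read 1 k))))
  (.seq (.setReal 6 (.reg 3) (.sub (.read 0 (.reg 11))
    (.mul (.read 5 (.reg 3)) (.read 1 (.reg 11)))))
  (.setReal 7 (.reg 3) (.sub (.sub (.read 0 (.reg 12))
    (.mul (.read 5 (.reg 3)) (.read 1 (.reg 12)))) (.read 6 (.reg 3)))))))))))))))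

/-- The data of piece `i` have been computed. -/
def HasPieceData (s₀ s : State) (i : ℕ) : Prop :=
  PieceData (s₀.real 0) (s₀.real 1) (s₀.nat 1 i) (s₀.nat 1 (i + 1)) (s.real 4 i) (s.real 5 i)
    (s.real 6 i) (s.real 7 i) (s.real 8 i) (s.real 10 i) ∧ s.real 9 i = s.real 8 i

theorem runs_pieceProgram {s : State} {i u v : ℕ}
    (hi : s.nat 3 0 = i) (hu : s.nat 1 i = u) (hv : s.nat 1 (i + 1) = v) (huv : u < v) :
    Runs pieceProgram s ((v - u) * 24 + 25) fun s' =>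
      s'.nat 0 = s.nat 0 ∧ s'.nat 1 = s.nat 1 ∧ s'.nat 3 = s.nat 3 ∧
      s'.real 0 = s.real 0 ∧ s'.real 1 = s.real 1 ∧
      (∀ j, j ≠ i → ∀ a, s'.real a j = s.real a j) ∧ HasPieceData s s' i := by
  have cast : ∀ (d : ℕ) (f : NatExpr → RealExpr) (s' : State) (F : ℕ → ℝ), s'.nat 3 = s.nat 3 →
      s'.nat 1 = s.nat 1 → 1 ≠ d → 3 ≠ d → 4 ≠ d →
      (∀ s'' e, s''.real = s'.real → s''.nat 3 0 = i → (f (.reg e)).eval s'' = F (s''.nat e 0)) →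
      Runs (pointSearch d f) s' ((v - u) * 4 + 3) _ := fun d f s' F h3 h1 d1 d3 d4 hf =>
    runs_pointSearch (by rw [h3, hi]) (by rw [h1, hu]) (by rw [h1, hv]) huv d1 d3 d4 F hf
  refine (Runs.seq (B' := (v - u) * 20 + 22) (cast 7 _ s (s.real 1) rfl rfl (by decide) (by decide)
    (by decide) ?_) fun s₁ h₁ => ?_).mono (by omega) fun _ h => h
  · intro s' e h _; simp [RealExpr.eval, NatExpr.eval, h]
  obtain ⟨r1, n1, b1, b2, b3⟩ := h₁
  refine (Runs.seq (B' := (v - u) * 16 + 19) (cast 8 _ s₁ (fun k => 0 - s.real 1 k)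
    (n1 3 (by decide) (by decide))
    (n1 1 (by decide) (by decide)) (by decide) (by decide)
    (by decide) ?_) fun s₂ h₂ => ?_).mono (by omega) fun _ h => h
  · intro s' e h _; simp [RealExpr.eval, NatExpr.eval, h, r1]
  obtain ⟨r2, n2, t1, t2, t3⟩ := h₂
  refine (Runs.seq (B' := (v - u) * 12 + 16) (cast 9 _ s₂ (s.real 0)
    (by rw [n2 3 (by decide) (by decide), n1 3 (by decide) (by decide)])
    (by rw [n2 1 (by decide) (by decide), n1 1 (by decide) (by decide)]) (by decide) (by decide)
    (by decide) ?_) fun s₃ h₃ => ?_).mono (by omega) fun _ h => h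
  · intro s' e h _; simp [RealExpr.eval, NatExpr.eval, h, r1, r2]
  obtain ⟨r3, n3, m1, m2, m3⟩ := h₃
  refine (Runs.seq (B' := (v - u) * 8 + 13) (cast 10 _ s₃ (fun k => 0 - s.real 0 k)
    (by rw [n3 3 (by decide) (by decide), n2 3 (by decide) (by decide),
      n1 3 (by decide) (by decide)])
    (by rw [n3 1 (by decide) (by decide), n2 1 (by decide) (by decide),
      n1 1 (by decide) (by decide)]) (by decide) (by decide)
    (by decide) ?_) fun s₄ h₄ => ?_).mono (by omega) fun _ h => h
  · intro s' e h _; simp [RealExpr.eval, NatExpr.eval, h, r1, r2, r3]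
  obtain ⟨r4, n4, M1, M2, M3⟩ := h₄
  have r4' : s₄.real = s.real := by rw [r4, r3, r2, r1]
  have k0 : s₄.nat 0 = s.nat 0 := by simp [n4, n3, n2, n1]
  have k1 : s₄.nat 1 = s.nat 1 := by simp [n4, n3, n2, n1]
  have k3 : s₄.nat 3 = s.nat 3 := by simp [n4, n3, n2, n1]
  have k7 : s₄.nat 7 = s₁.nat 7 := by simp [n4, n3, n2]
  have k8 : s₄.nat 8 = s₂.nat 8 := by simp [n4, n3]
  have k9 : s₄.nat 9 = s₃.nat 9 := by simp [n4]
  set b := s₁.nat 7 0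
  set t := s₂.nat 8 0
  set m := s₃.nat 9 0
  set M := s₄.nat 10 0
  set x := s.real 0
  set y := s.real 1
  set h := y t - y b with hh
  set sl := (x t - x b) / h with hsl
  have ei : s₄.nat 3 0 = i := by rw [k3, hi]
  refine (runs_setReal_seq (runs_setReal_seq (runs_setReal_seq (runs_setReal_seq
    (runs_setReal_seq (B := (v - u) * 8 + 8) ?_))))).mono (by omega) fun _ h => h
  simp only [RealExpr.eval, NatExpr.eval, State.writeReal_nat, ei, k7, k8, k9, r4']
  generalize hs₅ : State.writeReal _ 5 i _ = s₅
  have q4 : s₅.real 4 = Function.update (s.real 4) i (y b) := by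
    rw [← hs₅]; simp [r4', b, y]
  have q8 : s₅.real 8 = Function.update (s.real 8) i h := by
    rw [← hs₅]; simp [r4', b, y, t, hh]
  have q9 : s₅.real 9 = Function.update (s.real 9) i h := by
    rw [← hs₅]; simp [r4', b, y, t, hh]
  have q10 : s₅.real 10 = Function.update (s.real 10) i (x M - x m) := by
    rw [← hs₅]; simp [r4', m, M, x]
  have q5 : s₅.real 5 = Function.update (s.real 5) i sl := by
    rw [← hs₅]; simp [r4', b, t, x, y, hh, hsl]
  have qo : ∀ a, a ≠ 4 → a ≠ 5 → a ≠ 8 → a ≠ 9 → a ≠ 10 → s₅.real a = s.real a := by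
    intro a a1 a2 a3 a4 a5
    rw [← hs₅]; simp [a1, a2, a3, a4, a5, r4']
  have qn : s₅.nat = s₄.nat := by rw [← hs₅]; rfl
  clear hs₅
  refine (Runs.seq (B' := (v - u) * 4 + 5) (cast 11 _ s₅ (fun k => x k - sl * y k)
    (by rw [qn, k3]) (by rw [qn, k1]) (by decide) (by decide)
    (by decide) ?_) fun s₆ h₆ => ?_).mono (by omega) fun _ h => h
  · intro s' e h h3
    simp [RealExpr.eval, NatExpr.eval, h, h3, q5, qo 0, qo 1, x, y]
  obtain ⟨r6, n6, l1, l2, l3⟩ := h₆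
  refine (Runs.seq (B' := 2) (cast 12 _ s₆ (fun k => 0 - (x k - sl * y k))
    (by rw [n6 3 (by decide) (by decide), qn, k3])
    (by rw [n6 1 (by decide) (by decide), qn, k1]) (by decide) (by decide)
    (by decide) ?_) fun s₇ h₇ => ?_).mono (by omega) fun _ h => h
  · intro s' e h h3
    simp [RealExpr.eval, NatExpr.eval, h, h3, q5, qo 0, qo 1, x, y, r6]
  obtain ⟨r7, n7, R1, R2, R3⟩ := h₇
  have r7' : s₇.real = s₅.real := by rw [r7, r6]
  have e0 : s₇.nat 0 = s.nat 0 := by rw [n7 0 (by decide) (by decide), n6 0 (by decide) (by decide), qn, k0]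
  have e1 : s₇.nat 1 = s.nat 1 := by rw [n7 1 (by decide) (by decide), n6 1 (by decide) (by decide), qn, k1]
  have e3 : s₇.nat 3 = s.nat 3 := by rw [n7 3 (by decide) (by decide), n6 3 (by decide) (by decide), qn, k3]
  have e11 : s₇.nat 11 = s₆.nat 11 := by rw [n7 11 (by decide) (by decide)]
  set l := s₆.nat 11 0
  set r := s₇.nat 12 0
  refine runs_setReal_seq (runs_setReal ?_)
  simp only [RealExpr.eval, NatExpr.eval, State.writeReal_nat, e3, hi, e11, r7', q5,
    Function.update_self]
  refine ⟨e0, e1, trivial, by simp [r7', qo 0, x], by simp [r7', qo 1, y], ?_, ?_, ?_⟩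
  · intro j hj a
    by_cases a7 : a = 7
    · subst a7; simp [hj, r7', qo 7]
    by_cases a6 : a = 6
    · subst a6; simp [hj, r7', qo 6]
    simp only [ne_eq, a7, not_false_eq_true, State.writeReal_real_of_ne, a6, r7']
    by_cases a4 : a = 4
    · subst a4; simp [hj, q4]
    by_cases a5 : a = 5
    · subst a5; simp [hj, q5]
    by_cases a8 : a = 8
    · subst a8; simp [hj, q8]
    by_cases a9 : a = 9
    · subst a9; simp [hj, q9]
    by_cases a10 : a = 10
    · subst a10; simp [hj, q10]
    rw [qo a a4 a5 a8 a9 a10]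
  · rw [hu, hv]
    refine ⟨b, t, l, r, m, M, ⟨b1, b2⟩, ⟨t1, t2⟩, ⟨l1, l2⟩, ⟨R1, R2⟩, ⟨m1, m2⟩, ⟨M1, M2⟩,
      ?_, ?_, ?_, ?_, ?_, ?_, ?_⟩
    · simp [r7', q4, y]
    · simp [r7', q8, hh, y]
    · simp [r7', q8, q5, hsl]; rfl
    · simp [r7', q5, qo 0, qo 1, l]
    · simp [r7', q5, qo 0, qo 1, r]
    · simp [r7', q10, x]
    · intro k hk hk'
      have := b3 k hk hk'
      have := t3 k hk hk'
      have := l3 k hk hk'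
      have := R3 k hk hk'
      have := m3 k hk hk'
      have := M3 k hk hk'
      simp [r7', q5]
      refine ⟨?_, ?_, ?_, ?_, ?_, ?_⟩ <;> linarith
  · simp [r7', q9, q8]

/-- Compute the data of all pieces. -/
def dataProgram : Program := forLoop 3 (.const 0) (.reg 0) pieceProgram

theorem runs_dataProgram {s : State} {N : ℕ}
    (hlt : ∀ i < s.nat 0 0, s.nat 1 i < s.nat 1 (i + 1)) (hN : ∀ i < s.nat 0 0, s.nat 1 (i + 1) ≤ N) :
    Runs dataProgram s (s.nat 0 0 * (N * 24 + 27) + 2) fun s' =>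
      s'.nat 0 = s.nat 0 ∧ ∀ i < s.nat 0 0, HasPieceData s s' i := by
  refine (runs_forLoop (N := s.nat 0 0) (B := N * 24 + 25) (fun k s' =>
    s'.nat 0 = s.nat 0 ∧ s'.nat 1 = s.nat 1 ∧ s'.real 0 = s.real 0 ∧ s'.real 1 = s.real 1 ∧
      ∀ i < k, HasPieceData s s' i) (Nat.zero_le _) ?_ ?_ ?_).mono
      (by simp [NatExpr.eval]) fun _ h => ⟨h.1, h.2.2.2.2⟩
  · intro k s' h _
    simp [NatExpr.eval, h.1]
  · exact ⟨by simp, by simp, rfl, rfl, fun i hi => absurd hi (by simp [NatExpr.eval])⟩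
  · rintro k s' hk - ⟨h1, h2, h3, h4, h5⟩ hc
    have := hlt k hk
    have := hN k hk
    refine (runs_pieceProgram hc rfl rfl (by rw [h2]; exact hlt k hk)).mono
      (by rw [h2]; omega) ?_
    rintro s'' ⟨g1, g2, g3, g4, g5, g6, g7⟩
    refine ⟨by rw [g3, hc], by simp [g1, h1], by simp [g2, h2], by simp [g4, h3], by simp [g5, h4],
      fun i hi => ?_⟩
    rcases eq_or_ne i k with rfl | hik
    · unfold HasPieceData at g7 ⊢
      rwa [h2, h3, h4] at g7
    · have := h5 i (by omega)
      unfold HasPieceData at this ⊢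
      simp only [State.writeNat_real, g6 i hik]
      exact this

/-! ### From the memory to the geometry of the pieces -/

namespace PackingInstance

variable (I : PackingInstance)

theorem start_succ {i : ℕ} (hi : i < I.num) :
    I.start (i + 1) = I.start i + (I.pieces[i]'hi).length := by
  unfold start
  rw [List.take_add_one, List.getElem?_eq_getElem hi]
  simp

theorem start_le_size (i : ℕ) : I.start i ≤ I.size := by
  unfold start size points
  conv_rhs => rw [← List.take_append_drop i I.pieces, List.flatten_append, List.length_append]
  omega

theorem points_getD {i : ℕ} (hi : i < I.num) {k : ℕ} (hk : k < (I.pieces[i]'hi).length) :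
    I.points.getD (I.start i + k) 0 = (I.pieces[i]'hi)[k] := by
  have h : I.points = (I.pieces.take i).flatten ++
      (I.pieces[i]'hi ++ (I.pieces.drop (i + 1)).flatten) := by
    unfold points
    conv_lhs => rw [← List.take_append_drop i I.pieces, List.flatten_append,
      List.drop_eq_getElem_cons hi, List.flatten_cons]
  rw [h, List.getD_append_right _ _ _ _ (by unfold start; omega)]
  rw [show I.start i + k - (I.pieces.take i).flatten.length = k by unfold start; omega]
  rw [List.getD_append _ _ _ _ hk, List.getD_eq_getElem _ _ hk]

theorem mem_pieces_iff {i : ℕ} (hi : i < I.num) (p : Plane) :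
    p ∈ I.pieces[i]'hi ↔ ∃ k, I.start i ≤ k ∧ k < I.start (i + 1) ∧ I.points.getD k 0 = p := by
  rw [List.mem_iff_getElem, I.start_succ hi]
  constructor
  · rintro ⟨k, hk, rfl⟩
    exact ⟨I.start i + k, by omega, by omega, I.points_getD hi hk⟩
  · rintro ⟨k, h1, h2, rfl⟩
    refine ⟨k - I.start i, by omega, ?_⟩
    rw [← I.points_getD hi (by omega), Nat.add_sub_cancel' h1]

theorem start_lt {i : ℕ} (hi : i < I.num) : I.start i < I.start (i + 1) := by
  rw [I.start_succ hi]
  have := I.nondeg (I.pieces[i]'hi) (List.getElem_mem hi)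
  have hne : I.pieces[i]'hi ≠ [] := by
    intro h
    rw [h] at this
    simp at this
  have := List.length_pos_iff.2 hne
  omega

/-- Every piece lists at least one point because its interior is nonempty. -/
theorem num_le_size : I.num ≤ I.size := by
  have : ∀ i ≤ I.num, i ≤ I.start i := by
    intro i
    induction i with
    | zero => intro _; exact Nat.zero_le _
    | succ i ih => intro h; have := I.start_lt (i := i) (by omega); have := ih (by omega); omega
  exact (this I.num le_rfl).trans (I.start_le_size _)

theorem input_num : I.input.nat 0 0 = I.num := rfl

theorem input_start {i : ℕ} (hi : i ≤ I.num) : I.input.nat 1 i = I.start i := by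
  simp [input, hi]

theorem convex_piece (i : Fin I.num) : Convex ℝ (I.piece i) := convex_convexHull ℝ _

theorem isCompact_piece (i : Fin I.num) : IsCompact (I.piece i) :=
  (List.finite_toSet (I.pieces.get i)).isCompact_convexHull ℝ

theorem interior_piece_nonempty (i : Fin I.num) : (interior (I.piece i)).Nonempty :=
  I.nondeg _ (List.get_mem _ _)

end PackingInstance

/-- What the data of a piece `S` mean. -/
structure Shape (S : Set Plane) (yb sl lo w h e : ℝ) : Prop where
  height_pos : 0 < h
  width_nonneg : 0 ≤ w
  extent_pos : 0 < e
  vertical : ∀ p ∈ S, yb ≤ p 1 ∧ p 1 ≤ yb + h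
  sheared : ∀ p ∈ S, lo ≤ p 0 - sl * p 1 ∧ p 0 - sl * p 1 ≤ lo + w
  horizontal : ∀ p ∈ S, lo + sl * yb - e ≤ p 0 ∧ p 0 ≤ lo + sl * yb + 2 * e
  area : ENNReal.ofReal (w * h / 2) ≤ volume S
  exists_height : ∃ p ∈ S, ∃ q ∈ S, h = p 1 - q 1
  exists_extent : ∃ p ∈ S, ∃ q ∈ S, e = p 0 - q 0
  width_le : w ≤ 2 * e

/-- A set with inner points is not contained in a line that is parallel to an axis. -/
theorem exists_lt_of_interior {S : Set Plane} (hS : (interior S).Nonempty) (i : Fin 2) :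
    ∃ p ∈ S, ∃ q ∈ S, p i < q i := by
  obtain ⟨p, hp⟩ := hS
  have hn : (fun ε : ℝ => p + ε • (EuclideanSpace.single i 1 : Plane)) ⁻¹' S ∈ nhds 0 := by
    refine ContinuousAt.preimage_mem_nhds (by fun_prop) ?_
    simpa using (mem_interior_iff_mem_nhds.1 hp)
  obtain ⟨ε, h1, hε⟩ := Filter.nonempty_of_mem
    (Filter.inter_mem (mem_nhdsWithin_of_mem_nhds (t := Set.Ioi 0) hn) self_mem_nhdsWithin)
  refine ⟨p, interior_subset hp, _, h1, ?_⟩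
  have : 0 < ε := hε
  simpa using this

/-- Linear bounds pass from the listed points to their hull. For the horizontal ones, compare an
extreme point of the shadow with the point of the spine at the same height: both lie in the piece,
so the shadow reaches at most `e` to either side of the spine. Hence `w ≤ 2 * e`, and the lowest
point is at most `e` to the right of the left end of the base. -/
theorem PieceData.shape (I : PackingInstance) (i : Fin I.num) {yb sl lo w h e : ℝ}
    (H : PieceData (I.input.real 0) (I.input.real 1) (I.input.nat 1 i) (I.input.nat 1 (i + 1))
      yb sl lo w h e) : Shape (I.piece i) yb sl lo w h e := by
  obtain ⟨b, t, l, r, m, M, hb, ht, hl, hr, hm, hM, rfl, rfl, rfl, rfl, rfl, rfl, hall⟩ := H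
  rw [I.input_start (by omega), I.input_start (by omega)] at *
  set P : ℕ → Plane := fun k => I.points.getD k 0 with hP
  change ∀ k, _ → _ → (P b) 1 ≤ (P k) 1 ∧ (P k) 1 ≤ (P t) 1 ∧ _ at hall
  have hx : I.input.real 0 = fun k => (P k) 0 := rfl
  have hy : I.input.real 1 = fun k => (P k) 1 := rfl
  simp only [hx, hy] at *
  clear hx hy
  set h := (P t) 1 - (P b) 1 with hh
  set sl := ((P t) 0 - (P b) 0) / h with hsl
  set lo := (P l) 0 - sl * (P l) 1 with hlo
  have mem : ∀ k, I.start i ≤ k ∧ k < I.start (i + 1) → P k ∈ I.piece i := fun k hk =>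
    subset_convexHull ℝ _ ((I.mem_pieces_iff i.2 _).2 ⟨k, hk.1, hk.2, rfl⟩)
  have lin : ∀ u v c : ℝ, (∀ k, I.start i ≤ k → k < I.start (i + 1) →
      u * (P k) 0 + v * (P k) 1 ≤ c) → ∀ p ∈ I.piece i, u * p 0 + v * p 1 ≤ c := by
    intro u v c hk
    refine convexHull_linear_le fun p hp => ?_
    obtain ⟨k, h1, h2, rfl⟩ := (I.mem_pieces_iff i.2 p).1 hp
    exact hk k h1 h2
  have v1 : ∀ p ∈ I.piece i, (P b) 1 ≤ p 1 := fun p hp => by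
    linarith [lin 0 (-1) (-(P b) 1) (fun k h1 h2 => by linarith [(hall k h1 h2).1]) p hp]
  have v2 : ∀ p ∈ I.piece i, p 1 ≤ (P t) 1 := fun p hp => by
    linarith [lin 0 1 ((P t) 1) (fun k h1 h2 => by linarith [(hall k h1 h2).2.1]) p hp]
  have s1 : ∀ p ∈ I.piece i, lo ≤ p 0 - sl * p 1 := fun p hp => by
    linarith [lin (-1) sl (-lo) (fun k h1 h2 => by linarith [(hall k h1 h2).2.2.1]) p hp]
  have s2 : ∀ p ∈ I.piece i, p 0 - sl * p 1 ≤ (P r) 0 - sl * (P r) 1 := fun p hp => by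
    linarith [lin 1 (-sl) ((P r) 0 - sl * (P r) 1)
      (fun k h1 h2 => by linarith [(hall k h1 h2).2.2.2.1]) p hp]
  have e1 : ∀ p ∈ I.piece i, (P m) 0 ≤ p 0 := fun p hp => by
    linarith [lin (-1) 0 (-(P m) 0) (fun k h1 h2 => by linarith [(hall k h1 h2).2.2.2.2.1]) p hp]
  have e2 : ∀ p ∈ I.piece i, p 0 ≤ (P M) 0 := fun p hp => by
    linarith [lin 1 0 ((P M) 0) (fun k h1 h2 => by linarith [(hall k h1 h2).2.2.2.2.2]) p hp]
  have hpos : 0 < h := by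
    obtain ⟨p, hp, q, hq, hlt⟩ := exists_lt_of_interior (I.interior_piece_nonempty i) 1
    linarith [v1 p hp, v2 q hq]
  have epos : 0 < (P M) 0 - (P m) 0 := by
    obtain ⟨p, hp, q, hq, hlt⟩ := exists_lt_of_interior (I.interior_piece_nonempty i) 0
    linarith [e1 p hp, e2 q hq]
  have hst : (P t) 0 - (P b) 0 = sl * h := by rw [hsl]; field_simp
  -- a point of the spine at a given height
  have spine : ∀ p ∈ I.piece i,
      ∃ q ∈ I.piece i, q 1 = p 1 ∧ q 0 - sl * q 1 = (P b) 0 - sl * (P b) 1 := by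
    intro p hp
    set τ := (p 1 - (P b) 1) / h with hτ
    have hτh : τ * h = p 1 - (P b) 1 := by rw [hτ]; field_simp
    have h0 : 0 ≤ τ := div_nonneg (by linarith [v1 p hp]) hpos.le
    have h1 : τ ≤ 1 := by rw [hτ, div_le_one hpos]; linarith [v2 p hp]
    refine ⟨P b + τ • (P t - P b), (I.convex_piece i).add_smul_sub_mem (mem b hb) (mem t ht)
      ⟨h0, h1⟩, ?_, ?_⟩
    · simp only [PiLp.add_apply, PiLp.smul_apply, PiLp.sub_apply, smul_eq_mul]
      rw [← hh]; linarith
    · simp only [PiLp.add_apply, PiLp.smul_apply, PiLp.sub_apply, smul_eq_mul]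
      rw [← hh, hst]; ring
  have hleft : (P b) 0 - sl * (P b) 1 - lo ≤ (P M) 0 - (P m) 0 := by
    obtain ⟨q, hq, q1, q2⟩ := spine _ (mem l hl)
    rw [q1] at q2
    linarith [e2 q hq, e1 _ (mem l hl)]
  have hright : (P r) 0 - sl * (P r) 1 - ((P b) 0 - sl * (P b) 1) ≤ (P M) 0 - (P m) 0 := by
    obtain ⟨q, hq, q1, q2⟩ := spine _ (mem r hr)
    rw [q1] at q2
    linarith [e1 q hq, e2 _ (mem r hr)]
  have hlb := s1 _ (mem b hb)
  have hrb := s2 _ (mem b hb)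
  refine ⟨hpos, by linarith, epos, fun p hp => ⟨v1 p hp, by linarith [v2 p hp]⟩,
    fun p hp => ⟨s1 p hp, by linarith [s2 p hp]⟩, fun p hp => ⟨?_, ?_⟩, ?_,
    ⟨_, mem t ht, _, mem b hb, rfl⟩, ⟨_, mem M hM, _, mem m hm, rfl⟩, by linarith⟩
  · linarith [e1 p hp, e2 _ (mem b hb)]
  · linarith [e2 p hp, e1 _ (mem b hb)]
  · exact le_volume_of_spine (I.convex_piece i) (mem b hb) (mem t ht) (mem l hl) (mem r hr)
      (by linarith) hsl hlb hrb

/-- The geometry of the solution that the layout program finds. -/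
theorem LayoutResult.solution {I : PackingInstance} {s₀ s : State} {H : ℝ} {B : ℕ} {A Y : ℕ → ℝ}
    (R : LayoutResult s₀ s H B A Y) (hn : s₀.nat 0 0 = I.num)
    (hS : ∀ i : Fin I.num, Shape (I.piece i) (s₀.real 4 i) (s₀.real 5 i) (s₀.real 6 i)
      (s₀.real 7 i) (s₀.real 8 i) (s₀.real 10 i))
    (he : ∀ i < I.num, s₀.real 10 i ≤ s₀.real 17 0) :
    (∀ i, ∀ p ∈ (s.output I).placed i,
      (s₀.real 20 0 * s.nat 2 i ≤ p 0 ∧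
        p 0 ≤ s₀.real 20 0 * s.nat 2 i + (s₀.real 16 0 + 3 * s₀.real 17 0)) ∧
      0 ≤ p 1 ∧ p 1 ≤ s₀.real 18 0 ∧ (B = 0 → p 1 ≤ H)) ∧
    ∀ i j : Fin I.num, i ≠ j → s.nat 2 i = s.nat 2 j →
      NonOverlapping ((s.output I).placed i) ((s.output I).placed j) := by
  have hlt : ∀ i : Fin I.num, (i : ℕ) < s₀.nat 0 0 := fun i => by rw [hn]; exact i.2
  have hp : ∀ i, ∀ p ∈ (s.output I).placed i, ∃ q ∈ I.piece i, p 0 = q 0 + (s₀.real 20 0 *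
      s.nat 2 i + A i + s₀.real 17 0 - s₀.real 6 i - s₀.real 5 i * s₀.real 4 i) ∧
      p 1 = q 1 + (Y i - s₀.real 4 i) := by
    rintro i p ⟨q, hq, rfl⟩
    refine ⟨q, hq, ?_, ?_⟩
    · simp [State.output, R.shift_fst i (hlt i)]
    · simp [State.output, R.shift_snd i (hlt i)]
  have vert : ∀ i, ∀ p ∈ (s.output I).placed i, Y i ≤ p 1 ∧ p 1 ≤ Y i + s₀.real 8 i := by
    intro i p hpi
    obtain ⟨q, hq, -, e1⟩ := hp i p hpi
    have := (hS i).vertical q hq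
    constructor <;> linarith
  have lines : ∀ i, ∀ p ∈ (s.output I).placed i,
      p 0 ≤ (s₀.real 20 0 * s.nat 2 i + s₀.real 17 0 + A i + s₀.real 7 i - s₀.real 5 i * Y i) +
        s₀.real 5 i * p 1 ∧
      (s₀.real 20 0 * s.nat 2 i + s₀.real 17 0 + A i - s₀.real 5 i * Y i) +
        s₀.real 5 i * p 1 ≤ p 0 := by
    intro i p hpi
    obtain ⟨q, hq, e0, e1⟩ := hp i p hpi
    have := (hS i).sheared q hq
    rw [e0, e1]
    constructor <;> linarith
  have left : ∀ i j : Fin I.num, s.nat 2 i = s.nat 2 j → Y i = Y j →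
      A i + s₀.real 7 i ≤ A j → s₀.real 5 i ≤ s₀.real 5 j →
      NonOverlapping ((s.output I).placed i) ((s.output I).placed j) := by
    intro i j hb hY hA hs
    -- The two lines may cross below the row; they are compared only from the common bottom upwards,
    -- where the larger slope leads further to the right.
    refine nonOverlapping_of_lines (fun p hp => (lines i p hp).1) (fun p hp => (lines j p hp).2) ?_
    intro p hpi hpj
    have h1 := (vert i p hpi).1
    have h2 := mul_le_mul_of_nonneg_right hs (sub_nonneg.2 h1)
    rw [hb, ← hY]
    linarith
  refine ⟨fun i p hpi => ?_, fun i j hij hb => ?_⟩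
  -- The base starts in `[0, T]`, and the piece reaches at most `W` to the left and `2 * W` to the
  -- right of that start; the summand `W` in the translation makes this `[0, T + 3 * W]`.
  · obtain ⟨q, hq, e0, e1⟩ := hp i p hpi
    obtain ⟨a1, a2, a3, a4, a5, a6⟩ := R.placed i (hlt i)
    have h1 := (hS i).horizontal q hq
    have h2 := vert i p hpi
    have h3 := he i i.2
    refine ⟨⟨by linarith, by linarith⟩, by linarith, by linarith, fun hB => ?_⟩
    linarith [a6 hB]
  · rcases R.pairs i (hlt i) j (hlt j) (fun h => hij (Fin.ext h)) hb with
      h | h | ⟨h, ⟨h1, h2⟩ | ⟨h1, h2⟩⟩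
    · exact nonOverlapping_of_le (c := Y j) (fun p hp => by linarith [(vert i p hp).2])
        fun p hp => (vert j p hp).1
    · exact (nonOverlapping_of_le (c := Y i) (fun p hp => by linarith [(vert j p hp).2])
        fun p hp => (vert i p hp).1).symm
    · exact left i j hb h h1 h2
    · exact (left j i hb.symm h.symm h1 h2).symm

/-! ### The packing algorithm -/

/-- The memory holds the data of the pieces of `I`. -/
structure Prepared (I : PackingInstance) (s : State) : Prop where
  num : s.nat 0 0 = I.num
  shape : ∀ i : Fin I.num, Shape (I.piece i) (s.real 4 i) (s.real 5 i) (s.real 6 i)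
    (s.real 7 i) (s.real 8 i) (s.real 10 i)
  remaining : ∀ i < I.num, s.real 9 i = s.real 8 i

theorem Prepared.congr {I : PackingInstance} {s s' : State} (h : Prepared I s)
    (h0 : s'.nat 0 = s.nat 0) (hr : ∀ a, 4 ≤ a → a ≤ 10 → s'.real a = s.real a) :
    Prepared I s' := by
  refine ⟨by rw [h0, h.num], fun i => ?_, fun i hi => ?_⟩
  · rw [hr 4, hr 5, hr 6, hr 7, hr 8, hr 10] <;> first | exact h.shape i | omega
  · rw [hr 8, hr 9] <;> first | exact h.remaining i hi | omega

theorem runs_dataProgram_input (I : PackingInstance) :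
    Runs dataProgram I.input (I.num * (I.size * 24 + 27) + 2) (Prepared I) := by
  refine (runs_dataProgram (s := I.input) (N := I.size) ?_ ?_).mono le_rfl ?_
  · intro i hi
    rw [I.input_num] at hi
    rw [I.input_start hi.le, I.input_start hi]
    exact I.start_lt hi
  · intro i hi
    rw [I.input_num] at hi
    rw [I.input_start hi]
    exact I.start_le_size _
  · rintro s ⟨h1, h2⟩
    rw [I.input_num] at h2
    exact ⟨by rw [h1]; rfl, fun i => (h2 i i.2).1.shape, fun i hi => (h2 i hi).2⟩

/-- Prepare the data, compute the parameters by the program `P`, and compute the layout. -/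
def packProgram (P : Program) : Program := .seq dataProgram (.seq P layoutProgram)

/-- The conditions on the parameters. -/
structure GoodParameters (I : PackingInstance) (s : State) : Prop where
  base_pos : 0 < s.real 16 0
  cap_pos : 0 < s.real 18 0
  bound_cases : s.real 19 0 = s.real 18 0 ∨ 4 * s.real 19 0 ≤ s.real 18 0
  height_le : ∀ i < I.num, s.real 8 i ≤ s.real 19 0

/-- The part common to all four problems: only the computation of the parameters and the final
estimate differ. The arrays `4` to `10` are protected from `P` because the layout still reads the
data there. -/
theorem polyTimeSolvable_of_parameters {admissible : PackingInstance → Prop}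
    {good : (I : PackingInstance) → Solution I → Prop} (P : Program)
    (Q : PackingInstance → State → Prop)
    (hnat : 0 ∉ P.natWrites) (hreal : ∀ a, 4 ≤ a → a ≤ 10 → a ∉ P.realWrites)
    (hP : ∀ I, admissible I → ∀ s, Prepared I s → Runs P s (500 * (I.size + 1) ^ 2) (Q I))
    (hQ : ∀ I, admissible I → 0 < I.num → ∀ s, Prepared I s → Q I s → GoodParameters I s)
    (hgood₀ : ∀ I, admissible I → I.num = 0 → ∀ σ, good I σ)
    (hgood : ∀ I, admissible I → 0 < I.num → ∀ s s' H B A Y, Prepared I s → Q I s →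
      LayoutResult s s' H B A Y → good I (s'.output I)) :
    PolyTimeSolvable admissible good := by
  refine ⟨packProgram P, 600 * (Polynomial.X + 1) ^ 2, fun I hI => ?_⟩
  have key : Runs (packProgram P) I.input (600 * (I.size + 1) ^ 2) fun s' => good I (s'.output I) := by
    have hn := I.num_le_size
    refine (Runs.seq (B' := 500 * (I.size + 1) ^ 2 + (I.num * (I.num * 8 + 30) + 10))
      (runs_dataProgram_input I) fun s₁ h₁ =>
      Runs.seq (hP I hI s₁ h₁).frame fun s₂ h₂ => ?_).mono ?_ fun _ h => h
    · obtain ⟨h₂, F⟩ := h₂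
      have h₃ : Prepared I s₂ := h₁.congr (F.nat 0 hnat) fun a ha ha' => F.real a (hreal a ha ha')
      refine (runs_layoutProgram (s := s₂) (by rw [h₃.num]; exact h₃.remaining) ?_).mono
        (by rw [h₃.num]) ?_
      · intro hpos
        rw [h₃.num] at hpos
        have G := hQ I hI hpos s₂ h₃ h₂
        refine ⟨G.base_pos, G.cap_pos, G.bound_cases, ?_, ?_, ?_⟩ <;> rw [h₃.num]
        · exact fun i hi => (h₃.shape ⟨i, hi⟩).width_nonneg
        · exact fun i hi => (h₃.shape ⟨i, hi⟩).height_pos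
        · exact G.height_le
      · intro s₃ h
        rcases Nat.eq_zero_or_pos I.num with h0 | hpos
        · exact hgood₀ I hI h0 _
        · obtain ⟨H, B, A, Y, R⟩ := h (by rw [h₃.num]; exact hpos)
          exact hgood I hI hpos s₂ s₃ H B A Y h₃ h₂ R
    · nlinarith [Nat.mul_le_mul hn hn, Nat.mul_le_mul hn (le_refl I.size)]
  obtain ⟨t, s, h1, h2, h3⟩ := key
  refine ⟨t, s, h1, h2.trans (le_of_eq ?_), h3⟩
  simp

/-- The sum that the algorithm computes instead of the area. -/
theorem Prepared.sum_le {I : PackingInstance} {s : State} (h : Prepared I s) :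
    ENNReal.ofReal ((∑ i ∈ Finset.range (s.nat 0 0), s.real 7 i * s.real 8 i) / 2) ≤
      ∑ i, volume (I.piece i) := by
  rw [h.num, Finset.sum_range, Finset.sum_div, ENNReal.ofReal_sum_of_nonneg]
  · exact Finset.sum_le_sum fun i _ => (h.shape i).area
  · intro i _
    have := (h.shape i).width_nonneg
    have := (h.shape i).height_pos
    positivity

theorem Prepared.sum_nonneg {I : PackingInstance} {s : State} (h : Prepared I s) :
    0 ≤ ∑ i ∈ Finset.range (s.nat 0 0), s.real 7 i * s.real 8 i := by
  rw [h.num]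
  refine Finset.sum_nonneg fun i hi => ?_
  have S := h.shape ⟨i, Finset.mem_range.1 hi⟩
  exact mul_nonneg S.width_nonneg S.height_pos.le

theorem Prepared.sum_le_of_volume_le {I : PackingInstance} {s : State} (h : Prepared I s) {V : ℝ}
    (hV : 0 ≤ V) (hle : ∑ i, volume (I.piece i) ≤ ENNReal.ofReal V) :
    ∑ i ∈ Finset.range (s.nat 0 0), s.real 7 i * s.real 8 i ≤ 2 * V := by
  have := (ENNReal.ofReal_le_ofReal_iff hV).1 (h.sum_le.trans hle)
  linarith

/-! ### Lower bounds for the optimum -/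

theorem volume_translate (t : Plane) (S : Set Plane) : volume (translate t S) = volume S := by
  unfold translate
  rw [Set.image_add_right, measure_preimage_add_right]

theorem convex_translate (t : Plane) {S : Set Plane} (h : Convex ℝ S) :
    Convex ℝ (translate t S) := by
  have := h.translate t
  unfold translate
  simpa only [add_comm] using this

theorem interior_translate (t : Plane) {S : Set Plane} (h : (interior S).Nonempty) :
    (interior (translate t S)).Nonempty := by
  obtain ⟨p, hp⟩ := h
  have hi := (Homeomorph.addRight t).image_interior S
  exact ⟨p + t, by rw [translate]; exact hi ▸ ⟨p, hp, rfl⟩⟩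

namespace Solution

variable {I : PackingInstance}

theorem convex_placed (σ : Solution I) (i : Fin I.num) : Convex ℝ (σ.placed i) :=
  convex_translate _ (I.convex_piece i)

theorem volume_placed (σ : Solution I) (i : Fin I.num) :
    volume (σ.placed i) = volume (I.piece i) := volume_translate _ _

theorem add_shift_mem_placed (σ : Solution I) {i : Fin I.num} {p : Plane} (hp : p ∈ I.piece i) :
    p + σ.shift i ∈ σ.placed i := ⟨p, hp, rfl⟩

theorem IsPlanePacking.sum_volume_le {σ : Solution I} (h : σ.IsPlanePacking) {R : Set Plane}
    (hR : ∀ i, σ.placed i ⊆ R) : ∑ i, volume (I.piece i) ≤ volume R := by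
  rw [Finset.sum_congr rfl fun i _ => (σ.volume_placed i).symm]
  exact ConvexPacking.sum_volume_le _ (fun i _ => σ.convex_placed i) (fun i _ => hR i)
    fun i _ j _ hij => h hij

end Solution

/-- It suffices to compare with every single feasible solution. -/
theorem isApprox_of_forall {I : PackingInstance} {c : ℝ} (hc : 0 < c) {feasible : Solution I → Prop}
    {cost : Solution I → ℝ≥0∞} {σ : Solution I} (hσ : feasible σ)
    (h : ∀ τ, feasible τ → cost σ ≤ ENNReal.ofReal c * cost τ) : IsApprox c feasible cost σ := by
  refine ⟨hσ, ?_⟩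
  have h0 : ENNReal.ofReal c ≠ 0 := by simpa using hc
  unfold opt
  rw [mul_comm, ← ENNReal.div_le_iff_le_mul (.inl h0) (.inl ENNReal.ofReal_ne_top)]
  refine le_iInf₂ fun τ hτ => ?_
  rw [ENNReal.div_le_iff_le_mul (.inl h0) (.inl ENNReal.ofReal_ne_top), mul_comm]
  exact h τ hτ

/-! ### Bin packing and square packing -/

theorem unitSquare_eq_box : unitSquare = box 0 1 0 1 := rfl

theorem volume_unitSquare : volume unitSquare = 1 := by
  rw [unitSquare_eq_box, volume_box]; simp

theorem coord_sub_le_dist (p q : Plane) (i : Fin 2) : p i - q i ≤ dist p q := by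
  have h := dist_sq_plane p q
  refine (abs_le_of_sq_le_sq' (b := dist p q) ?_ dist_nonneg).2
  fin_cases i
  · simp only [Fin.zero_eta]; nlinarith [sq_nonneg (p 1 - q 1)]
  · simp only [Fin.mk_one]; nlinarith [sq_nonneg (p 0 - q 0)]

theorem Prepared.extent_le_of_diam {I : PackingInstance} {s : State} (h : Prepared I s) {d : ℝ}
    (hd : ∀ i, Metric.diam (I.piece i) ≤ d) :
    ∀ i < I.num, s.real 10 i ≤ d ∧ s.real 8 i ≤ d := by
  intro i hi
  have S := h.shape ⟨i, hi⟩
  have hle : ∀ p ∈ I.piece ⟨i, hi⟩, ∀ q ∈ I.piece ⟨i, hi⟩, dist p q ≤ d := fun p hp q hq =>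
    (Metric.dist_le_diam_of_mem (I.isCompact_piece _).isBounded hp hq).trans (hd _)
  obtain ⟨p, hp, q, hq, e⟩ := S.exists_extent
  obtain ⟨p', hp', q', hq', e'⟩ := S.exists_height
  simp only at e e'
  rw [e, e']
  exact ⟨(coord_sub_le_dist p q 0).trans (hle p hp q hq),
    (coord_sub_le_dist p' q' 1).trans (hle p' hp' q' hq')⟩

/-- The parameters for pieces of diameter at most `1/10` in unit squares. -/
def smallPieces : Program :=
  .seq (.setReal 16 (.const 0) (.const (7 / 10)))
    (.seq (.setReal 17 (.const 0) (.const (1 / 10)))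
      (.seq (.setReal 18 (.const 0) (.const 1))
        (.seq (.setReal 19 (.const 0) (.const (1 / 10))) (.setReal 20 (.const 0) (.const 0)))))

/-- The values that `smallPieces` computes. -/
def SmallPieces (s : State) : Prop :=
  s.real 16 0 = 7 / 10 ∧ s.real 17 0 = 1 / 10 ∧ s.real 18 0 = 1 ∧ s.real 19 0 = 1 / 10 ∧
    s.real 20 0 = 0

theorem runs_smallPieces (s : State) : Runs smallPieces s 5 SmallPieces := by
  refine runs_setReal_seq (runs_setReal_seq (runs_setReal_seq (runs_setReal_seq
    (runs_setReal ⟨?_, ?_, ?_, ?_, ?_⟩)))) <;> simp [RealExpr.eval, NatExpr.eval]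

/-- A row has length `7 / 10 + 3 / 10 = 1`, and the distance `0` puts all bins onto the same unit
square. -/
theorem LayoutResult.unitSquare_of_small {I : PackingInstance} {s s' : State} {H : ℝ} {B : ℕ}
    {A Y : ℕ → ℝ} (hd : ∀ i, Metric.diam (I.piece i) ≤ 1 / 10) (hs : Prepared I s)
    (hp : SmallPieces s) (R : LayoutResult s s' H B A Y) :
    (s'.output I).IsBinPacking := by
  obtain ⟨h16, h17, h18, h19, h20⟩ := hp
  obtain ⟨h1, h2⟩ := R.solution hs.num hs.shape fun i hi => by
    rw [h17]; exact (hs.extent_le_of_diam hd i hi).1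
  refine ⟨fun i p hp => ?_, fun i j hij e => h2 i j hij e⟩
  obtain ⟨⟨a1, a2⟩, a3, a4, -⟩ := h1 i p hp
  rw [h20] at a1 a2
  rw [h16, h17] at a2
  rw [h18] at a4
  exact ⟨⟨by linarith, by linarith⟩, a3, a4⟩

theorem SmallPieces.good {I : PackingInstance} {s : State}
    (hd : ∀ i, Metric.diam (I.piece i) ≤ 1 / 10) (hs : Prepared I s) (hp : SmallPieces s) :
    GoodParameters I s := by
  obtain ⟨h16, h17, h18, h19, h20⟩ := hp
  refine ⟨by rw [h16]; norm_num, by rw [h18]; norm_num, ?_, fun i hi => ?_⟩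
  · right; rw [h19, h18]; norm_num
  · rw [h19]; exact (hs.extent_le_of_diam hd i hi).2

theorem Solution.IsBinPacking.sum_volume_le {I : PackingInstance} {τ : Solution I}
    (h : τ.IsBinPacking) :
    ∑ i, volume (I.piece i) ≤ ((Finset.univ.image τ.bin).card : ℝ≥0∞) := by
  rw [← Finset.sum_fiberwise_of_maps_to (g := τ.bin) (t := Finset.univ.image τ.bin)
    (fun i hi => Finset.mem_image_of_mem _ hi)]
  have : ∀ b ∈ Finset.univ.image τ.bin,
      ∑ i ∈ Finset.univ.filter (fun i => τ.bin i = b), volume (I.piece i) ≤ 1 := by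
    intro b _
    rw [Finset.sum_congr rfl fun i _ => (τ.volume_placed i).symm, ← volume_unitSquare]
    refine ConvexPacking.sum_volume_le _ (fun i _ => τ.convex_placed i) (fun i _ => h.1 i) ?_
    intro i hi j hj hij
    rw [Finset.mem_filter] at hi hj
    exact h.2 hij (hi.2.trans hj.2.symm)
  simpa using Finset.sum_le_sum this

theorem five_le_poly (n : ℕ) : 5 ≤ 500 * (n + 1) ^ 2 := by
  have := Nat.one_le_pow 2 (n + 1) (by omega)
  omega

theorem binPacking : PolyTimeSolvable (fun I => ∀ i, Metric.diam (I.piece i) ≤ 1 / 10)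
    (fun _ => IsApprox 10.1 Solution.IsBinPacking Solution.binCount) := by
  refine polyTimeSolvable_of_parameters smallPieces (fun _ => SmallPieces)
    (by simp [smallPieces, Program.natWrites])
    (fun a h1 h2 => by simp [smallPieces, Program.realWrites]; omega)
    (fun I _ s _ => (runs_smallPieces s).mono (five_le_poly _) fun _ h => h)
    (fun I hd _ s hs hp => hp.good hd hs) ?_ ?_
  · intro I _ h0 σ
    have : IsEmpty (Fin I.num) := by rw [h0]; infer_instance
    refine isApprox_of_forall (by norm_num) ⟨fun i => isEmptyElim i, fun i => isEmptyElim i⟩ ?_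
    intro τ _
    simp [Solution.binCount]
  · intro I hd hpos s s' H B A Y hs hp R
    refine isApprox_of_forall (by norm_num) (R.unitSquare_of_small hd hs hp) fun τ hτ => ?_
    obtain ⟨h16, h17, h18, h19, h20⟩ := hp
    set N := (Finset.univ.image τ.bin).card with hN
    have hN1 : (1 : ℝ) ≤ N := by
      have : 0 < N := Finset.card_pos.2 (Finset.Nonempty.image ⟨⟨0, hpos⟩, Finset.mem_univ _⟩ _)
      exact_mod_cast this
    have hsum := hs.sum_le_of_volume_le (V := N) (by positivity)
      (by rw [ENNReal.ofReal_natCast]; exact hτ.sum_volume_le)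
    have hcard : (Finset.univ.image (s'.output I).bin).card ≤ B + 1 := by
      refine (Finset.card_le_card (t := Finset.range (B + 1)) ?_).trans (by simp)
      intro b hb
      obtain ⟨i, -, rfl⟩ := Finset.mem_image.1 hb
      have := (R.placed i (by rw [hs.num]; exact i.2)).2.2.2.2.1
      exact Finset.mem_range.2 (Nat.lt_succ_of_le this)
    have area := R.area
    rw [h16, h18, h19] at area
    have hH := R.nonneg
    have hcard' : ((Finset.univ.image (s'.output I).bin).card : ℝ) ≤ B + 1 := by
      exact_mod_cast hcard
    unfold Solution.binCount
    rw [← hN, ← ENNReal.ofReal_natCast, ← ENNReal.ofReal_natCast N,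
      ← ENNReal.ofReal_mul (by norm_num)]
    -- The area bound reads `0.525 * B + 0.7 * H ≤ 4 * N + 0.14`, so `B + 1` is even below `9 * N`.
    refine ENNReal.ofReal_le_ofReal ?_
    norm_num
    linarith

theorem squarePacking : PolyTimeSolvable
    (fun I => (∀ i, Metric.diam (I.piece i) ≤ 1 / 10) ∧
      ∑ i, volume (I.piece i) ≤ ENNReal.ofReal (1 / 10))
    (fun _ => Solution.IsSquarePacking) := by
  refine polyTimeSolvable_of_parameters smallPieces (fun _ => SmallPieces)
    (by simp [smallPieces, Program.natWrites])
    (fun a h1 h2 => by simp [smallPieces, Program.realWrites]; omega)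
    (fun I _ s _ => (runs_smallPieces s).mono (five_le_poly _) fun _ h => h)
    (fun I hd _ s hs hp => hp.good hd.1 hs) ?_ ?_
  · intro I _ h0 σ
    have : IsEmpty (Fin I.num) := by rw [h0]; infer_instance
    exact ⟨fun i => isEmptyElim i, fun i => isEmptyElim i⟩
  · intro I hd hpos s s' H B A Y hs hp R
    obtain ⟨h1, h2⟩ := R.unitSquare_of_small hd.1 hs hp
    obtain ⟨h16, h17, h18, h19, h20⟩ := hp
    have hsum := hs.sum_le_of_volume_le (by norm_num) hd.2
    -- A second bin would need `0.7 < 2 * Σ w * h + 0.14`, but the sum is at most `0.2`.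
    have hB : B = 0 := by
      by_contra hB
      have := R.area_of_pos (Nat.pos_of_ne_zero hB)
      rw [h16, h18, h19] at this
      linarith
    have hbin : ∀ i : Fin I.num, (s'.output I).bin i = 0 := fun i => by
      have : s'.nat 2 i ≤ B := (R.placed i (by rw [hs.num]; exact i.2)).2.2.2.2.1
      exact Nat.le_zero.1 (hB ▸ this)
    exact ⟨h1, fun i j hij => h2 hij (by rw [hbin, hbin])⟩

/-- A finite generating set is listed for each polygon, and the translations are read off the output
of the square packing program. -/
theorem exists_unitSquare_packing (n : ℕ) (P : Fin n → Set Plane)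
    (hP : ∀ i, IsConvexPolygon (P i)) (hd : ∀ i, Metric.diam (P i) ≤ 1 / 10)
    (hA : ∑ i, volume (P i) ≤ ENNReal.ofReal (1 / 10)) :
    ∃ v : Fin n → Plane, (∀ i, translate (v i) (P i) ⊆ unitSquare) ∧
      Pairwise fun i j => NonOverlapping (translate (v i) (P i)) (translate (v j) (P j)) := by
  have h : ∀ i, ∃ V : List Plane, P i = convexHull ℝ {p | p ∈ V} := fun i => by
    obtain ⟨⟨V, hV, e⟩, -⟩ := hP i
    exact ⟨hV.toFinset.toList, by rw [e]; simp⟩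
  choose V hV using h
  let I : PackingInstance := ⟨List.ofFn V, fun W hW => by
    obtain ⟨i, rfl⟩ := List.mem_ofFn.1 hW
    rw [← hV i]; exact (hP i).2⟩
  have hn : I.num = n := List.length_ofFn
  have hpiece : ∀ i : Fin I.num, I.piece i = P (Fin.cast hn i) := fun i => by
    have h : I.pieces.get i = V (Fin.cast hn i) := List.get_ofFn V i
    unfold PackingInstance.piece
    rw [hV, h]
  obtain ⟨Pr, q, h⟩ := squarePacking
  obtain ⟨t, s, -, -, h1, h2⟩ := h I ⟨fun i => by rw [hpiece]; exact hd _, by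
    rw [Fintype.sum_equiv (finCongr hn) _ (fun i => volume (P i)) fun i => by rw [hpiece i]; rfl]
    exact hA⟩
  have hpl : ∀ i : Fin n, (s.output I).placed (Fin.cast hn.symm i) =
      translate ((s.output I).shift (Fin.cast hn.symm i)) (P i) := fun i => by
    unfold Solution.placed
    rw [hpiece]
    rfl
  refine ⟨fun i => (s.output I).shift (Fin.cast hn.symm i), fun i => ?_, fun i j hij => ?_⟩
  · rw [← hpl]; exact h1 _
  · change NonOverlapping (translate ((s.output I).shift (Fin.cast hn.symm i)) (P i))
      (translate ((s.output I).shift (Fin.cast hn.symm j)) (P j))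
    rw [← hpl, ← hpl]
    exact h2 fun e => hij (by simpa using e)

/-! ### Strip packing -/

/-- The parameters for strip packing. -/
def stripParameters : Program :=
  .seq (findMax 10)
    (.seq (.setReal 17 (.const 0) (.read 10 (.reg 5)))
      (.seq (.setReal 16 (.const 0) (.mul (.const 2) (.reg 17)))
        (.seq (.setReal 18 (.const 0) (.const 1))
          (.seq (.setReal 19 (.const 0) (.const 1))
            (.setReal 20 (.const 0) (.mul (.const 5) (.reg 17)))))))

/-- The values that `stripParameters` computes. -/
structure StripParameters (I : PackingInstance) (s : State) : Prop where
  extent_le : ∀ i < I.num, s.real 10 i ≤ s.real 17 0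
  extent_eq : 0 < I.num → ∃ i < I.num, s.real 17 0 = s.real 10 i
  base : s.real 16 0 = 2 * s.real 17 0
  cap : s.real 18 0 = 1
  bound : s.real 19 0 = 1
  dist : s.real 20 0 = 5 * s.real 17 0

theorem runs_stripParameters {I : PackingInstance} {s : State} (h : Prepared I s) :
    Runs stripParameters s (I.num * 4 + 8) (StripParameters I) := by
  refine (Runs.seq (B' := 5) (runs_findMax 10 s) ?_).mono (by rw [h.num]) fun _ h => h
  rintro s' ⟨h1, h2, h3, h4⟩
  rw [h.num] at h3 h4
  refine runs_setReal_seq (runs_setReal_seq (runs_setReal_seq (runs_setReal_seq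
    (runs_setReal ⟨?_, fun hpos => ⟨s'.nat 5 0, h3 hpos, ?_⟩, ?_, ?_, ?_, ?_⟩)))) <;>
    simp [RealExpr.eval, NatExpr.eval, h1]
  exact h4

/-- With `T = 2 * W` a bin is a segment of length `5 * W` of the strip. A competitor of length `ℓ`
has `W ≤ ℓ` and area at most `ℓ`, so `1.5 * W * B ≤ 4 * ℓ + 4 * W`; the used length `5 * W * (B +
1)` is then at most `95 / 3 * ℓ`. -/
theorem stripPacking : PolyTimeSolvable (fun I => ∃ σ : Solution I, σ.IsStripPacking)
    (fun _ => IsApprox 32.7 Solution.IsStripPacking Solution.stripLength) := by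
  have heights : ∀ I : PackingInstance, (∃ σ : Solution I, σ.IsStripPacking) → ∀ s, Prepared I s →
      ∀ i < I.num, s.real 8 i ≤ 1 := by
    rintro I ⟨σ, hσ, -⟩ s hs i hi
    obtain ⟨p, hp, q, hq, e⟩ := (hs.shape ⟨i, hi⟩).exists_height
    simp only at e
    have h1 := (hσ _ (σ.add_shift_mem_placed hp)).2.2
    have h2 := (hσ _ (σ.add_shift_mem_placed hq)).2.1
    simp only [PiLp.add_apply] at h1 h2
    linarith
  refine polyTimeSolvable_of_parameters stripParameters StripParameters
    (by simp [stripParameters, findMax, argMin, forLoop, Program.natWrites])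
    (fun a h1 h2 => by
      simp [stripParameters, findMax, argMin, forLoop, Program.realWrites]; omega)
    (fun I _ s hs => (runs_stripParameters hs).mono ?_ fun _ h => h) ?_ ?_ ?_
  · have := I.num_le_size
    nlinarith
  · intro I hI hpos s hs hp
    obtain ⟨i, hi, e⟩ := hp.extent_eq hpos
    have := (hs.shape ⟨i, hi⟩).extent_pos
    simp only at this
    refine ⟨by rw [hp.base, e]; linarith, by rw [hp.cap]; norm_num,
      .inl (by rw [hp.cap, hp.bound]), ?_⟩
    rw [hp.bound]
    exact heights I hI s hs
  · intro I _ h0 σ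
    have : IsEmpty (Fin I.num) := by rw [h0]; infer_instance
    refine isApprox_of_forall (by norm_num) ⟨fun i => isEmptyElim i, fun i => isEmptyElim i⟩ ?_
    intro τ _
    simp [Solution.stripLength]
  · intro I hI hpos s s' H B A Y hs hp R
    obtain ⟨i₀, hi₀, e₀⟩ := hp.extent_eq hpos
    set W := s.real 17 0 with hW
    have hWpos : 0 < W := by rw [e₀]; exact (hs.shape ⟨i₀, hi₀⟩).extent_pos
    obtain ⟨g1, g2⟩ := R.solution hs.num hs.shape hp.extent_le
    rw [← hW, hp.base, hp.cap, hp.dist] at g1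
    refine isApprox_of_forall (by norm_num) ⟨fun i p hpi => ?_, fun i j hij => ?_⟩ fun τ hτ => ?_
    · obtain ⟨⟨a1, a2⟩, a3, a4, -⟩ := g1 i p hpi
      exact ⟨le_trans (by positivity) a1, a3, a4⟩
    · have sep : ∀ i j : Fin I.num, s'.nat 2 i < s'.nat 2 j →
          NonOverlapping ((s'.output I).placed i) ((s'.output I).placed j) := by
        intro i j hlt
        refine nonOverlapping_of_lines (a := 5 * W * s'.nat 2 i + 5 * W) (s := 0)
          (a' := 5 * W * s'.nat 2 j) (s' := 0) ?_ ?_ ?_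
        · intro p hpi
          have := (g1 i p hpi).1.2
          linarith
        · intro p hpj
          have := (g1 j p hpj).1.1
          linarith
        · intro p _ _
          have : (s'.nat 2 i : ℝ) + 1 ≤ s'.nat 2 j := by exact_mod_cast hlt
          nlinarith
      rcases lt_trichotomy (s'.nat 2 i) (s'.nat 2 j) with h | h | h
      · exact sep i j h
      · exact g2 i j hij h
      · exact (sep j i h).symm
    · rcases eq_or_ne τ.stripLength ⊤ with htop | hfin
      · rw [htop, ENNReal.mul_top (by simp; norm_num)]
        exact le_top
      set ℓ := τ.stripLength.toReal with hℓ
      have hℓ0 : 0 ≤ ℓ := ENNReal.toReal_nonneg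
      have hlen : τ.stripLength = ENNReal.ofReal ℓ := (ENNReal.ofReal_toReal hfin).symm
      have hle : ∀ i, ∀ p ∈ τ.placed i, p 0 ≤ ℓ := by
        intro i p hpi
        have h1 : ENNReal.ofReal (p 0) ≤ τ.stripLength :=
          le_iSup_of_le i (le_iSup₂_of_le p hpi le_rfl)
        rw [hlen] at h1
        exact (ENNReal.ofReal_le_ofReal_iff hℓ0).1 h1
      have hvol : ∑ i, volume (I.piece i) ≤ ENNReal.ofReal ℓ := by
        refine (hτ.2.sum_volume_le (R := box 0 ℓ 0 1) fun i p hpi =>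
          ⟨⟨(hτ.1 i hpi).1, hle i p hpi⟩, (hτ.1 i hpi).2⟩).trans ?_
        rw [volume_box]; simp
      have hsum := hs.sum_le_of_volume_le hℓ0 hvol
      have hWℓ : W ≤ ℓ := by
        obtain ⟨p, hp', q, hq, e⟩ := (hs.shape ⟨i₀, hi₀⟩).exists_extent
        simp only at e
        have h1 := hle _ _ (τ.add_shift_mem_placed hp')
        have h2 := (hτ.1 _ (τ.add_shift_mem_placed hq)).1
        simp only [PiLp.add_apply] at h1 h2
        linarith
      have area := R.area
      rw [hp.base, hp.cap, hp.bound, ← hW] at area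
      have hWH := mul_nonneg hWpos.le R.nonneg
      rw [hlen, ← ENNReal.ofReal_mul (by norm_num)]
      refine iSup_le fun i => iSup₂_le fun p hpi => ENNReal.ofReal_le_ofReal ?_
      have h1 := (g1 i p hpi).1.2
      have h2 : (s'.nat 2 i : ℝ) ≤ B := by
        exact_mod_cast (R.placed i (by rw [hs.num]; exact i.2)).2.2.2.2.1
      have h3 := mul_le_mul_of_nonneg_left h2 hWpos.le
      norm_num
      linarith

/-! ### Perimeter packing -/

/-- Add up the products of width and height of all pieces. -/
def sumProducts : Program :=
  .seq (.setReal 24 (.const 0) (.const 0))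
    (forLoop 3 (.const 0) (.reg 0) (.setReal 24 (.const 0)
      (.add (.reg 24) (.mul (.read 7 (.reg 3)) (.read 8 (.reg 3))))))

theorem runs_sumProducts (s : State) :
    Runs sumProducts s (s.nat 0 0 * 3 + 3) fun s' =>
      s'.real 24 0 = ∑ i ∈ Finset.range (s.nat 0 0), s.real 7 i * s.real 8 i := by
  refine (runs_setReal_seq (runs_forLoop (N := s.nat 0 0) (B := 1) (fun k s' =>
    s'.nat 0 = s.nat 0 ∧ s'.real 7 = s.real 7 ∧ s'.real 8 = s.real 8 ∧
      s'.real 24 0 = ∑ i ∈ Finset.range k, s.real 7 i * s.real 8 i) (Nat.zero_le _) ?_ ?_ ?_)).mono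
      (by simp [NatExpr.eval]; omega) fun _ h => h.2.2.2
  · intro k s' h _
    simp [NatExpr.eval, h.1]
  · simp [RealExpr.eval, NatExpr.eval]
  · rintro k s' hk - ⟨h1, h2, h3, h4⟩ hc
    refine runs_setReal ?_
    simp [RealExpr.eval, NatExpr.eval, hc, h1, h2, h3, h4, Finset.sum_range_succ]

/-- Increase register `16` in steps of size register `25`, until its square is at least twice
register `24`; at most as often as register `13` tells. -/
def rootSearch : Program :=
  forLoop 3 (.const 0) (.reg 13)
    (.cond (.realLt (.mul (.reg 16) (.reg 16)) (.add (.reg 24) (.reg 24)))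
      (.setReal 16 (.const 0) (.add (.reg 16) (.reg 25))) .skip)

/-- An increment happens only while the register is at most the root, so the overshoot is at most
one step. By `h24` the permitted number of increments reaches the target. -/
theorem runs_rootSearch {s : State} (h16 : s.real 16 0 = s.real 25 0) (h25 : 0 ≤ s.real 25 0)
    (h24 : 2 * s.real 24 0 ≤ ((s.nat 13 0 + 1) * s.real 25 0) ^ 2) :
    Runs rootSearch s (s.nat 13 0 * 4 + 2) fun s' =>
      2 * s.real 24 0 ≤ s'.real 16 0 ^ 2 ∧ s.real 25 0 ≤ s'.real 16 0 ∧
      s'.real 16 0 ≤ √(2 * s.real 24 0) + s.real 25 0 := by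
  refine (runs_forLoop (N := s.nat 13 0) (B := 2) (fun k s' =>
    s'.nat 13 = s.nat 13 ∧ s'.real 24 = s.real 24 ∧ s'.real 25 = s.real 25 ∧
      (2 * s.real 24 0 ≤ s'.real 16 0 ^ 2 ∨ s'.real 16 0 = (k + 1) * s.real 25 0) ∧
      s.real 25 0 ≤ s'.real 16 0 ∧ s'.real 16 0 ≤ √(2 * s.real 24 0) + s.real 25 0)
    (Nat.zero_le _) ?_ ?_ ?_).mono (by simp [NatExpr.eval]) ?_
  · intro k s' h _
    simp [NatExpr.eval, h.1]
  · simp [NatExpr.eval, h16, Real.sqrt_nonneg]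
  · rintro k s' hk - ⟨h1, h2, h3, h4, h5, h6⟩ hc
    refine runs_cond (B := 1) (fun hb => ?_) (fun hb => ?_)
    · simp only [Test.Holds, RealExpr.eval, NatExpr.eval, h2] at hb
      refine runs_setReal ?_
      have h7 : s'.real 16 0 ≤ √(2 * s.real 24 0) := Real.le_sqrt_of_sq_le (by nlinarith)
      have h8 : s'.real 16 0 = (k + 1) * s.real 25 0 :=
        h4.resolve_left fun h => by nlinarith
      simp [RealExpr.eval, NatExpr.eval, h1, h2, h3, hc]
      refine ⟨.inr (by rw [h8]; ring), by linarith, by simpa using h7⟩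
    · simp only [Test.Holds, RealExpr.eval, NatExpr.eval, h2] at hb
      refine runs_skip ⟨hc, by simp [h1], by simp [h2], by simp [h3], .inl ?_, h5, h6⟩
      simp only [State.writeNat_real]
      nlinarith
  · rintro s' ⟨-, -, -, h4, h5, h6⟩
    refine ⟨?_, h5, h6⟩
    rcases h4 with h4 | h4
    · exact h4
    · rwa [h4]

/-- The parameters for perimeter packing. -/
def perimeterParameters : Program :=
  .seq (findMax 10)
  (.seq (.setReal 17 (.const 0) (.read 10 (.reg 5)))
  (.seq (findMax 8)
  (.seq (.setReal 19 (.const 0) (.read 8 (.reg 5)))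
  (.seq sumProducts
  (.seq (.setReal 25 (.const 0) (.div (.add (.reg 17) (.reg 19)) (.const 32)))
  (.seq (.setReal 16 (.const 0) (.reg 25))
  -- Five doublings give `32 * n`, as natural numbers can only be added.
  (.seq (.setNat 13 (.const 0) (.add (.reg 0) (.reg 0)))
  (.seq (.setNat 13 (.const 0) (.add (.reg 13) (.reg 13)))
  (.seq (.setNat 13 (.const 0) (.add (.reg 13) (.reg 13)))
  (.seq (.setNat 13 (.const 0) (.add (.reg 13) (.reg 13)))
  (.seq (.setNat 13 (.const 0) (.add (.reg 13) (.reg 13)))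
  (.seq rootSearch
  -- This choice makes `T * C = 2 * Σ w * h + 4 * T * K`, so that the layout never opens a second
  -- bin.
  (.seq (.setReal 18 (.const 0) (.add (.div (.add (.reg 24) (.reg 24)) (.reg 16))
    (.mul (.const 4) (.reg 19))))
  (.setReal 20 (.const 0) (.const 0)))))))))))))))

/-- The values that `perimeterParameters` computes. -/
structure PerimeterParameters (I : PackingInstance) (s : State) : Prop where
  extent_le : ∀ i < I.num, s.real 10 i ≤ s.real 17 0
  extent_eq : ∃ i < I.num, s.real 17 0 = s.real 10 i
  height_le : ∀ i < I.num, s.real 8 i ≤ s.real 19 0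
  height_eq : ∃ i < I.num, s.real 19 0 = s.real 8 i
  base_sq : 2 * ∑ i ∈ Finset.range (s.nat 0 0), s.real 7 i * s.real 8 i ≤ s.real 16 0 ^ 2
  le_base : (s.real 17 0 + s.real 19 0) / 32 ≤ s.real 16 0
  base_le : s.real 16 0 ≤ √(2 * ∑ i ∈ Finset.range (s.nat 0 0), s.real 7 i * s.real 8 i) +
    (s.real 17 0 + s.real 19 0) / 32
  cap : s.real 18 0 = 2 * (∑ i ∈ Finset.range (s.nat 0 0), s.real 7 i * s.real 8 i) / s.real 16 0 +
    4 * s.real 19 0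
  dist : s.real 20 0 = 0

/-- Why `32 * n` increments suffice: each product is at most `2 * W * K`, so twice their sum is at
most `n * (W + K) ^ 2`, hence at most `(n * (W + K)) ^ 2`, and `n * (W + K)` is `32 * n` steps of
length `(W + K) / 32`. -/
theorem runs_perimeterParameters {I : PackingInstance} {s : State} (h : Prepared I s)
    (hpos : 0 < I.num) :
    Runs perimeterParameters s (I.num * 139 + 22) (PerimeterParameters I) := by
  refine (Runs.seq (B' := I.num * 135 + 19) (runs_findMax 10 s) ?_).mono
    (by rw [h.num]; omega) fun _ h => h
  rintro s₁ ⟨r1, n1, i1, m1⟩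
  refine (runs_setReal_seq (B := I.num * 135 + 18) ?_).mono (by omega) fun _ h => h
  simp only [RealExpr.eval, NatExpr.eval, r1]
  set W := s.real 10 (s₁.nat 5 0) with hW
  generalize hs₂ : s₁.writeReal 17 0 W = s₂
  have r2 : ∀ a, a ≠ 17 → s₂.real a = s.real a := fun a ha => by rw [← hs₂]; simp [ha, r1]
  have w2 : s₂.real 17 0 = W := by rw [← hs₂]; simp
  have n2 : s₂.nat 0 = s.nat 0 := by rw [← hs₂]; simp [n1 0]
  clear hs₂
  refine (Runs.seq (B' := I.num * 131 + 15) (runs_findMax 8 s₂) ?_).mono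
    (by rw [n2, h.num]; omega) fun _ h => h
  rintro s₃ ⟨r3, n3, i3, m3⟩
  refine (runs_setReal_seq (B := I.num * 131 + 14) ?_).mono (by omega) fun _ h => h
  simp only [RealExpr.eval, NatExpr.eval, r3, r2 8 (by decide)]
  set K := s.real 8 (s₃.nat 5 0) with hK
  generalize hs₄ : s₃.writeReal 19 0 K = s₄
  have r4 : ∀ a, a ≠ 17 → a ≠ 19 → s₄.real a = s.real a := fun a ha ha' => by
    rw [← hs₄]; simp [ha', r3, r2 a ha]
  have w4 : s₄.real 17 0 = W := by rw [← hs₄]; simp [r3, w2]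
  have k4 : s₄.real 19 0 = K := by rw [← hs₄]; simp
  have n4 : s₄.nat 0 = s.nat 0 := by rw [← hs₄]; simp [n3 0, n2]
  clear hs₄
  rw [n2] at i3 m3
  rw [h.num] at i1 i3 m1 m3
  rw [r2 8 (by decide)] at m3
  refine (Runs.seq (B' := I.num * 128 + 11) (runs_sumProducts s₄).frame ?_).mono
    (by rw [n4, h.num]; omega) fun _ h => h
  rintro s₅ ⟨h5, F5⟩
  have r5 : ∀ a, a ≠ 24 → s₅.real a = s₄.real a := fun a ha =>
    F5.real a (by simp [sumProducts, forLoop, Program.realWrites, ha])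
  have n5 : s₅.nat 0 = s.nat 0 := by
    rw [F5.nat 0 (by simp [sumProducts, forLoop, Program.natWrites]), n4]
  rw [n4, r4 7 (by decide) (by decide), r4 8 (by decide) (by decide)] at h5
  set S := ∑ i ∈ Finset.range (s.nat 0 0), s.real 7 i * s.real 8 i with hS
  refine (runs_setReal_seq (runs_setReal_seq (runs_setNat_seq (runs_setNat_seq (runs_setNat_seq
    (runs_setNat_seq (runs_setNat_seq (B := I.num * 128 + 4) ?_))))))).mono (by omega) fun _ h => h
  generalize hs₆ : State.writeNat _ 13 _ _ = s₆
  have r6 : ∀ a, a ≠ 16 → a ≠ 25 → s₆.real a = s₅.real a := fun a ha ha' => by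
    rw [← hs₆]; simp [ha, ha']
  have e6 : s₆.real 25 0 = (W + K) / 32 := by
    rw [← hs₆]; simp [RealExpr.eval, NatExpr.eval, r5 17, r5 19, w4, k4]
  have t6 : s₆.real 16 0 = (W + K) / 32 := by
    rw [← hs₆]; simp [RealExpr.eval, NatExpr.eval, r5 17, r5 19, w4, k4]
  have c6 : s₆.nat 13 0 = I.num * 32 := by
    rw [← hs₆]; simp [NatExpr.eval, n5, h.num]; omega
  have n6 : s₆.nat 0 = s.nat 0 := by rw [← hs₆]; simp [n5]
  have S6 : s₆.real 24 0 = S := by rw [r6 24 (by decide) (by decide), h5]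
  clear hs₆
  have hWpos : 0 < W := (h.shape ⟨_, i1 hpos⟩).extent_pos
  have hKpos : 0 < K := (h.shape ⟨_, i3 hpos⟩).height_pos
  have hSle : S ≤ I.num * (2 * W * K) := by
    rw [hS, h.num]
    refine (Finset.sum_le_card_nsmul _ _ (2 * W * K) ?_).trans (by simp)
    intro i hi
    have hi := Finset.mem_range.1 hi
    have Sh := h.shape ⟨i, hi⟩
    exact mul_le_mul (Sh.width_le.trans (by linarith [m1 i hi])) (m3 i hi) Sh.height_pos.le
      (by positivity)
  have hbound : 2 * s₆.real 24 0 ≤ ((s₆.nat 13 0 + 1) * s₆.real 25 0) ^ 2 := by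
    rw [S6, c6, e6]
    have hn1 : (1 : ℝ) ≤ I.num := by exact_mod_cast hpos
    have h1 : 2 * S ≤ I.num * (W + K) ^ 2 := by nlinarith [sq_nonneg (W - K)]
    have h2 : (I.num : ℝ) * (W + K) ^ 2 ≤ (I.num * (W + K)) ^ 2 := by
      have := sq_nonneg (W + K)
      nlinarith
    refine h1.trans (h2.trans (pow_le_pow_left₀ (by positivity) ?_ 2))
    push_cast
    linarith
  refine (Runs.seq (B' := 2) (runs_rootSearch (t6.trans e6.symm) (by rw [e6]; positivity)
    hbound).frame ?_).mono (by rw [c6]; omega) fun _ h => h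
  rintro s₇ ⟨⟨g1, g2, g3⟩, F7⟩
  rw [S6] at g1 g3
  rw [e6] at g2 g3
  have r7 : ∀ a, a ≠ 16 → s₇.real a = s₆.real a := fun a ha =>
    F7.real a (by simp [rootSearch, forLoop, Program.realWrites, ha])
  have n7 : s₇.nat 0 = s.nat 0 := by
    rw [F7.nat 0 (by simp [rootSearch, forLoop, Program.natWrites]), n6]
  have o7 : ∀ a, a ≤ 10 → s₇.real a = s.real a := fun a ha => by
    rw [r7 a (by omega), r6 a (by omega) (by omega), r5 a (by omega), r4 a (by omega) (by omega)]
  have w7 : s₇.real 17 0 = W := by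
    rw [r7 17 (by decide), r6 17 (by decide) (by decide), r5 17 (by decide), w4]
  have k7 : s₇.real 19 0 = K := by
    rw [r7 19 (by decide), r6 19 (by decide) (by decide), r5 19 (by decide), k4]
  have S7 : s₇.real 24 0 = S := by rw [r7 24 (by decide), S6]
  refine runs_setReal_seq (runs_setReal ?_)
  refine ⟨?_, ⟨s₁.nat 5 0, i1 hpos, ?_⟩, ?_, ⟨s₃.nat 5 0, i3 hpos, ?_⟩, ?_, ?_, ?_, ?_, ?_⟩ <;>
    simp [RealExpr.eval, NatExpr.eval, w7, k7, S7, o7 7, o7 8, o7 10, n7, ← hS, ← two_mul]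
  · exact m1
  · exact hW
  · exact m3
  · exact hK
  · exact g1
  · exact g2
  · simpa using g3

theorem Solution.isCompact_hull {I : PackingInstance} (σ : Solution I) :
    IsCompact (convexHull ℝ (⋃ i, σ.placed i)) := by
  set V := ⋃ i, translate (σ.shift i) {p | p ∈ I.pieces.get i} with hV
  have hfin : V.Finite := Set.finite_iUnion fun i => (List.finite_toSet (I.pieces.get i)).image _
  have h : convexHull ℝ (⋃ i, σ.placed i) = convexHull ℝ V := by
    refine (convexHull_min (Set.iUnion_subset fun i => ?_) (convex_convexHull ℝ _)).antisymm
      (convexHull_mono (Set.iUnion_mono fun i => Set.image_mono (subset_convexHull ℝ _)))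
    refine Set.image_subset_iff.2 (convexHull_min ?_
      ((convex_convexHull ℝ V).translate_preimage_left (σ.shift i)))
    exact fun p hp => subset_convexHull ℝ _ (Set.mem_iUnion.2 ⟨i, p, hp, rfl⟩)
  rw [h]
  exact hfin.isCompact_convexHull ℝ

theorem Solution.interior_hull_nonempty {I : PackingInstance} (σ : Solution I) (hpos : 0 < I.num) :
    (interior (convexHull ℝ (⋃ i, σ.placed i))).Nonempty :=
  (interior_translate _ (I.interior_piece_nonempty ⟨0, hpos⟩)).mono (interior_mono
    ((Set.subset_iUnion σ.placed ⟨0, hpos⟩).trans (subset_convexHull ℝ _)))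

theorem PerimeterParameters.extent_pos {I : PackingInstance} {s : State}
    (hp : PerimeterParameters I s) (hs : Prepared I s) : 0 < s.real 17 0 := by
  obtain ⟨i, hi, e⟩ := hp.extent_eq
  rw [e]; exact (hs.shape ⟨i, hi⟩).extent_pos

theorem PerimeterParameters.height_pos {I : PackingInstance} {s : State}
    (hp : PerimeterParameters I s) (hs : Prepared I s) : 0 < s.real 19 0 := by
  obtain ⟨i, hi, e⟩ := hp.height_eq
  rw [e]; exact (hs.shape ⟨i, hi⟩).height_pos

theorem PerimeterParameters.base_pos {I : PackingInstance} {s : State}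
    (hp : PerimeterParameters I s) (hs : Prepared I s) : 0 < s.real 16 0 := by
  have := hp.extent_pos hs
  have := hp.height_pos hs
  have := hp.le_base
  linarith

theorem PerimeterParameters.good {I : PackingInstance} {s : State}
    (hp : PerimeterParameters I s) (hs : Prepared I s) : GoodParameters I s := by
  have hK := hp.height_pos hs
  have hT := hp.base_pos hs
  have hC : 4 * s.real 19 0 ≤ s.real 18 0 := by
    rw [hp.cap]
    have := div_nonneg (mul_nonneg zero_le_two hs.sum_nonneg) hT.le
    linarith
  exact ⟨hT, by linarith, .inr hC, hp.height_le⟩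

/-- `B > 0` would give `T * C < 2 * Σ w * h + 2 * T * K`, against the choice of `C`. With one bin,
`H ≤ 2 * Σ w * h / T + 2 * K`, where the quotient is at most the root because `T` is at least the
root. The hull then lies in a rectangle with sides `T + 3 * W` and `H`. -/
theorem hullPerimeter_le {I : PackingInstance} {s s' : State} {H : ℝ} {B : ℕ} {A Y : ℕ → ℝ}
    (hpos : 0 < I.num) (hs : Prepared I s) (hp : PerimeterParameters I s)
    (R : LayoutResult s s' H B A Y) :
    (s'.output I).IsPlanePacking ∧
    (s'.output I).hullPerimeter ≤ ENNReal.ofReal (2 * (s.real 16 0 + 3 * s.real 17 0 +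
      (√(2 * ∑ i ∈ Finset.range (s.nat 0 0), s.real 7 i * s.real 8 i) + 2 * s.real 19 0))) := by
  have hT := hp.base_pos hs
  have hW := hp.extent_pos hs
  have hK := hp.height_pos hs
  have hB : B = 0 := by
    by_contra hB
    have := R.area_of_pos (Nat.pos_of_ne_zero hB)
    rw [hp.cap, mul_add, mul_div_cancel₀ _ hT.ne'] at this
    nlinarith [mul_pos hT hK]
  subst hB
  obtain ⟨g1, g2⟩ := R.solution hs.num hs.shape hp.extent_le
  rw [hp.dist] at g1
  have hbin : ∀ i : Fin I.num, s'.nat 2 i = 0 := fun i =>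
    Nat.le_zero.1 (R.placed i (by rw [hs.num]; exact i.2)).2.2.2.2.1
  refine ⟨fun i j hij => g2 i j hij (by rw [hbin, hbin]), ?_⟩
  have hH : H ≤ √(2 * ∑ i ∈ Finset.range (s.nat 0 0), s.real 7 i * s.real 8 i) +
      2 * s.real 19 0 := by
    have area := R.area
    have hr := Real.sqrt_le_iff.2 ⟨hT.le, hp.base_sq⟩
    have hr2 := Real.sq_sqrt (mul_nonneg zero_le_two hs.sum_nonneg)
    have hr0 := Real.sqrt_nonneg (2 * ∑ i ∈ Finset.range (s.nat 0 0), s.real 7 i * s.real 8 i)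
    set r := √(2 * ∑ i ∈ Finset.range (s.nat 0 0), s.real 7 i * s.real 8 i)
    have h1 := mul_le_mul_of_nonneg_left hr hr0
    refine le_of_mul_le_mul_left ?_ hT
    simp only [Nat.cast_zero, mul_zero, zero_add] at area
    nlinarith
  refine (perimeter_le_of_subset_box (Solution.isCompact_hull _) (convex_convexHull ℝ _)
    (Solution.interior_hull_nonempty _ hpos) (a := s.real 16 0 + 3 * s.real 17 0) (b := H)
    (by positivity) R.nonneg (convexHull_subset_box (Set.iUnion_subset fun i p hpi => ?_))).trans
    (ENNReal.ofReal_le_ofReal (by linarith))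
  obtain ⟨⟨a1, a2⟩, a3, -, a4⟩ := g1 i p hpi
  exact ⟨⟨by linarith, by linarith⟩, a3, a4 rfl⟩

/-- The diameter of the hull is at most half of its perimeter. This bounds the extents of all
pieces, and through `volume_le_of_dist_le` their total area; the products add up to at most twice
that area. -/
theorem le_hullPerimeter {I : PackingInstance} {s : State} (hpos : 0 < I.num) (hs : Prepared I s)
    (hp : PerimeterParameters I s) {τ : Solution I} (hτ : τ.IsPlanePacking) {d : ℝ} (hd : 0 ≤ d)
    (h : τ.hullPerimeter = ENNReal.ofReal (2 * d)) :
    s.real 17 0 ≤ d ∧ s.real 19 0 ≤ d ∧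
      2 * ∑ i ∈ Finset.range (s.nat 0 0), s.real 7 i * s.real 8 i ≤ 92 / 25 * d ^ 2 := by
  set S := convexHull ℝ (⋃ i, τ.placed i) with hS
  have hc : IsCompact S := τ.isCompact_hull
  have hi := τ.interior_hull_nonempty hpos
  have hdist : ∀ p ∈ S, ∀ q ∈ S, dist p q ≤ d := by
    intro p hp q hq
    have h1 := two_mul_dist_le_perimeter hc (convex_convexHull ℝ _) hi hp hq
    rw [show perimeter S = _ from h, edist_dist, ENNReal.ofReal_mul zero_le_two,
      ENNReal.ofReal_ofNat, ENNReal.mul_le_mul_iff_right two_ne_zero ENNReal.ofNat_ne_top] at h1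
    exact (ENNReal.ofReal_le_ofReal_iff hd).1 h1
  have hsub : ∀ i, τ.placed i ⊆ S := fun i =>
    (Set.subset_iUnion τ.placed i).trans (subset_convexHull ℝ _)
  have hcoord : ∀ (i : Fin I.num) (k : Fin 2), ∀ p ∈ I.piece i, ∀ q ∈ I.piece i,
      p k - q k ≤ d := by
    intro i k p hp q hq
    have := (coord_sub_le_dist _ _ k).trans (hdist _ (hsub i (τ.add_shift_mem_placed hp)) _
      (hsub i (τ.add_shift_mem_placed hq)))
    simpa using this
  refine ⟨?_, ?_, ?_⟩
  · obtain ⟨i, hi, e⟩ := hp.extent_eq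
    obtain ⟨p, hp', q, hq, e'⟩ := (hs.shape ⟨i, hi⟩).exists_extent
    simp only at e'
    rw [e, e']
    exact hcoord _ 0 p hp' q hq
  · obtain ⟨i, hi, e⟩ := hp.height_eq
    obtain ⟨p, hp', q, hq, e'⟩ := (hs.shape ⟨i, hi⟩).exists_height
    simp only at e'
    rw [e, e']
    exact hcoord _ 1 p hp' q hq
  · have := hs.sum_le_of_volume_le (by positivity) ((hτ.sum_volume_le hsub).trans
      (volume_le_of_dist_le hc (convex_convexHull ℝ _) (hi.mono interior_subset) hdist))
    linarith

theorem perimeterPacking : PolyTimeSolvable (fun _ => True)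
    (fun _ => IsApprox 8.9 Solution.IsPlanePacking Solution.hullPerimeter) := by
  refine polyTimeSolvable_of_parameters
    (.cond (.natLt (.const 0) (.reg 0)) perimeterParameters .skip)
    (fun I s => 0 < I.num → PerimeterParameters I s)
    (by simp [perimeterParameters, sumProducts, rootSearch, findMax, argMin, forLoop,
      Program.natWrites])
    (fun a h1 h2 => by
      simp [perimeterParameters, sumProducts, rootSearch, findMax, argMin, forLoop,
        Program.realWrites]
      omega)
    (fun I _ s hs => (runs_cond (B := I.num * 139 + 22) (fun hb => ?_) (fun hb => ?_)).mono ?_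
      fun _ h => h) (fun I _ hpos s hs hp => (hp hpos).good hs) ?_ ?_
  · simp only [Test.Holds, NatExpr.eval, hs.num] at hb
    exact (runs_perimeterParameters hs hb).mono le_rfl fun _ h _ => h
  · simp only [Test.Holds, NatExpr.eval, hs.num] at hb
    exact (runs_skip fun h => absurd h hb).mono (by omega) fun _ h => h
  · have := I.num_le_size
    nlinarith
  · intro I _ h0 σ
    have : IsEmpty (Fin I.num) := by rw [h0]; infer_instance
    refine isApprox_of_forall (by norm_num) (fun i => isEmptyElim i) fun τ _ => ?_
    simp [Solution.hullPerimeter, perimeter]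
  · intro I _ hpos s s' H B A Y hs hp R
    replace hp := hp hpos
    obtain ⟨g1, g2⟩ := hullPerimeter_le hpos hs hp R
    refine isApprox_of_forall (by norm_num) g1 fun τ hτ => g2.trans ?_
    rcases eq_or_ne τ.hullPerimeter ⊤ with htop | hfin
    · rw [htop, ENNReal.mul_top (by simp; norm_num)]
      exact le_top
    set d := τ.hullPerimeter.toReal / 2 with hd
    have hd0 : 0 ≤ d := div_nonneg ENNReal.toReal_nonneg zero_le_two
    have hper : τ.hullPerimeter = ENNReal.ofReal (2 * d) := by
      rw [hd, mul_div_cancel₀ _ (two_ne_zero' ℝ), ENNReal.ofReal_toReal hfin]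
    obtain ⟨hW, hK, hS⟩ := le_hullPerimeter hpos hs hp hτ hd0 hper
    -- `1.9184` is slightly above `√(92 / 25)`.
    have hr : √(2 * ∑ i ∈ Finset.range (s.nat 0 0), s.real 7 i * s.real 8 i) ≤ 1.9184 * d :=
      Real.sqrt_le_iff.2 ⟨by positivity, hS.trans (by nlinarith [sq_nonneg d])⟩
    have hT := hp.base_le
    rw [hper, ← ENNReal.ofReal_mul (by norm_num)]
    -- With `W` and `K` at most `d`, half of the perimeter is at most `(2 * 1.9184 + 3 + 2 + 2 / 32)
    -- * d`, and the factor is `8.8993`.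
    refine ENNReal.ofReal_le_ofReal ?_
    linarith

end ConvexPacking

end

/-! ### The five statements together -/

theorem theorem6 :
    -- strip packing, on all instances that can be packed into the strip at all
    ConvexPacking.PolyTimeSolvable
      (fun I => ∃ σ : ConvexPacking.Solution I, σ.IsStripPacking)
      (fun _ => ConvexPacking.IsApprox 32.7 ConvexPacking.Solution.IsStripPacking
        ConvexPacking.Solution.stripLength) ∧
    -- bin packing of pieces of diameter at most `1/10`
    ConvexPacking.PolyTimeSolvable
      (fun I => ∀ i, Metric.diam (I.piece i) ≤ 1 / 10)
      (fun _ => ConvexPacking.IsApprox 10.1 ConvexPacking.Solution.IsBinPacking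
        ConvexPacking.Solution.binCount) ∧
    -- perimeter packing
    ConvexPacking.PolyTimeSolvable
      (fun _ => True)
      (fun _ => ConvexPacking.IsApprox 8.9 ConvexPacking.Solution.IsPlanePacking
        ConvexPacking.Solution.hullPerimeter) ∧
    -- square packing of pieces of diameter and total area at most `1/10`
    ConvexPacking.PolyTimeSolvable
      (fun I => (∀ i, Metric.diam (I.piece i) ≤ 1 / 10) ∧
        ∑ i, MeasureTheory.volume (I.piece i) ≤ ENNReal.ofReal (1 / 10))
      (fun _ => ConvexPacking.Solution.IsSquarePacking) ∧
    -- every such set of convex polygons can be packed into the unit square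
    (∀ (n : ℕ) (P : Fin n → Set ConvexPacking.Plane),
      (∀ i, ConvexPacking.IsConvexPolygon (P i)) →
      (∀ i, Metric.diam (P i) ≤ 1 / 10) →
      ∑ i, MeasureTheory.volume (P i) ≤ ENNReal.ofReal (1 / 10) →
      ∃ v : Fin n → ConvexPacking.Plane,
        (∀ i, ConvexPacking.translate (v i) (P i) ⊆ ConvexPacking.unitSquare) ∧
        Pairwise fun i j => ConvexPacking.NonOverlapping
          (ConvexPacking.translate (v i) (P i)) (ConvexPacking.translate (v j) (P j))) := by
  exact ⟨ConvexPacking.stripPacking, ConvexPacking.binPacking, ConvexPacking.perimeterPacking,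
    ConvexPacking.squarePacking, ConvexPacking.exists_unitSquare_packing⟩
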